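/- Let $n\ge 3$, let $\Omega\subset\mathbb R^n$ be a bounded domain with $C^2$ boundary, outward unit normal $\nu$ and surface measure $\sigma$ on $\partial\Omega$, and let $\eta_1\in\mathbb R^n$ with $|\eta_1|=1$. Put $$\partial\Omega_{\pm,\eta_1}=\{x\in\partial\Omega:\ \pm\,\nu(x)\cdot\eta_1\ge 0\}$$ ($+$: the shadowed face, $-$: the illuminated face). For every $M\ge 0$ there is a constant $C>0$, depending only on $\Omega$, $\eta_1$ and $M$, and for every $\rho_1>0$ there is $\rho_2>\rho_1$, depending only on $\Omega$, $\eta_1$, $M$ and $\rho_1$, such that for all (complex-valued) $q\in L^\infty(\Omega)$ with $\|q\|_{L^\infty(\Omega)}\le M$, all (complex-valued) $v\in H^1_0(\Omega)\cap H^2(\Omega)$ and all $\rho>\rho_2$, $$\rho^2\int_\Omega e^{-2\rho x\cdot\eta_1}|v(x)|^2\,dx+\rho\int_{\partial\Omega_{+,\eta_1}}e^{-2\rho x\cdot\eta_1}|\partial_\nu v(x)|^2\,|\eta_1\cdot\nu(x)|\,d\sigma(x)$$ $$\le C\left[\int_\Omega e^{-2\rho x\cdot\eta_1}|(-\Delta+q)v(x)|^2\,dx+\rho\int_{\partial\Omega_{-,\eta_1}}e^{-2\rho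 x\cdot\eta_1}|\partial_\nu v(x)|^2\,|\eta_1\cdot\nu(x)|\,d\sigma(x)\right].$$ Here $\partial_\nu v=\nu\cdot\nabla v$ on $\partial\Omega$ in the sense of traces. -/

import Mathlib

open MeasureTheory Filter Topology
open scoped ContDiff NNReal ENNReal InnerProductSpace

namespace CarlemanEstimate

/-- Euclidean space `ℝⁿ`. -/
abbrev Eucl (n : ℕ) : Type := EuclideanSpace ℝ (Fin n)

/-- The `i`-th vector of the standard basis of `ℝⁿ`. -/
noncomputable abbrev stdVec {n : ℕ} (i : Fin n) : Eucl n := EuclideanSpace.single i (1 : ℝ)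

/-! ### Domains with `C²` boundary, outward normal, surface measure -/

/-- `Ω` has a `C²` boundary: near each boundary point, in suitable orthogonal coordinates given by
a unit vector `e` and the hyperplane orthogonal to `e`, the set `Ω` is the strict epigraph of
a `C²` function. -/
def HasC2Boundary {n : ℕ} (Ω : Set (Eucl n)) : Prop :=
  ∀ x ∈ frontier Ω, ∃ e : Eucl n, ‖e‖ = 1 ∧ ∃ γ : (ℝ ∙ e)ᗮ → ℝ, ContDiff ℝ 2 γ ∧
    ∃ r : ℝ, 0 < r ∧ ∀ y ∈ Metric.ball x r,
      (y ∈ Ω ↔ γ ((ℝ ∙ e)ᗮ.orthogonalProjectionOnto y) < ⟪e, y⟫_ℝ)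

/-- A bounded domain (nonempty connected open set) of `ℝⁿ` with `C²` boundary. -/
structure IsBoundedC2Domain {n : ℕ} (Ω : Set (Eucl n)) : Prop where
  isOpen : IsOpen Ω
  isConnected : IsConnected Ω
  isBounded : Bornology.IsBounded Ω
  c2Boundary : HasC2Boundary Ω

/-- `ν` is the outward unit normal to `∂Ω` at `x`: every direction making an obtuse angle with `ν`
enters `Ω` and every direction making an acute angle with `ν` leaves `Ω`. At most one vector has
this property; at a boundary point near which `Ω = {ψ < 0}` with `∇ψ ≠ 0`, it is `∇ψ / |∇ψ|`. -/
def IsOutwardUnitNormal {n : ℕ} (Ω : Set (Eucl n)) (x ν : Eucl n) : Prop :=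
  ‖ν‖ = 1 ∧ ∀ d : Eucl n,
    (⟪ν, d⟫_ℝ < 0 → ∀ᶠ t : ℝ in 𝓝[>] 0, x + t • d ∈ Ω) ∧
    (0 < ⟪ν, d⟫_ℝ → ∀ᶠ t : ℝ in 𝓝[>] 0, x + t • d ∉ Ω)

open Classical in
/-- The outward unit normal `ν(x)` to `∂Ω` at `x` (zero at points where there is none). -/
noncomputable def outwardNormal {n : ℕ} (Ω : Set (Eucl n)) (x : Eucl n) : Eucl n :=
  if h : ∃ ν, IsOutwardUnitNormal Ω x ν then h.choose else 0

/-- The surface measure `σ` on `∂Ω`: the `(n-1)`-dimensional Hausdorff measure, normalized so that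
it extends the Lebesgue measure of hyperplanes. -/
noncomputable def surfaceMeasure {n : ℕ} (Ω : Set (Eucl n)) : Measure (Eucl n) :=
  (μHE[n - 1]).restrict (frontier Ω)

/-- The `η`-shadowed face `∂Ω₊ = {x ∈ ∂Ω : ν(x)·η ≥ 0}`. -/
def shadowedFace {n : ℕ} (Ω : Set (Eucl n)) (η : Eucl n) : Set (Eucl n) :=
  {x | x ∈ frontier Ω ∧ 0 ≤ ⟪outwardNormal Ω x, η⟫_ℝ}

/-- The `η`-illuminated face `∂Ω₋ = {x ∈ ∂Ω : ν(x)·η ≤ 0}`. -/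
def illuminatedFace {n : ℕ} (Ω : Set (Eucl n)) (η : Eucl n) : Set (Eucl n) :=
  {x | x ∈ frontier Ω ∧ ⟪outwardNormal Ω x, η⟫_ℝ ≤ 0}

/-! ### Weak derivatives and Sobolev spaces (complex-valued functions)

Functions are defined on all of `ℝⁿ`, but only their values on `Ω` matter. -/

/-- `g` is the weak partial derivative `∂ᵢu` on the open set `Ω`. -/
def IsWeakPartial {n : ℕ} (Ω : Set (Eucl n)) (i : Fin n) (u g : Eucl n → ℂ) : Prop :=
  LocallyIntegrableOn u Ω volume ∧ LocallyIntegrableOn g Ω volume ∧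
    ∀ φ : Eucl n → ℝ, ContDiff ℝ ∞ φ → HasCompactSupport φ → tsupport φ ⊆ Ω →
      ∫ x in Ω, (fderiv ℝ φ x (stdVec i)) • u x = - ∫ x in Ω, φ x • g x

open Classical in
/-- The weak partial derivative `∂ᵢu` on `Ω`, which is unique up to equality almost everywhere on
`Ω` (zero if there is none). -/
noncomputable def weakPartial {n : ℕ} (Ω : Set (Eucl n)) (i : Fin n) (u : Eucl n → ℂ) :
    Eucl n → ℂ :=
  if h : ∃ g, IsWeakPartial Ω i u g then h.choose else 0

/-- `u ∈ H¹(Ω)`: `u` and all its first-order weak partial derivatives are in `L²(Ω)`. -/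
def MemH1 {n : ℕ} (Ω : Set (Eucl n)) (u : Eucl n → ℂ) : Prop :=
  MemLp u 2 (volume.restrict Ω) ∧
    ∀ i : Fin n, ∃ g : Eucl n → ℂ, IsWeakPartial Ω i u g ∧ MemLp g 2 (volume.restrict Ω)

/-- `u ∈ H²(Ω)`: `u` and all its first-order weak partial derivatives are in `H¹(Ω)`. -/
def MemH2 {n : ℕ} (Ω : Set (Eucl n)) (u : Eucl n → ℂ) : Prop :=
  MemH1 Ω u ∧ ∀ i : Fin n, MemH1 Ω (weakPartial Ω i u)

/-- The smooth functions `w k` converge to `u` in `H¹(Ω)`. -/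
def TendstoH1 {n : ℕ} (Ω : Set (Eucl n)) (w : ℕ → Eucl n → ℂ) (u : Eucl n → ℂ) : Prop :=
  Tendsto (fun k => eLpNorm (fun x => w k x - u x) 2 (volume.restrict Ω)) atTop (𝓝 0) ∧
    ∀ i : Fin n, Tendsto
      (fun k => eLpNorm (fun x => fderiv ℝ (w k) x (stdVec i) - weakPartial Ω i u x) 2
        (volume.restrict Ω)) atTop (𝓝 0)

/-- `u ∈ H¹₀(Ω)`: `u ∈ H¹(Ω)` is in the `H¹(Ω)`-closure of the smooth functions with compact
support in `Ω`. -/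
def MemH10 {n : ℕ} (Ω : Set (Eucl n)) (u : Eucl n → ℂ) : Prop :=
  MemH1 Ω u ∧ ∃ w : ℕ → Eucl n → ℂ,
    (∀ k, ContDiff ℝ ∞ (w k) ∧ HasCompactSupport (w k) ∧ tsupport (w k) ⊆ Ω) ∧ TendstoH1 Ω w u

/-- The Laplacian `Δu` on `Ω` in the weak sense. -/
noncomputable def weakLaplacian {n : ℕ} (Ω : Set (Eucl n)) (u : Eucl n → ℂ) : Eucl n → ℂ :=
  fun x => ∑ i : Fin n, weakPartial Ω i (weakPartial Ω i u) x

/-! ### Boundary traces -/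

/-- `g ∈ L²(∂Ω)` is the trace on `∂Ω` of `u ∈ H¹(Ω)`: the limit in `L²(∂Ω)` of the restrictions to
`∂Ω` of functions, smooth up to the boundary, which converge to `u` in `H¹(Ω)`. -/
def IsSobolevTrace {n : ℕ} (Ω : Set (Eucl n)) (u g : Eucl n → ℂ) : Prop :=
  MemH1 Ω u ∧ MemLp g 2 (surfaceMeasure Ω) ∧ ∃ w : ℕ → Eucl n → ℂ,
    (∀ k, ContDiff ℝ ∞ (w k)) ∧ TendstoH1 Ω w u ∧
    Tendsto (fun k => eLpNorm (fun x => w k x - g x) 2 (surfaceMeasure Ω)) atTop (𝓝 0)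

open Classical in
/-- The trace on `∂Ω` of `u ∈ H¹(Ω)`, which is unique up to equality almost everywhere for the
surface measure (zero if there is none). -/
noncomputable def sobolevTrace {n : ℕ} (Ω : Set (Eucl n)) (u : Eucl n → ℂ) : Eucl n → ℂ :=
  if h : ∃ g, IsSobolevTrace Ω u g then h.choose else 0

/-- The normal derivative `∂_ν v = ν · ∇v` on `∂Ω` of `v ∈ H²(Ω)`, where `∇v` is taken on `∂Ω` in
the sense of traces. -/
noncomputable def normalDeriv {n : ℕ} (Ω : Set (Eucl n)) (v : Eucl n → ℂ) : Eucl n → ℂ :=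
  fun x => ∑ i : Fin n, (outwardNormal Ω x i : ℂ) * sobolevTrace Ω (weakPartial Ω i v) x

end CarlemanEstimate

/-! Write m = e^{-2ρ x·η} and w = e^{-ρ x·η} v. Then e^{-ρ x·η} Δv = (Δ + ρ²)w + 2ρ ∂_η w. Because v
vanishes on ∂Ω, the cross term of the two summands is a pure boundary term: 4ρ Re ∫ (Δ + ρ²)w ·
conj(∂_η w) = 2ρ ∫_{∂Ω} (ν·η) m |∂_ν v|². Discarding the square of (Δ + ρ²)w leaves a lower bound
for ∫ m |Δv|², which is `carleman_laplacian`. The function w is never formed: `conjDeriv` is X = ∂_η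
v - ρv = e^{ρ x·η} ∂_η w, and the cross term is assembled from the weighted identities `rellich`,
`pairing_laplacian_self` and `pairing_dirDeriv_self`.

The rest of the argument is short. If |x·η| ≤ R on Ω, the one-dimensional Poincaré inequality for w
(`weighted_poincare`) bounds 4ρ² ∫ m |X|² below by R⁻² ρ² ∫ m |v|². The potential costs a multiple
of M² ∫ m |v|², which is absorbed on the left once ρ ≥ 2RM. The sign of ν·η keeps the shadowed part
of the boundary term on the left and moves the illuminated part to the right
(`integral_frontier_eq_sub`).

Most of the work justifies the integrations by parts for v merely in H² ∩ H¹₀. Flattening the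
boundary in graph charts gives a divergence theorem (`BoundaryAtlas.setIntegral_fderiv`) for a
measure `area` built from the charts. This measure is not identified with the Hausdorff surface
measure: each is bounded by a constant times the other (`area_le`, `surfaceMeasure_le`), and the
constant C of the estimate absorbs both factors. One-sided mollification shows that smooth functions
are dense in H¹ (`MemH1.exists_smooth_approx`), and with the trace inequality this yields traces and
Green's formula (`HasTrace.green`). Finally, the trace of ∇v is parallel to ν (`ae_trace_grad_eq`),
so the boundary term of the Rellich identity involves only |∂_ν v|². -/

namespace CarlemanEstimate

/-! ### Flattening a graph, and the divergence theorem on an epigraph. -/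

section Graph

variable {n : ℕ} {e : Eucl n}

/-- The orthogonal projection onto the hyperplane orthogonal to `e`. -/
noncomputable abbrev hyperProj (e : Eucl n) : Eucl n →L[ℝ] (ℝ ∙ e)ᗮ :=
  (ℝ ∙ e)ᗮ.orthogonalProjectionOnto

theorem hyperProj_add_smul (y : (ℝ ∙ e)ᗮ) (s : ℝ) :
    hyperProj e ((y : Eucl n) + s • e) = y := by
  have h : hyperProj e e = 0 := by
    apply Submodule.orthogonalProjectionOnto_apply_of_mem_orthogonal
    rw [Submodule.orthogonal_orthogonal]
    exact Submodule.mem_span_singleton_self e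
  rw [map_add, map_smul, h, smul_zero, add_zero]
  exact Submodule.orthogonalProjectionOnto_mem_subspace_eq_self y

theorem inner_coe_hyperplane (y : (ℝ ∙ e)ᗮ) : ⟪e, (y : Eucl n)⟫_ℝ = 0 :=
  Submodule.mem_orthogonal_singleton_iff_inner_right.1 y.2

theorem inner_add_smul (he : ‖e‖ = 1) (y : (ℝ ∙ e)ᗮ) (s : ℝ) :
    ⟪e, (y : Eucl n) + s • e⟫_ℝ = s := by
  rw [inner_add_right, inner_coe_hyperplane, inner_smul_right, real_inner_self_eq_norm_sq, he]
  simp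

theorem hyperProj_add_inner_smul (he : ‖e‖ = 1) (x : Eucl n) :
    (hyperProj e x : Eucl n) + ⟪e, x⟫_ℝ • e = x := by
  have h1 := Submodule.starProjection_add_starProjection_orthogonal (K := ℝ ∙ e) x
  rw [Submodule.starProjection_unit_singleton ℝ he] at h1
  rw [add_comm]
  exact h1

/-- The height of `x` above the graph of `γ` in the direction `e`. -/
noncomputable def graphHeight (e : Eucl n) (γ : (ℝ ∙ e)ᗮ → ℝ) (x : Eucl n) : ℝ :=
  ⟪e, x⟫_ℝ - γ (hyperProj e x)

/-- The point of the graph of `γ` above `y`. -/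
noncomputable def graphPoint (e : Eucl n) (γ : (ℝ ∙ e)ᗮ → ℝ) (y : (ℝ ∙ e)ᗮ) : Eucl n :=
  (y : Eucl n) + γ y • e

/-- Coordinates of `ℝⁿ` adapted to the graph of `γ`: the projection and the height. -/
noncomputable def graphHomeo (he : ‖e‖ = 1) {γ : (ℝ ∙ e)ᗮ → ℝ} (hγ : Continuous γ) :
    (ℝ ∙ e)ᗮ × ℝ ≃ₜ Eucl n where
  toFun p := (p.1 : Eucl n) + (γ p.1 + p.2) • e
  invFun x := (hyperProj e x, graphHeight e γ x)
  left_inv p := by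
    simp only [graphHeight, hyperProj_add_smul, inner_add_smul he]
    ext <;> simp
  right_inv x := by
    simp only [graphHeight]
    rw [add_sub_cancel]
    exact hyperProj_add_inner_smul he x
  continuous_toFun := by fun_prop
  continuous_invFun := by unfold graphHeight; fun_prop

theorem measurePreserving_add_smul (he : ‖e‖ = 1) :
    MeasurePreserving (fun p : (ℝ ∙ e)ᗮ × ℝ => (p.1 : Eucl n) + p.2 • e)
      (volume.prod volume) volume := by
  have h1 := ((ℝ ∙ e).measurePreserving_measurableEquivProd (0 : Eucl n)).symm
  rw [InnerProductSpace.euclideanHausdorffMeasure_eq_volume] at h1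
  have h2 : MeasurePreserving (LinearIsometryEquiv.toSpanUnitSingleton e he :
      ℝ ≃ₗᵢ[ℝ] (ℝ ∙ e)) := LinearIsometryEquiv.measurePreserving _
  have h3 : MeasurePreserving (Prod.swap : (ℝ ∙ e)ᗮ × ℝ → ℝ × (ℝ ∙ e)ᗮ)
      (volume.prod volume) (volume.prod volume) := Measure.measurePreserving_swap
  have h4 := h1.comp ((h2.prod (MeasurePreserving.id (volume : Measure (ℝ ∙ e)ᗮ))).comp h3)
  have h5 : (fun p : (ℝ ∙ e)ᗮ × ℝ => (p.1 : Eucl n) + p.2 • e) =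
      ((ℝ ∙ e).measurableEquivProd (0 : Eucl n)).symm ∘
        Prod.map (LinearIsometryEquiv.toSpanUnitSingleton e he) id ∘ Prod.swap := by
    funext p
    simp [add_comm]
  rw [h5]
  exact h4

/-- The map is a shear followed by an orthogonal change of coordinates. On each vertical line the
shear is a translation, so there is no Jacobian. -/
theorem measurePreserving_graphHomeo (he : ‖e‖ = 1) {γ : (ℝ ∙ e)ᗮ → ℝ} (hγ : Continuous γ) :
    MeasurePreserving (graphHomeo he hγ) (volume.prod volume) volume := by
  have h1 : MeasurePreserving (fun p : (ℝ ∙ e)ᗮ × ℝ => (p.1, γ p.1 + p.2))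
      (volume.prod volume) (volume.prod volume) := by
    refine (MeasurePreserving.id (volume : Measure (ℝ ∙ e)ᗮ)).skew_product
      (g := fun y t => γ y + t) (by fun_prop) ?_
    exact Eventually.of_forall fun y => (measurePreserving_add_left volume (γ y)).map_eq
  exact (measurePreserving_add_smul he).comp h1

theorem integral_fderiv_eq_zero {E : Type*} [NormedAddCommGroup E] [NormedSpace ℝ E]
    [FiniteDimensional ℝ E] [MeasurableSpace E] [BorelSpace E] {μ : Measure E}
    [μ.IsAddHaarMeasure] {a : E → ℂ} (ha : ContDiff ℝ 1 a) (hs : HasCompactSupport a) (d : E) :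
    ∫ x, fderiv ℝ a x d ∂μ = 0 := by
  have hc : Continuous fun x => fderiv ℝ a x d :=
    (ha.continuous_fderiv one_ne_zero).clm_apply continuous_const
  have hcs : HasCompactSupport fun x => fderiv ℝ a x d := hs.fderiv_apply ℝ d
  have := integral_smul_fderiv_eq_neg_fderiv_smul_of_integrable (𝕜 := ℝ) (μ := μ)
    (f := fun _ : E => (1 : ℝ)) (g := a) (v := d) (by simp)
    (by simpa using hc.integrable_of_hasCompactSupport hcs)
    (by simpa using ha.continuous.integrable_of_hasCompactSupport hs)
    (by fun_prop) (fun x _ => (ha.differentiable one_ne_zero) x)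
  simpa using this

/-- In flattened coordinates the domain is the half-space t > 0. The derivative along d splits into
a horizontal one, which integrates to zero over each slice t = const, and a multiple of the vertical
one, which integrates over each ray to minus its boundary value. The multiple depends on the base
point only, so it leaves the inner integral undifferentiated and C¹ regularity of γ suffices. -/
theorem integral_epigraph_fderiv (he : ‖e‖ = 1) {γ : (ℝ ∙ e)ᗮ → ℝ} (hγ : ContDiff ℝ 1 γ)
    {a : Eucl n → ℂ} (ha : ContDiff ℝ 1 a) (hs : HasCompactSupport a) (d : Eucl n) :
    ∫ x in {x | 0 < graphHeight e γ x}, fderiv ℝ a x d =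
      ∫ y, (fderiv ℝ γ y (hyperProj e d) - ⟪e, d⟫_ℝ) • a (graphPoint e γ y) := by
  set Ψ := graphHomeo he hγ.continuous with hΨ
  have hΨa (p) : Ψ p = (p.1 : Eucl n) + (γ p.1 + p.2) • e := rfl
  have hheight (p : (ℝ ∙ e)ᗮ × ℝ) : graphHeight e γ (Ψ p) = p.2 :=
    congrArg Prod.snd (Ψ.left_inv p)
  set b : (ℝ ∙ e)ᗮ × ℝ → ℂ := a ∘ Ψ with hb
  have hΨd (p : (ℝ ∙ e)ᗮ × ℝ) : HasFDerivAt Ψ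
      ((ℝ ∙ e)ᗮ.subtypeL ∘L ContinuousLinearMap.fst ℝ _ _ +
        ((fderiv ℝ γ p.1) ∘L ContinuousLinearMap.fst ℝ _ _ +
          ContinuousLinearMap.snd ℝ _ _).smulRight e) p := by
    have h1 : HasFDerivAt (fun p : (ℝ ∙ e)ᗮ × ℝ => γ p.1)
        ((fderiv ℝ γ p.1) ∘L ContinuousLinearMap.fst ℝ _ _) p :=
      ((hγ.differentiable one_ne_zero) p.1).hasFDerivAt.comp p hasFDerivAt_fst
    exact (((ℝ ∙ e)ᗮ.subtypeL ∘L ContinuousLinearMap.fst ℝ _ ℝ).hasFDerivAt).add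
      ((h1.add hasFDerivAt_snd).smul_const e)
  have hbC : ContDiff ℝ 1 b := by
    refine ha.comp ?_
    have : ContDiff ℝ 1 fun p : (ℝ ∙ e)ᗮ × ℝ => (ℝ ∙ e)ᗮ.subtypeL p.1 + (γ p.1 + p.2) • e := by
      fun_prop
    exact this
  have hbs : HasCompactSupport b := hs.comp_homeomorph Ψ
  set s : (ℝ ∙ e)ᗮ → ℝ := fun y => ⟪e, d⟫_ℝ - fderiv ℝ γ y (hyperProj e d) with hsdef
  have hdecomp (p : (ℝ ∙ e)ᗮ × ℝ) : fderiv ℝ a (Ψ p) d =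
      fderiv ℝ b p (hyperProj e d, 0) + s p.1 • fderiv ℝ b p (0, 1) := by
    have h1 : HasFDerivAt b _ p :=
      (((ha.differentiable one_ne_zero) (Ψ p)).hasFDerivAt).comp p (hΨd p)
    rw [h1.fderiv, ← map_smul, ← map_add]
    simp only [ContinuousLinearMap.comp_apply]
    congr 1
    simp only [hsdef, Prod.smul_mk, smul_zero, Prod.mk_add_mk, add_zero, zero_add, smul_eq_mul,
      mul_one, add_apply, ContinuousLinearMap.comp_apply,
      ContinuousLinearMap.smulRight_apply, ContinuousLinearMap.coe_fst',
      ContinuousLinearMap.coe_snd', add_sub_cancel, Submodule.subtypeL_apply]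
    exact (hyperProj_add_inner_smul he d).symm
  have hcont (w) : Continuous fun p => fderiv ℝ b p w :=
    (hbC.continuous_fderiv one_ne_zero).clm_apply continuous_const
  have hcs (w) : HasCompactSupport fun p => fderiv ℝ b p w := hbs.fderiv_apply ℝ w
  have hsc : Continuous s := by
    have := (hγ.continuous_fderiv one_ne_zero).clm_apply
      (continuous_const (y := hyperProj e d))
    fun_prop
  have hint1 : Integrable (fun p => fderiv ℝ b p (hyperProj e d, 0)) (volume.prod volume) :=
    (hcont _).integrable_of_hasCompactSupport (hcs _)
  have hint2 : Integrable (fun p => s p.1 • fderiv ℝ b p (0, 1)) (volume.prod volume) :=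
    ((hsc.comp continuous_fst).smul (hcont _)).integrable_of_hasCompactSupport (hcs _).smul_left
  have hmeas : MeasurableSet {p : (ℝ ∙ e)ᗮ × ℝ | 0 < p.2} :=
    measurableSet_lt measurable_const measurable_snd
  have hset : {p : (ℝ ∙ e)ᗮ × ℝ | 0 < p.2} = Set.univ ×ˢ Set.Ioi (0 : ℝ) := by
    ext p; simp
  have hpre : Ψ ⁻¹' {x | 0 < graphHeight e γ x} = {p | 0 < p.2} := by
    ext p; simp [hheight]
  have hinc (τ : (ℝ ∙ e)ᗮ) (t : ℝ) : ∫ y, fderiv ℝ b (y, t) (τ, 0) = 0 := by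
    have hcl : Topology.IsClosedEmbedding fun y : (ℝ ∙ e)ᗮ => (y, t) :=
      Function.LeftInverse.isClosedEmbedding (f := Prod.fst) (fun _ => rfl) (by fun_prop)
        (by fun_prop)
    have h := integral_fderiv_eq_zero (μ := volume) (a := fun y => b (y, t))
      (hbC.comp (by fun_prop)) (hbs.comp_isClosedEmbedding hcl) τ
    rw [← h]
    refine integral_congr_ae (Eventually.of_forall fun y => ?_)
    have h1 : HasFDerivAt (fun y => b (y, t)) _ y :=
      HasFDerivAt.comp (g := b) y ((hbC.differentiable one_ne_zero) (y, t)).hasFDerivAt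
        (hasFDerivAt_prodMk_left y t)
    simp [h1.fderiv]
  have hinc2 (y : (ℝ ∙ e)ᗮ) : ∫ t in Set.Ioi (0 : ℝ), fderiv ℝ b (y, t) (0, 1) = - b (y, 0) := by
    have hcl : Topology.IsClosedEmbedding fun t : ℝ => (y, t) :=
      Function.LeftInverse.isClosedEmbedding (f := Prod.snd) (fun _ => rfl) (by fun_prop)
        (by fun_prop)
    have hcomp := hbs.comp_isClosedEmbedding hcl
    have hd (t : ℝ) : deriv (fun t => b (y, t)) t = fderiv ℝ b (y, t) (0, 1) := by
      have h1 : HasFDerivAt (fun t => b (y, t)) _ t :=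
        HasFDerivAt.comp (g := b) t ((hbC.differentiable one_ne_zero) (y, t)).hasFDerivAt
          (hasFDerivAt_prodMk_right y t)
      simpa using h1.hasDerivAt.deriv
    have h := HasCompactSupport.integral_Ioi_deriv_eq (f := fun t => b (y, t))
      (hbC.comp (by fun_prop)) hcomp 0
    simpa only [hd] using h
  rw [← (measurePreserving_graphHomeo he hγ.continuous).setIntegral_preimage_emb
    Ψ.measurableEmbedding, ← hΨ, hpre]
  simp only [hdecomp]
  rw [integral_add hint1.integrableOn hint2.integrableOn, hset]
  have e1 : ∫ p in Set.univ ×ˢ Set.Ioi (0 : ℝ), fderiv ℝ b p (hyperProj e d, 0)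
      ∂(volume.prod volume) = 0 := by
    rw [← Measure.prod_restrict, Measure.restrict_univ, integral_prod_symm _ (by
      rw [← Measure.restrict_univ (μ := (volume : Measure (ℝ ∙ e)ᗮ)), Measure.prod_restrict]
      exact hint1.integrableOn)]
    simp [hinc]
  have e2 : ∫ p in Set.univ ×ˢ Set.Ioi (0 : ℝ), s p.1 • fderiv ℝ b p (0, 1)
      ∂(volume.prod volume) = ∫ y, (- s y) • b (y, 0) := by
    rw [setIntegral_prod _ hint2.integrableOn, Measure.restrict_univ]
    refine integral_congr_ae (Eventually.of_forall fun y => ?_)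
    simp only
    rw [integral_smul, hinc2, smul_neg, neg_smul]
  rw [e1, e2, zero_add]
  refine integral_congr_ae (Eventually.of_forall fun y => ?_)
  simp [hsdef, hb, hΨa, graphPoint]

end Graph

end CarlemanEstimate

/-! ### Outward normals and C¹ graph charts. -/

namespace CarlemanEstimate

/-- If the two unit vectors differ, the direction ν - ν' makes an acute angle with ν and an obtuse
one with ν', so it would both leave and enter Ω. -/
theorem IsOutwardUnitNormal.unique {n : ℕ} {Ω : Set (Eucl n)} {x ν ν' : Eucl n}
    (h : IsOutwardUnitNormal Ω x ν) (h' : IsOutwardUnitNormal Ω x ν') : ν = ν' := by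
  by_contra hne
  have hlt : ⟪ν, ν'⟫_ℝ < 1 := by
    refine lt_of_le_of_ne ?_ fun h1 => hne ((inner_eq_one_iff_of_norm_eq_one h.1 h'.1).1 h1)
    simpa [h.1, h'.1] using real_inner_le_norm ν ν'
  have e1 : ⟪ν, ν⟫_ℝ = 1 := by rw [real_inner_self_eq_norm_sq, h.1]; norm_num
  have e2 : ⟪ν', ν'⟫_ℝ = 1 := by rw [real_inner_self_eq_norm_sq, h'.1]; norm_num
  have h1 := (h.2 (ν - ν')).2 (by rw [inner_sub_right, e1]; linarith)
  have h2 := (h'.2 (ν - ν')).1 (by rw [inner_sub_right, e2, real_inner_comm]; linarith)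
  obtain ⟨t, ht1, ht2⟩ := (h1.and h2).exists
  exact ht1 ht2

theorem IsOutwardUnitNormal.outwardNormal_eq {n : ℕ} {Ω : Set (Eucl n)} {x ν : Eucl n}
    (h : IsOutwardUnitNormal Ω x ν) : outwardNormal Ω x = ν := by
  have hex : ∃ ν, IsOutwardUnitNormal Ω x ν := ⟨ν, h⟩
  rw [outwardNormal, dif_pos hex]
  exact hex.choose_spec.unique h

section Chart

variable {n : ℕ}

/-- The downward normal `(∇γ, -1)` to the graph of `γ`, extended constantly in the direction `e`. -/
noncomputable def graphNormal (e : Eucl n) (γ : (ℝ ∙ e)ᗮ → ℝ) (x : Eucl n) : Eucl n :=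
  ((InnerProductSpace.toDual ℝ (ℝ ∙ e)ᗮ).symm (fderiv ℝ γ (hyperProj e x)) : (ℝ ∙ e)ᗮ) - e

theorem inner_graphNormal (e : Eucl n) (γ : (ℝ ∙ e)ᗮ → ℝ) (x d : Eucl n) :
    ⟪graphNormal e γ x, d⟫_ℝ = fderiv ℝ γ (hyperProj e x) (hyperProj e d) - ⟪e, d⟫_ℝ := by
  rw [graphNormal, inner_sub_left,
    ← Submodule.inner_orthogonalProjectionOnto_eq_of_mem_left,
    InnerProductSpace.toDual_symm_apply]

theorem continuous_graphNormal {e : Eucl n} {γ : (ℝ ∙ e)ᗮ → ℝ} (hγ : ContDiff ℝ 1 γ) :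
    Continuous (graphNormal e γ) := by
  have h1 : Continuous fun x => fderiv ℝ γ (hyperProj e x) :=
    (hγ.continuous_fderiv one_ne_zero).comp (hyperProj e).continuous
  have h2 := (InnerProductSpace.toDual ℝ (ℝ ∙ e)ᗮ).symm.continuous.comp h1
  exact (continuous_subtype_val.comp h2).sub continuous_const

theorem hyperProj_self (e : Eucl n) : hyperProj e e = 0 := by
  have := hyperProj_add_smul (e := e) 0 1
  rwa [Submodule.coe_zero, zero_add, one_smul] at this

theorem inner_graphNormal_self {e : Eucl n} (he : ‖e‖ = 1) (γ : (ℝ ∙ e)ᗮ → ℝ) (x : Eucl n) :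
    ⟪graphNormal e γ x, e⟫_ℝ = -1 := by
  rw [inner_graphNormal, hyperProj_self, real_inner_self_eq_norm_sq, he]
  simp

theorem one_le_norm_graphNormal {e : Eucl n} (he : ‖e‖ = 1) (γ : (ℝ ∙ e)ᗮ → ℝ) (x : Eucl n) :
    1 ≤ ‖graphNormal e γ x‖ := by
  have h := abs_real_inner_le_norm (graphNormal e γ x) e
  rw [inner_graphNormal_self he, he] at h
  simpa using h

theorem continuous_graphHeight {e : Eucl n} {γ : (ℝ ∙ e)ᗮ → ℝ} (hγ : Continuous γ) :
    Continuous (graphHeight e γ) := by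
  unfold graphHeight; fun_prop

theorem continuous_graphPoint {e : Eucl n} {γ : (ℝ ∙ e)ᗮ → ℝ} (hγ : Continuous γ) :
    Continuous (graphPoint e γ) := by
  unfold graphPoint; fun_prop

theorem hyperProj_graphPoint {e : Eucl n} (γ : (ℝ ∙ e)ᗮ → ℝ) (y : (ℝ ∙ e)ᗮ) :
    hyperProj e (graphPoint e γ y) = y := hyperProj_add_smul y _

theorem graphHeight_graphPoint {e : Eucl n} (he : ‖e‖ = 1) (γ : (ℝ ∙ e)ᗮ → ℝ) (y : (ℝ ∙ e)ᗮ) :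
    graphHeight e γ (graphPoint e γ y) = 0 := by
  rw [graphHeight, hyperProj_graphPoint, graphPoint, inner_add_smul he, sub_self]

theorem graphPoint_hyperProj {e : Eucl n} (he : ‖e‖ = 1) {γ : (ℝ ∙ e)ᗮ → ℝ} {x : Eucl n}
    (hx : graphHeight e γ x = 0) : graphPoint e γ (hyperProj e x) = x := by
  rw [graphPoint, ← sub_eq_zero.1 hx]
  exact hyperProj_add_inner_smul he x

theorem norm_hyperProj_le (e x : Eucl n) : ‖hyperProj e x‖ ≤ ‖x‖ :=
  Submodule.norm_orthogonalProjectionOnto_apply_le _ _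

theorem hasFDerivAt_graphHeight {e : Eucl n} {γ : (ℝ ∙ e)ᗮ → ℝ} (hγ : ContDiff ℝ 1 γ)
    (x : Eucl n) : HasFDerivAt (graphHeight e γ)
      (innerSL ℝ e - (fderiv ℝ γ (hyperProj e x)) ∘L hyperProj e) x := by
  have h1 : HasFDerivAt (fun x => γ (hyperProj e x))
      ((fderiv ℝ γ (hyperProj e x)) ∘L hyperProj e) x :=
    ((hγ.differentiable one_ne_zero) _).hasFDerivAt.comp x (hyperProj e).hasFDerivAt
  exact (innerSL ℝ e).hasFDerivAt.sub h1

/-- In the ball of radius `r` around `x₀`, the set `Ω` is the epigraph of the `C¹` function `γ`,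
which is `K`-Lipschitz below that ball. -/
structure IsGraphChart (Ω : Set (Eucl n)) (x₀ : Eucl n) (r : ℝ) (e : Eucl n)
    (γ : (ℝ ∙ e)ᗮ → ℝ) (K : ℝ≥0) : Prop where
  norm_eq : ‖e‖ = 1
  contDiff : ContDiff ℝ 1 γ
  pos : 0 < r
  mem_iff : ∀ y ∈ Metric.ball x₀ r, (y ∈ Ω ↔ 0 < graphHeight e γ y)
  lipschitz : LipschitzOnWith K γ (hyperProj e '' Metric.ball x₀ r)

/-- A C¹ function is Lipschitz near a point, and the projection is nonexpansive, so a smaller ball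
projects into the region where the Lipschitz bound holds. -/
theorem HasC2Boundary.exists_isGraphChart {Ω : Set (Eucl n)} (h : HasC2Boundary Ω)
    {x : Eucl n} (hx : x ∈ frontier Ω) :
    ∃ r e γ K, IsGraphChart Ω x r e γ K := by
  obtain ⟨e, he, γ, hγ, r, hr, hmem⟩ := h x hx
  obtain ⟨K, t, ht, hK⟩ := (hγ.of_le one_le_two).contDiffAt.exists_lipschitzOnWith
    (x := hyperProj e x)
  obtain ⟨s, hs, hst⟩ := Metric.mem_nhds_iff.1 ht
  refine ⟨min r s, e, γ, K, he, hγ.of_le one_le_two, lt_min hr hs, fun y hy => ?_, hK.mono ?_⟩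
  · rw [hmem y (Metric.ball_subset_ball (min_le_left _ _) hy), graphHeight, sub_pos]
  · rintro _ ⟨y, hy, rfl⟩
    apply hst
    rw [Metric.mem_ball, dist_eq_norm, ← map_sub]
    refine (norm_hyperProj_le _ _).trans_lt ?_
    rw [← dist_eq_norm]
    exact lt_of_lt_of_le hy (min_le_right _ _)

namespace IsGraphChart

variable {Ω : Set (Eucl n)} {x₀ : Eucl n} {r : ℝ} {e : Eucl n} {γ : (ℝ ∙ e)ᗮ → ℝ} {K : ℝ≥0}

theorem mem_frontier_iff (h : IsGraphChart Ω x₀ r e γ K) (hΩ : IsOpen Ω) {y : Eucl n}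
    (hy : y ∈ Metric.ball x₀ r) : y ∈ frontier Ω ↔ graphHeight e γ y = 0 := by
  have hcont := continuous_graphHeight h.contDiff.continuous
  rw [hΩ.frontier_eq]
  constructor
  · rintro ⟨hcl, hnot⟩
    refine le_antisymm (not_lt.1 fun hlt => hnot ((h.mem_iff y hy).2 hlt)) ?_
    by_contra! hlt
    obtain ⟨z, ⟨hz1, hz2⟩, hz3⟩ := mem_closure_iff.1 hcl
      (Metric.ball x₀ r ∩ {z | graphHeight e γ z < 0})
      (Metric.isOpen_ball.inter (isOpen_lt hcont continuous_const)) ⟨hy, hlt⟩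
    exact lt_asymm hz2 ((h.mem_iff z hz1).1 hz3)
  · intro h0
    refine ⟨?_, fun hmem => ((h.mem_iff y hy).1 hmem).ne' h0⟩
    -- Moving along `e` raises the height by exactly t, so these points lie in Ω and tend to y.
    have htend : Tendsto (fun t : ℝ => y + t • e) (𝓝[>] 0) (𝓝 y) := by
      have : Continuous fun t : ℝ => y + t • e := by fun_prop
      simpa using (this.tendsto 0).mono_left nhdsWithin_le_nhds
    refine mem_closure_of_tendsto htend ?_
    filter_upwards [htend (Metric.isOpen_ball.mem_nhds hy), self_mem_nhdsWithin] with t ht1 ht2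
    rw [h.mem_iff _ ht1]
    have hP : hyperProj e (y + t • e) = hyperProj e y := by
      rw [map_add, map_smul, hyperProj_self, smul_zero, add_zero]
    rw [graphHeight, hP, inner_add_right, inner_smul_right, real_inner_self_eq_norm_sq, h.norm_eq]
    rw [graphHeight] at h0
    have : 0 < t := ht2
    linarith

/-- The height starts at 0 and its derivative along d is minus the inner product of d with
`graphNormal`, so the sign of that product decides on which side of the graph y + td lies for small
t > 0. -/
theorem isOutwardUnitNormal (h : IsGraphChart Ω x₀ r e γ K) {y : Eucl n}
    (hy : y ∈ Metric.ball x₀ r) (h0 : graphHeight e γ y = 0) :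
    IsOutwardUnitNormal Ω y (‖graphNormal e γ y‖⁻¹ • graphNormal e γ y) := by
  have hpos : 0 < ‖graphNormal e γ y‖ := one_pos.trans_le (one_le_norm_graphNormal h.norm_eq γ y)
  refine ⟨by rw [norm_smul, norm_inv, norm_norm, inv_mul_cancel₀ hpos.ne'], fun d => ?_⟩
  have hcont : Continuous fun t : ℝ => y + t • d := by fun_prop
  have hball : ∀ᶠ t : ℝ in 𝓝[>] 0, y + t • d ∈ Metric.ball x₀ r := by
    have htend : Tendsto (fun t : ℝ => y + t • d) (𝓝[>] 0) (𝓝 y) := by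
      simpa using (hcont.tendsto 0).mono_left nhdsWithin_le_nhds
    exact htend (Metric.isOpen_ball.mem_nhds hy)
  have hder : HasDerivAt (fun t : ℝ => graphHeight e γ (y + t • d))
      (- ⟪graphNormal e γ y, d⟫_ℝ) 0 := by
    have h1 : HasDerivAt (fun t : ℝ => y + t • d) d 0 := by
      simpa using ((hasDerivAt_id (0 : ℝ)).smul_const d).const_add y
    have h2 := HasFDerivAt.comp_hasDerivAt (f := fun t : ℝ => y + t • d) (l := graphHeight e γ)
      (0 : ℝ) (by simpa using hasFDerivAt_graphHeight h.contDiff y) h1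
    have h3 : - ⟪graphNormal e γ y, d⟫_ℝ =
        (innerSL ℝ e - (fderiv ℝ γ (hyperProj e y)) ∘L hyperProj e) d := by
      rw [inner_graphNormal]
      simp
    rw [h3]
    exact h2
  have hslope := (hasDerivAt_iff_tendsto_slope.1 hder).mono_left
    (nhdsWithin_mono 0 (fun t (ht : 0 < t) => ht.ne'))
  have hinner : ⟪‖graphNormal e γ y‖⁻¹ • graphNormal e γ y, d⟫_ℝ =
      ‖graphNormal e γ y‖⁻¹ * ⟪graphNormal e γ y, d⟫_ℝ := real_inner_smul_left _ _ _
  rw [hinner]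
  have hs (t : ℝ) : slope (fun t : ℝ => graphHeight e γ (y + t • d)) 0 t =
      t⁻¹ * graphHeight e γ (y + t • d) := by
    simp [slope, h0]
  constructor
  · intro hd
    have hd' : 0 < - ⟪graphNormal e γ y, d⟫_ℝ := by
      have := neg_of_mul_neg_right hd (inv_pos.2 hpos).le
      linarith
    filter_upwards [hball, hslope (lt_mem_nhds hd'), self_mem_nhdsWithin] with t h1 h2 h3
    rw [h.mem_iff _ h1]
    have h2' : 0 < slope (fun t : ℝ => graphHeight e γ (y + t • d)) 0 t := h2
    rw [hs] at h2'
    exact (pos_iff_pos_of_mul_pos h2').1 (inv_pos.2 h3)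
  · intro hd
    have hd' : - ⟪graphNormal e γ y, d⟫_ℝ < 0 := by
      have := pos_of_mul_pos_right hd (inv_pos.2 hpos).le
      linarith
    filter_upwards [hball, hslope (gt_mem_nhds hd'), self_mem_nhdsWithin] with t h1 h2 h3
    rw [h.mem_iff _ h1]
    have h2' : slope (fun t : ℝ => graphHeight e γ (y + t • d)) 0 t < 0 := h2
    rw [hs] at h2'
    exact fun hc => lt_asymm h2' (mul_pos (inv_pos.2 h3) hc)

theorem outwardNormal_eq (h : IsGraphChart Ω x₀ r e γ K) (hΩ : IsOpen Ω) {y : Eucl n}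
    (hy : y ∈ Metric.ball x₀ r) (hyf : y ∈ frontier Ω) :
    outwardNormal Ω y = ‖graphNormal e γ y‖⁻¹ • graphNormal e γ y :=
  (h.isOutwardUnitNormal hy ((h.mem_frontier_iff hΩ hy).1 hyf)).outwardNormal_eq

/-- Moving by a small multiple of a vector close to `e` cannot leave `Ω` inside the chart. -/
theorem mem_of_add_smul_mem (h : IsGraphChart Ω x₀ r e γ K) {x ξ : Eucl n} {ε : ℝ}
    (hx : x ∈ Ω) (hε : 0 < ε) (hξ : ‖ξ‖ * (1 + K) < 1) (hxb : x ∈ Metric.ball x₀ r)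
    (hyb : x + ε • (e + ξ) ∈ Metric.ball x₀ r) : x + ε • (e + ξ) ∈ Ω := by
  rw [h.mem_iff _ hyb]
  have hx0 := (h.mem_iff _ hxb).1 hx
  have hP : hyperProj e (x + ε • (e + ξ)) = hyperProj e x + ε • hyperProj e ξ := by
    rw [map_add, map_smul, map_add, hyperProj_self, zero_add]
  have hlip := h.lipschitz.dist_le_mul _ ⟨_, hyb, rfl⟩ _ ⟨_, hxb, rfl⟩
  rw [hP, dist_eq_norm, dist_eq_norm, add_sub_cancel_left, norm_smul, Real.norm_of_nonneg hε.le]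
    at hlip
  have h1 := (abs_le.1 (Real.norm_eq_abs _ ▸ hlip)).2
  have h2 := norm_hyperProj_le e ξ
  have h3 := (abs_le.1 (abs_real_inner_le_norm e ξ)).1
  rw [h.norm_eq, one_mul] at h3
  rw [graphHeight] at hx0 ⊢
  rw [hP, inner_add_right, inner_smul_right, inner_add_right, real_inner_self_eq_norm_sq, h.norm_eq]
  -- The step raises the height by at least ε(1 - ‖ξ‖) - Kε‖ξ‖ = ε(1 - (1 + K)‖ξ‖), which is
  -- positive.
  have h4 : (K : ℝ) * (ε * ‖hyperProj e ξ‖) ≤ K * (ε * ‖ξ‖) := by gcongr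
  nlinarith [mul_pos hε (sub_pos.2 hξ), mul_le_mul_of_nonneg_left h3 hε.le]

end IsGraphChart

/-! ### Divergence theorem in one chart, and comparison of chart measure with Hausdorff measure. -/

/-- The Lebesgue measure of the hyperplane orthogonal to `e`, lifted to the part of the graph of
`γ` in a ball. -/
noncomputable def chartMeasure (x₀ : Eucl n) (r : ℝ) (e : Eucl n) (γ : (ℝ ∙ e)ᗮ → ℝ) :
    Measure (Eucl n) :=
  (Measure.map (graphPoint e γ) volume).restrict (Metric.ball x₀ r)

namespace IsGraphChart

variable {Ω : Set (Eucl n)} {x₀ : Eucl n} {r : ℝ} {e : Eucl n} {γ : (ℝ ∙ e)ᗮ → ℝ} {K : ℝ≥0}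

/-- Since `a` is supported in the chart ball, where Ω and the epigraph coincide, Ω may be replaced
by the whole epigraph. -/
theorem setIntegral_fderiv (h : IsGraphChart Ω x₀ r e γ K) {a : Eucl n → ℂ}
    (ha : ContDiff ℝ 1 a) (hs : HasCompactSupport a) (hsub : tsupport a ⊆ Metric.ball x₀ r)
    (hΩ : MeasurableSet Ω) (d : Eucl n) :
    ∫ x in Ω, fderiv ℝ a x d = ∫ x, ⟪graphNormal e γ x, d⟫_ℝ • a x ∂chartMeasure x₀ r e γ := by
  have hmeas : MeasurableSet {x | 0 < graphHeight e γ x} :=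
    (isOpen_lt continuous_const (continuous_graphHeight h.contDiff.continuous)).measurableSet
  have h1 : ∫ x in Ω, fderiv ℝ a x d = ∫ x in {x | 0 < graphHeight e γ x}, fderiv ℝ a x d := by
    rw [← integral_indicator hΩ, ← integral_indicator hmeas]
    congr 1
    ext x
    by_cases hx : x ∈ Metric.ball x₀ r
    · have := h.mem_iff x hx
      by_cases hxΩ : x ∈ Ω
      · rw [Set.indicator_of_mem hxΩ, Set.indicator_of_mem (by exact this.1 hxΩ)]
      · rw [Set.indicator_of_notMem hxΩ, Set.indicator_of_notMem (by exact fun hc => hxΩ (this.2 hc))]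
    · have h0 : fderiv ℝ a x d = 0 := by
        rw [fderiv_of_notMem_tsupport ℝ (fun hc => hx (hsub hc))]; rfl
      simp [Set.indicator_apply, h0]
  have h2 : ∫ x, ⟪graphNormal e γ x, d⟫_ℝ • a x ∂chartMeasure x₀ r e γ =
      ∫ x, ⟪graphNormal e γ x, d⟫_ℝ • a x ∂(Measure.map (graphPoint e γ) volume) := by
    refine setIntegral_eq_integral_of_forall_compl_eq_zero fun x hx => ?_
    rw [image_eq_zero_of_notMem_tsupport (fun hc => hx (hsub hc)), smul_zero]
  have hc1 : Continuous fun x => ⟪graphNormal e γ x, d⟫_ℝ :=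
    (continuous_graphNormal h.contDiff).inner continuous_const
  have hc : Continuous fun x => ⟪graphNormal e γ x, d⟫_ℝ • a x := hc1.smul ha.continuous
  rw [h1, h2, integral_epigraph_fderiv h.norm_eq h.contDiff ha hs,
    integral_map (continuous_graphPoint h.contDiff.continuous).aemeasurable
      hc.aestronglyMeasurable]
  simp only [inner_graphNormal, hyperProj_graphPoint]

theorem finrank_hyperplane (he : ‖e‖ = 1) : Module.finrank ℝ (ℝ ∙ e)ᗮ = n - 1 := by
  have h0 : e ≠ 0 := by
    rintro rfl
    simp at he
  have h1 := (ℝ ∙ e).finrank_add_finrank_orthogonal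
  rw [finrank_span_singleton h0, finrank_euclideanSpace_fin] at h1
  omega

theorem volume_hyperplane (he : ‖e‖ = 1) : (volume : Measure (ℝ ∙ e)ᗮ) = μHE[n - 1] := by
  rw [← finrank_hyperplane he, InnerProductSpace.euclideanHausdorffMeasure_eq_volume]

theorem chartMeasure_apply (h : IsGraphChart Ω x₀ r e γ K) {A : Set (Eucl n)}
    (hA : MeasurableSet A) : chartMeasure x₀ r e γ A =
      volume (graphPoint e γ ⁻¹' (A ∩ Metric.ball x₀ r)) := by
  rw [chartMeasure, Measure.restrict_apply hA,
    Measure.map_apply (continuous_graphPoint h.contDiff.continuous).measurable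
      (hA.inter measurableSet_ball)]

theorem euclideanHausdorffMeasure_image_le {X Y : Type*} [EMetricSpace X] [MeasurableSpace X]
    [BorelSpace X] [EMetricSpace Y] [MeasurableSpace Y] [BorelSpace Y] {K : ℝ≥0} {f : X → Y}
    {s : Set X} (h : LipschitzOnWith K f s) (d : ℕ) :
    μHE[d] (f '' s) ≤ (K : ℝ≥0∞) ^ d * μHE[d] s := by
  simp only [Measure.euclideanHausdorffMeasure_def, Measure.smul_apply]
  have := h.hausdorffMeasure_image_le (d := d) (Nat.cast_nonneg d)
  rw [ENNReal.rpow_natCast] at this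
  calc _ ≤ _ • ((K : ℝ≥0∞) ^ d * μH[d] s) := by
        gcongr
    _ = _ := by
        simp only [ENNReal.smul_def, smul_eq_mul]
        ring

/-- The parameter set of a piece of boundary is contained in its projection, and projecting is
1-Lipschitz, hence does not increase Hausdorff measure. -/
theorem chartMeasure_le (h : IsGraphChart Ω x₀ r e γ K) (hΩ : IsOpen Ω) :
    chartMeasure x₀ r e γ ≤ surfaceMeasure Ω := by
  refine Measure.le_iff.2 fun A hA => ?_
  rw [h.chartMeasure_apply hA, volume_hyperplane h.norm_eq, surfaceMeasure,
    Measure.restrict_apply hA]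
  have hsub : graphPoint e γ ⁻¹' (A ∩ Metric.ball x₀ r) ⊆ hyperProj e '' (A ∩ frontier Ω) := by
    intro y hy
    exact ⟨_, ⟨hy.1, (h.mem_frontier_iff hΩ hy.2).2 (graphHeight_graphPoint h.norm_eq γ y)⟩,
      hyperProj_graphPoint γ y⟩
  refine (measure_mono hsub).trans ?_
  have hl : LipschitzOnWith 1 (hyperProj e) (A ∩ frontier Ω) := by
    refine LipschitzWith.lipschitzOnWith (LipschitzWith.of_dist_le_mul fun x y => ?_)
    rw [dist_eq_norm, dist_eq_norm, ← map_sub, NNReal.coe_one, one_mul]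
    exact norm_hyperProj_le _ _
  simpa using euclideanHausdorffMeasure_image_le hl (n - 1)

/-- Conversely, the parametrization of the graph is (1 + K)-Lipschitz over the chart, so it expands
(n-1)-dimensional measure by at most (1 + K)^(n-1). -/
theorem restrict_surfaceMeasure_le (h : IsGraphChart Ω x₀ r e γ K) (hΩ : IsOpen Ω) :
    (surfaceMeasure Ω).restrict (Metric.ball x₀ r) ≤
      ((1 + K) ^ (n - 1) : ℝ≥0) • chartMeasure x₀ r e γ := by
  refine Measure.le_iff.2 fun A hA => ?_
  rw [Measure.smul_apply, h.chartMeasure_apply hA, volume_hyperplane h.norm_eq, surfaceMeasure,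
    Measure.restrict_apply hA, Measure.restrict_apply (hA.inter measurableSet_ball)]
  set S := graphPoint e γ ⁻¹' (A ∩ Metric.ball x₀ r) with hS
  have hsub : A ∩ Metric.ball x₀ r ∩ frontier Ω ⊆ graphPoint e γ '' S := by
    rintro x ⟨hx, hxf⟩
    have hp := graphPoint_hyperProj h.norm_eq ((h.mem_frontier_iff hΩ hx.2).1 hxf)
    exact ⟨hyperProj e x, by rw [hS, Set.mem_preimage, hp]; exact hx, hp⟩
  have hl : LipschitzOnWith (1 + K) (graphPoint e γ) S := by
    refine LipschitzOnWith.of_dist_le_mul fun y hy z hz => ?_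
    have h1 := h.lipschitz.dist_le_mul y ⟨_, hy.2, hyperProj_graphPoint γ y⟩ z
      ⟨_, hz.2, hyperProj_graphPoint γ z⟩
    rw [dist_eq_norm, graphPoint, graphPoint,
      show (y : Eucl n) + γ y • e - ((z : Eucl n) + γ z • e) = ((y - z : (ℝ ∙ e)ᗮ) : Eucl n) +
        (γ y - γ z) • e by rw [sub_smul, Submodule.coe_sub]; abel]
    refine (norm_add_le _ _).trans ?_
    rw [norm_smul, h.norm_eq, mul_one, NNReal.coe_add, NNReal.coe_one, add_mul, one_mul,
      dist_eq_norm y z]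
    rw [dist_eq_norm y z, dist_eq_norm (γ y)] at h1
    exact add_le_add le_rfl h1
  refine (measure_mono hsub).trans ((euclideanHausdorffMeasure_image_le hl (n - 1)).trans ?_)
  rw [ENNReal.smul_def, smul_eq_mul]
  push_cast
  rfl

theorem isFiniteMeasure_chartMeasure (h : IsGraphChart Ω x₀ r e γ K) :
    IsFiniteMeasure (chartMeasure x₀ r e γ) := by
  refine ⟨?_⟩
  rw [h.chartMeasure_apply MeasurableSet.univ, Set.univ_inter]
  refine lt_of_le_of_lt (measure_mono (t := Metric.ball (hyperProj e x₀) r) fun y hy => ?_)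
    measure_ball_lt_top
  have hy' : dist (graphPoint e γ y) x₀ < r := hy
  rw [Metric.mem_ball, ← hyperProj_graphPoint γ y, dist_eq_norm, ← map_sub]
  rw [dist_eq_norm] at hy'
  exact (norm_hyperProj_le _ _).trans_lt hy'

end IsGraphChart

end Chart

end CarlemanEstimate

/-! ### Partition of unity, area measure and the global divergence theorem. -/

namespace CarlemanEstimate

variable {n : ℕ} {Ω : Set (Eucl n)}

/-- A finite cover of `∂Ω` by graph charts with a smooth partition of unity on `closure Ω`
subordinate to it and to `Ω`. -/
structure BoundaryAtlas (Ω : Set (Eucl n)) where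
  ι : Type
  [fintype : Fintype ι]
  center : ι → Eucl n
  radius : ι → ℝ
  dir : ι → Eucl n
  γ : ∀ i, (ℝ ∙ dir i)ᗮ → ℝ
  K : ι → ℝ≥0
  chart : ∀ i, IsGraphChart Ω (center i) (radius i) (dir i) (γ i) (K i)
  χ₀ : Eucl n → ℝ
  χ : ι → Eucl n → ℝ
  contDiff₀ : ContDiff ℝ ∞ χ₀
  contDiff : ∀ i, ContDiff ℝ ∞ (χ i)
  hasCompactSupport₀ : HasCompactSupport χ₀
  hasCompactSupport : ∀ i, HasCompactSupport (χ i)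
  tsupport_subset₀ : tsupport χ₀ ⊆ Ω
  tsupport_subset : ∀ i, tsupport (χ i) ⊆ Metric.ball (center i) (radius i)
  nonneg : ∀ i x, 0 ≤ χ i x
  sum_eq_one : ∀ x ∈ closure Ω, χ₀ x + ∑ i, χ i x = 1

attribute [instance] BoundaryAtlas.fintype

open scoped Manifold in
theorem IsBoundedC2Domain.nonempty_boundaryAtlas (hΩ : IsBoundedC2Domain Ω) :
    Nonempty (BoundaryAtlas Ω) := by
  choose r e γ K h using fun p : frontier Ω => hΩ.c2Boundary.exists_isGraphChart p.2
  have hcomp : IsCompact (frontier Ω) :=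
    hΩ.isBounded.isCompact_closure.of_isClosed_subset isClosed_frontier frontier_subset_closure
  obtain ⟨t, ht⟩ := hcomp.elim_finite_subcover (fun p : frontier Ω => Metric.ball (p : Eucl n) (r p))
    (fun _ => Metric.isOpen_ball) (fun x hx => Set.mem_iUnion.2
      ⟨⟨x, hx⟩, Metric.mem_ball_self (h ⟨x, hx⟩).pos⟩)
  -- The index `none` carries Ω itself, so the interior bump function has its support inside Ω and
  -- contributes no boundary term.
  obtain ⟨f, hf⟩ := SmoothPartitionOfUnity.exists_isSubordinate 𝓘(ℝ, Eucl n)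
    (isClosed_closure (s := Ω))
    (fun o : Option t => o.elim Ω fun p => Metric.ball ((p : frontier Ω) : Eucl n) (r p))
    (by rintro (_ | p); exacts [hΩ.isOpen, Metric.isOpen_ball])
    (by
      intro x hx
      by_cases hxΩ : x ∈ Ω
      · exact Set.mem_iUnion.2 ⟨none, hxΩ⟩
      · obtain ⟨p, hp, hxp⟩ := Set.mem_iUnion₂.1 (ht (by
          rw [hΩ.isOpen.frontier_eq]; exact ⟨hx, hxΩ⟩))
        exact Set.mem_iUnion.2 ⟨some ⟨p, hp⟩, hxp⟩)
  have hbdd (o) : HasCompactSupport (f o) := by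
    refine Metric.isCompact_of_isClosed_isBounded (isClosed_tsupport _) ?_
    refine Bornology.IsBounded.subset ?_ (hf o)
    rcases o with _ | p
    exacts [hΩ.isBounded, Metric.isBounded_ball]
  exact ⟨{ ι := t, center := fun p => ((p : frontier Ω) : Eucl n), radius := fun p => r p
           dir := fun p => e p, γ := fun p => γ p, K := fun p => K p, chart := fun p => h p
           χ₀ := f none, χ := fun p => f (some p)
           contDiff₀ := (f none).contMDiff.contDiff
           contDiff := fun p => (f (some p)).contMDiff.contDiff
           hasCompactSupport₀ := hbdd _, hasCompactSupport := fun _ => hbdd _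
           tsupport_subset₀ := hf none, tsupport_subset := fun p => hf (some p)
           nonneg := fun p x => f.nonneg _ x
           sum_eq_one := fun x hx => by
            have h1 := f.sum_eq_one hx
            rw [finsum_eq_sum_of_fintype, Fintype.sum_option] at h1
            exact h1 }⟩

theorem ae_surfaceMeasure_mem_frontier (Ω : Set (Eucl n)) :
    ∀ᵐ x ∂surfaceMeasure Ω, x ∈ frontier Ω :=
  ae_restrict_mem isClosed_frontier.measurableSet

namespace BoundaryAtlas

variable (A : BoundaryAtlas Ω)

/-- The unnormalized normal in the `i`-th chart. -/
noncomputable abbrev normalField (i : A.ι) : Eucl n → Eucl n := graphNormal (A.dir i) (A.γ i)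

/-- The measure on the graph in the `i`-th chart. -/
noncomputable abbrev pieceMeasure (i : A.ι) : Measure (Eucl n) :=
  chartMeasure (A.center i) (A.radius i) (A.dir i) (A.γ i)

/-- The part of the area measure of `∂Ω` carried by the `i`-th chart. -/
noncomputable def areaPiece (i : A.ι) : Measure (Eucl n) :=
  (A.pieceMeasure i).withDensity fun x => ENNReal.ofReal (A.χ i x * ‖A.normalField i x‖)

/-- The area measure of `∂Ω`, for which the divergence theorem holds. -/
noncomputable def area : Measure (Eucl n) := ∑ i, A.areaPiece i

theorem continuous_normalField (i : A.ι) : Continuous (A.normalField i) :=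
  continuous_graphNormal (A.chart i).contDiff

theorem one_le_norm_normalField (i : A.ι) (x : Eucl n) : 1 ≤ ‖A.normalField i x‖ :=
  one_le_norm_graphNormal (A.chart i).norm_eq _ _

theorem exists_bound (i : A.ι) : ∃ C : ℝ≥0, ∀ x, A.χ i x * ‖A.normalField i x‖ ≤ C := by
  have hc : Continuous fun x => A.χ i x * ‖A.normalField i x‖ :=
    (A.contDiff i).continuous.mul (A.continuous_normalField i).norm
  obtain ⟨C, hC⟩ := hc.bounded_above_of_compact_support (A.hasCompactSupport i).mul_right
  refine ⟨C.toNNReal, fun x => ?_⟩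
  exact ((Real.le_norm_self _).trans (hC x)).trans (Real.le_coe_toNNReal C)

theorem areaPiece_le (i : A.ι) (hΩ : IsOpen Ω) :
    ∃ C : ℝ≥0, A.areaPiece i ≤ C • surfaceMeasure Ω := by
  obtain ⟨C, hC⟩ := A.exists_bound i
  refine ⟨C, ?_⟩
  calc A.areaPiece i ≤ (A.pieceMeasure i).withDensity (fun _ => (C : ℝ≥0∞)) := by
        refine withDensity_mono (Eventually.of_forall fun x => ?_)
        exact (ENNReal.ofReal_le_ofReal (hC x)).trans_eq (ENNReal.ofReal_coe_nnreal)
    _ = C • A.pieceMeasure i := by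
        rw [withDensity_const]
        rfl
    _ ≤ C • surfaceMeasure Ω := by
        gcongr
        exact (A.chart i).chartMeasure_le hΩ

theorem area_le (hΩ : IsOpen Ω) : ∃ C : ℝ≥0, A.area ≤ C • surfaceMeasure Ω := by
  choose C hC using fun i => A.areaPiece_le i hΩ
  refine ⟨∑ i, C i, ?_⟩
  rw [Finset.sum_smul]
  exact Finset.sum_le_sum fun i _ => hC i

theorem isFiniteMeasure_areaPiece (i : A.ι) : IsFiniteMeasure (A.areaPiece i) := by
  have := (A.chart i).isFiniteMeasure_chartMeasure
  obtain ⟨C, hC⟩ := A.exists_bound i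
  refine isFiniteMeasure_withDensity_ofReal ?_
  refine HasFiniteIntegral.of_bounded (C := C) (Eventually.of_forall fun x => ?_)
  rw [Real.norm_of_nonneg (mul_nonneg (A.nonneg i x) (norm_nonneg _))]
  exact hC x

instance isFiniteMeasure_area : IsFiniteMeasure A.area := by
  have := A.isFiniteMeasure_areaPiece
  unfold area
  infer_instance

/-- On ∂Ω the χ_i sum to one, so the surface measure is the sum of the measures with densities χ_i.
Each is compared with its chart measure, and the factor ‖N_i‖ ≥ 1 in `areaPiece` only helps. -/
theorem surfaceMeasure_le (hΩ : IsOpen Ω) : ∃ C : ℝ≥0, surfaceMeasure Ω ≤ C • A.area := by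
  set C : A.ι → ℝ≥0 := fun i => (1 + A.K i) ^ (n - 1)
  have hmeas (i) : Measurable fun x => ENNReal.ofReal (A.χ i x) :=
    ENNReal.measurable_ofReal.comp (A.contDiff i).continuous.measurable
  have hi (i : A.ι) : (surfaceMeasure Ω).withDensity (fun x => ENNReal.ofReal (A.χ i x)) ≤
      C i • A.areaPiece i := by
    calc (surfaceMeasure Ω).withDensity (fun x => ENNReal.ofReal (A.χ i x))
        = ((surfaceMeasure Ω).restrict (Metric.ball (A.center i) (A.radius i))).withDensity
            (fun x => ENNReal.ofReal (A.χ i x)) := by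
          rw [← withDensity_indicator measurableSet_ball]
          congr 1
          ext x
          by_cases hx : x ∈ Metric.ball (A.center i) (A.radius i)
          · rw [Set.indicator_of_mem hx]
          · rw [Set.indicator_of_notMem hx,
              image_eq_zero_of_notMem_tsupport fun hc => hx (A.tsupport_subset i hc),
              ENNReal.ofReal_zero]
      _ ≤ (C i • A.pieceMeasure i).withDensity (fun x => ENNReal.ofReal (A.χ i x)) :=
          Measure.le_iff.2 fun B hB => by
            rw [withDensity_apply _ hB, withDensity_apply _ hB]
            exact lintegral_mono' (Measure.restrict_mono le_rfl
              ((A.chart i).restrict_surfaceMeasure_le hΩ)) le_rfl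
      _ = C i • (A.pieceMeasure i).withDensity (fun x => ENNReal.ofReal (A.χ i x)) := by
          rw [ENNReal.smul_def, withDensity_smul_measure]
          rfl
      _ ≤ C i • A.areaPiece i := by
          gcongr
          refine withDensity_mono (Eventually.of_forall fun x => ENNReal.ofReal_le_ofReal ?_)
          exact le_mul_of_one_le_right (A.nonneg i x) (A.one_le_norm_normalField i x)
  refine ⟨∑ i, C i, ?_⟩
  calc surfaceMeasure Ω = (surfaceMeasure Ω).withDensity
        (∑ i, fun x => ENNReal.ofReal (A.χ i x)) := by
        conv_lhs => rw [← withDensity_one (μ := surfaceMeasure Ω)]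
        refine withDensity_congr_ae ?_
        filter_upwards [ae_surfaceMeasure_mem_frontier Ω] with x hx
        have h1 := A.sum_eq_one x (frontier_subset_closure hx)
        rw [image_eq_zero_of_notMem_tsupport (f := A.χ₀)
          (fun hc => (hΩ.frontier_eq ▸ hx).2 (A.tsupport_subset₀ hc)), zero_add] at h1
        rw [Finset.sum_apply, ← ENNReal.ofReal_sum_of_nonneg fun i _ => A.nonneg i x, h1]
        simp
    _ = ∑ i, (surfaceMeasure Ω).withDensity (fun x => ENNReal.ofReal (A.χ i x)) := by
        rw [← tsum_fintype (L := SummationFilter.unconditional _), withDensity_tsum hmeas,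
          Measure.sum_fintype]
    _ ≤ ∑ i, C i • A.areaPiece i := Finset.sum_le_sum fun i _ => hi i
    _ ≤ ∑ i, C i • A.area := by
        gcongr with i
        exact Finset.single_le_sum (f := A.areaPiece) (fun j _ => Measure.zero_le _) (Finset.mem_univ i)
    _ = (∑ i, C i) • A.area := by rw [Finset.sum_smul]

theorem outwardNormal_eq (hΩ : IsOpen Ω) (i : A.ι) {x : Eucl n} (hx : x ∈ frontier Ω)
    (hxb : x ∈ Metric.ball (A.center i) (A.radius i)) :
    outwardNormal Ω x = ‖A.normalField i x‖⁻¹ • A.normalField i x :=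
  (A.chart i).outwardNormal_eq hΩ hxb hx

theorem sum_eq_one_of_mem_frontier (hΩ : IsOpen Ω) {x : Eucl n} (hx : x ∈ frontier Ω) :
    ∑ i, A.χ i x = 1 := by
  have h1 := A.sum_eq_one x (frontier_subset_closure hx)
  rwa [image_eq_zero_of_notMem_tsupport (f := A.χ₀)
    (fun hc => (hΩ.frontier_eq ▸ hx).2 (A.tsupport_subset₀ hc)), zero_add] at h1

theorem exists_mem_ball (hΩ : IsOpen Ω) {x : Eucl n} (hx : x ∈ frontier Ω) :
    ∃ i, x ∈ Metric.ball (A.center i) (A.radius i) := by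
  obtain ⟨i, -, hi⟩ := Finset.exists_ne_zero_of_sum_ne_zero
    ((A.sum_eq_one_of_mem_frontier hΩ hx).trans_ne one_ne_zero)
  exact ⟨i, A.tsupport_subset i (subset_tsupport _ hi)⟩

theorem norm_outwardNormal (A : BoundaryAtlas Ω) (hΩ : IsOpen Ω) {x : Eucl n} (hx : x ∈ frontier Ω) :
    ‖outwardNormal Ω x‖ = 1 := by
  obtain ⟨i, hi⟩ := A.exists_mem_ball hΩ hx
  have := A.one_le_norm_normalField i x
  rw [A.outwardNormal_eq hΩ i hx hi, norm_smul, norm_inv, norm_norm, inv_mul_cancel₀ (by positivity)]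

theorem continuousOn_outwardNormal (A : BoundaryAtlas Ω) (hΩ : IsOpen Ω) :
    ContinuousOn (outwardNormal Ω) (frontier Ω) := by
  intro x hx
  obtain ⟨i, hi⟩ := A.exists_mem_ball hΩ hx
  have hc : ContinuousAt (fun y => ‖A.normalField i y‖⁻¹ • A.normalField i y) x := by
    have := A.one_le_norm_normalField i x
    exact ((A.continuous_normalField i).norm.continuousAt.inv₀ (by positivity)).smul
      (A.continuous_normalField i).continuousAt
  refine hc.continuousWithinAt.congr_of_eventuallyEq ?_ (A.outwardNormal_eq hΩ i hx hi)
  filter_upwards [self_mem_nhdsWithin,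
    mem_nhdsWithin_of_mem_nhds (Metric.isOpen_ball.mem_nhds hi)] with y hy hyb
  exact A.outwardNormal_eq hΩ i hy hyb

theorem ae_areaPiece_mem_frontier (hΩ : IsOpen Ω) (i : A.ι) :
    ∀ᵐ x ∂A.areaPiece i, x ∈ frontier Ω := by
  have h := (withDensity_absolutelyContinuous (A.pieceMeasure i)
    (fun x => ENNReal.ofReal (A.χ i x * ‖A.normalField i x‖))).trans
    (Measure.absolutelyContinuous_of_le ((A.chart i).chartMeasure_le hΩ))
  exact h.ae_le (ae_surfaceMeasure_mem_frontier Ω)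

theorem ae_area_mem_frontier (hΩ : IsOpen Ω) : ∀ᵐ x ∂A.area, x ∈ frontier Ω := by
  obtain ⟨C, hC⟩ := A.area_le hΩ
  have h : A.area ≪ surfaceMeasure Ω :=
    (Measure.absolutelyContinuous_of_le hC).trans Measure.smul_absolutelyContinuous
  exact h.ae_le (ae_surfaceMeasure_mem_frontier Ω)

theorem integrable_of_continuousOn_frontier {F : Type*} [NormedAddCommGroup F]
    (hb : Bornology.IsBounded Ω) {μ : Measure (Eucl n)} [IsFiniteMeasure μ]
    (hμ : ∀ᵐ x ∂μ, x ∈ frontier Ω) {f : Eucl n → F} (hf : ContinuousOn f (frontier Ω)) :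
    Integrable f μ := by
  have hcomp : IsCompact (frontier Ω) :=
    hb.isCompact_closure.of_isClosed_subset isClosed_frontier frontier_subset_closure
  have h := hf.integrableOn_compact (μ := μ) hcomp
  rwa [IntegrableOn, Measure.restrict_eq_self_of_ae_mem hμ] at h

/-- The density ‖N_i‖ in `areaPiece` turns the unnormalized normal of the chart into the unit
normal, so the boundary integrand no longer depends on the chart. -/
theorem setIntegral_fderiv_piece (hΩ : IsOpen Ω) (i : A.ι) {a : Eucl n → ℂ}
    (ha : ContDiff ℝ 1 a) (d : Eucl n) :
    ∫ x in Ω, fderiv ℝ (fun x => A.χ i x • a x) x d =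
      ∫ x, ⟪outwardNormal Ω x, d⟫_ℝ • a x ∂A.areaPiece i := by
  have hχ : ContDiff ℝ 1 (A.χ i) := (A.contDiff i).of_le (by exact_mod_cast le_top)
  rw [(A.chart i).setIntegral_fderiv (a := fun x => A.χ i x • a x) (hχ.smul ha) (A.hasCompactSupport i).smul_right
    ((tsupport_smul_subset_left _ _).trans (A.tsupport_subset i)) hΩ.measurableSet,
    areaPiece, integral_withDensity_eq_integral_toReal_smul]
  · refine integral_congr_ae ?_
    have h1 := (Measure.absolutelyContinuous_of_le ((A.chart i).chartMeasure_le hΩ)).ae_le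
      (ae_surfaceMeasure_mem_frontier Ω)
    have h2 : ∀ᵐ x ∂A.pieceMeasure i, x ∈ Metric.ball (A.center i) (A.radius i) :=
      ae_restrict_mem measurableSet_ball
    filter_upwards [h1, h2] with x hx hxb
    have hpos := A.one_le_norm_normalField i x
    rw [A.outwardNormal_eq hΩ i hx hxb, real_inner_smul_left,
      ENNReal.toReal_ofReal (mul_nonneg (A.nonneg i x) (norm_nonneg _)), smul_smul, smul_smul]
    congr 1
    field_simp
  · exact ENNReal.measurable_ofReal.comp (((A.contDiff i).continuous.mul
      (A.continuous_normalField i).norm).measurable)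
  · exact Eventually.of_forall fun x => ENNReal.ofReal_lt_top

/-- The divergence theorem. -/
theorem setIntegral_fderiv (hΩ : IsBoundedC2Domain Ω) {a : Eucl n → ℂ} (ha : ContDiff ℝ 1 a)
    (d : Eucl n) :
    ∫ x in Ω, fderiv ℝ a x d = ∫ x, ⟪outwardNormal Ω x, d⟫_ℝ • a x ∂A.area := by
  have hχ₀ : ContDiff ℝ 1 A.χ₀ := A.contDiff₀.of_le (by exact_mod_cast le_top)
  have hχ (i) : ContDiff ℝ 1 (A.χ i) := (A.contDiff i).of_le (by exact_mod_cast le_top)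
  have hint {f : Eucl n → ℂ} (hf : ContDiff ℝ 1 f) (hs : HasCompactSupport f) :
      Integrable fun x => fderiv ℝ f x d :=
    ((hf.continuous_fderiv one_ne_zero).clm_apply continuous_const).integrable_of_hasCompactSupport
      (hs.fderiv_apply ℝ d)
  have hd (x) : DifferentiableAt ℝ (fun x => A.χ₀ x • a x) x :=
    ((hχ₀.smul ha).differentiable one_ne_zero) x
  have hdi (i x) : DifferentiableAt ℝ (fun x => A.χ i x • a x) x :=
    (((hχ i).smul ha).differentiable one_ne_zero) x
  -- The cutoffs sum to one on a neighbourhood of each point of the open set Ω, so the identity may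
  -- be differentiated there.
  have hsplit : ∀ x ∈ Ω, fderiv ℝ a x d = fderiv ℝ (fun x => A.χ₀ x • a x) x d +
      ∑ i, fderiv ℝ (fun x => A.χ i x • a x) x d := by
    intro x hx
    have heq : a =ᶠ[𝓝 x] fun x => A.χ₀ x • a x + ∑ i, A.χ i x • a x := by
      filter_upwards [hΩ.isOpen.mem_nhds hx] with y hy
      rw [← Finset.sum_smul, ← add_smul, A.sum_eq_one y (subset_closure hy), one_smul]
    have hsum : HasFDerivAt (fun x => A.χ₀ x • a x + ∑ i, A.χ i x • a x) _ x :=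
      (hd x).hasFDerivAt.add (HasFDerivAt.fun_sum fun i _ => (hdi i x).hasFDerivAt)
    rw [heq.fderiv_eq, hsum.fderiv]
    simp
  have h0 : ∫ x in Ω, fderiv ℝ (fun x => A.χ₀ x • a x) x d = 0 := by
    rw [setIntegral_eq_integral_of_forall_compl_eq_zero]
    · exact integral_fderiv_eq_zero (hχ₀.smul ha) A.hasCompactSupport₀.smul_right d
    · intro x hx
      rw [fderiv_of_notMem_tsupport ℝ fun hc => hx (A.tsupport_subset₀
        (tsupport_smul_subset_left _ _ hc))]
      rfl
  rw [setIntegral_congr_fun hΩ.isOpen.measurableSet hsplit, integral_add, h0, zero_add,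
    integral_finsetSum, area, integral_finsetSum_measure]
  · exact Finset.sum_congr rfl fun i _ => A.setIntegral_fderiv_piece hΩ.isOpen i ha d
  · intro i _
    have := A.isFiniteMeasure_areaPiece i
    refine integrable_of_continuousOn_frontier hΩ.isBounded
      (A.ae_areaPiece_mem_frontier hΩ.isOpen i) ?_
    have hc : ContinuousOn (fun x => ⟪outwardNormal Ω x, d⟫_ℝ) (frontier Ω) :=
      (A.continuousOn_outwardNormal hΩ.isOpen).inner continuousOn_const
    exact hc.smul ha.continuous.continuousOn
  · exact fun i _ => (hint ((hχ i).smul ha) (A.hasCompactSupport i).smul_right).integrableOn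
  · exact (hint (hχ₀.smul ha) A.hasCompactSupport₀.smul_right).integrableOn
  · exact integrable_finsetSum _ fun i _ =>
      (hint ((hχ i).smul ha) (A.hasCompactSupport i).smul_right).integrableOn

/-- A smooth vector field that points strictly outwards along `∂Ω`. -/
noncomputable def transversal (x : Eucl n) : Eucl n := -∑ i, A.χ i x • A.dir i

theorem contDiff_transversal : ContDiff ℝ ∞ A.transversal := by
  unfold transversal
  exact (ContDiff.sum fun i _ => (A.contDiff i).smul contDiff_const).neg

/-- In every chart that is active at x, the inner product of the normal with -e_i is 1/‖N_i‖ > 0. A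
sum of such terms with weights χ_i is positive on ∂Ω, and compactness makes the bound uniform. -/
theorem exists_le_inner_transversal (hΩ : IsBoundedC2Domain Ω) :
    ∃ c : ℝ, 0 < c ∧ ∀ x ∈ frontier Ω, c ≤ ⟪outwardNormal Ω x, A.transversal x⟫_ℝ := by
  have hcomp : IsCompact (frontier Ω) :=
    hΩ.isBounded.isCompact_closure.of_isClosed_subset isClosed_frontier frontier_subset_closure
  have hcont : ContinuousOn (fun x => ⟪outwardNormal Ω x, A.transversal x⟫_ℝ) (frontier Ω) :=
    (A.continuousOn_outwardNormal hΩ.isOpen).inner A.contDiff_transversal.continuous.continuousOn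
  have hpos : ∀ x ∈ frontier Ω, 0 < ⟪outwardNormal Ω x, A.transversal x⟫_ℝ := by
    intro x hx
    have hterm (i) (hi : A.χ i x ≠ 0) : 0 < A.χ i x * ⟪outwardNormal Ω x, -A.dir i⟫_ℝ := by
      refine mul_pos (lt_of_le_of_ne (A.nonneg i x) hi.symm) ?_
      rw [A.outwardNormal_eq hΩ.isOpen i hx (A.tsupport_subset i (subset_tsupport _ hi)),
        real_inner_smul_left, inner_neg_right, inner_graphNormal_self (A.chart i).norm_eq, neg_neg,
        mul_one]
      exact inv_pos.2 (one_pos.trans_le (A.one_le_norm_normalField i x))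
    have hexp : ⟪outwardNormal Ω x, A.transversal x⟫_ℝ =
        ∑ i, A.χ i x * ⟪outwardNormal Ω x, -A.dir i⟫_ℝ := by
      rw [transversal, ← Finset.sum_neg_distrib, inner_sum]
      simp [inner_smul_right]
    obtain ⟨i, -, hi⟩ := Finset.exists_ne_zero_of_sum_ne_zero
      ((A.sum_eq_one_of_mem_frontier hΩ.isOpen hx).trans_ne one_ne_zero)
    rw [hexp]
    refine Finset.sum_pos' (fun j _ => ?_) ⟨i, Finset.mem_univ i, hterm i hi⟩
    by_cases hj : A.χ j x = 0
    · rw [hj, zero_mul]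
    · exact (hterm j hj).le
  rcases (frontier Ω).eq_empty_or_nonempty with he | hne
  · exact ⟨1, one_pos, by simp [he]⟩
  · obtain ⟨x₀, hx₀, hmin⟩ := hcomp.exists_isMinOn hne hcont
    exact ⟨_, hpos x₀ hx₀, fun x hx => hmin hx⟩

end BoundaryAtlas

end CarlemanEstimate

/-! ### Mollification in L². -/

namespace CarlemanEstimate

theorem eLpNorm_two_sq_eq_lintegral {α F : Type*} [MeasurableSpace α] {μ : Measure α}
    [NormedAddCommGroup F] (f : α → F) : eLpNorm f 2 μ ^ 2 = ∫⁻ x, ‖f x‖ₑ ^ 2 ∂μ := by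
  have h := eLpNorm_nnreal_pow_eq_lintegral (μ := μ) (f := f) (p := 2) two_ne_zero
  simp only [NNReal.coe_ofNat, ENNReal.rpow_ofNat] at h
  exact_mod_cast h

variable {n : ℕ}

theorem tendsto_eLpNorm_translate_sub {f : Eucl n → ℂ} (hf : MemLp f 2 volume) :
    Tendsto (fun z => eLpNorm (fun x => f (x - z) - f x) 2 volume) (𝓝 0) (𝓝 0) := by
  let T : C(Eucl n, C(Eucl n, Eucl n)) :=
    ContinuousMap.curry ⟨fun p : Eucl n × Eucl n => p.2 - p.1, by fun_prop⟩
  have hT (z) : MeasurePreserving (T z) volume volume := measurePreserving_sub_right volume z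
  have h := Filter.Tendsto.compMeasurePreservingLp (p := 2) (E := ℂ)
    (tendsto_const_nhds (x := hf.toLp f) (f := 𝓝 (0 : Eucl n))) (T.continuous.tendsto 0)
    hT (hT 0) (by norm_num)
  simp only [Lp.toLp_compMeasurePreserving] at h
  rw [Lp.tendsto_Lp_iff_tendsto_eLpNorm''] at h
  refine h.congr fun z => eLpNorm_congr_ae (Eventually.of_forall fun x => ?_)
  simp [T, Function.comp_def]

/-- The convolution of `f` with the kernel `k`. -/
noncomputable def mollify (k : Eucl n → ℝ) (f : Eucl n → ℂ) (x : Eucl n) : ℂ :=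
  ∫ y, k (x - y) • f y

theorem mollify_eq_convolution (k : Eucl n → ℝ) (f : Eucl n → ℂ) :
    mollify k f = convolution f k (ContinuousLinearMap.lsmul ℝ ℝ).flip volume := by
  ext x
  simp [mollify, convolution_def]

theorem contDiff_mollify {k : Eucl n → ℝ} {f : Eucl n → ℂ} (hk : ContDiff ℝ ∞ k)
    (hs : HasCompactSupport k) (hf : LocallyIntegrable f volume) : ContDiff ℝ ∞ (mollify k f) := by
  rw [mollify_eq_convolution]
  exact hs.contDiff_convolution_right _ hf hk

theorem fderiv_mollify_apply {k : Eucl n → ℝ} {f : Eucl n → ℂ} (hk : ContDiff ℝ ∞ k)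
    (hs : HasCompactSupport k) (hf : LocallyIntegrable f volume) (x d : Eucl n) :
    fderiv ℝ (mollify k f) x d = mollify (fun z => fderiv ℝ k z d) f x := by
  have hk1 : ContDiff ℝ 1 k := hk.of_le (by exact_mod_cast le_top)
  rw [mollify_eq_convolution, mollify_eq_convolution,
    (hs.hasFDerivAt_convolution_right _ hf hk1 x).fderiv,
    convolution_precompR_apply _ hf (hs.fderiv ℝ) (hk1.continuous_fderiv one_ne_zero)]

theorem integrable_kernel_smul {k : Eucl n → ℝ} {f : Eucl n → ℂ} (hk : Continuous k)
    (hs : HasCompactSupport k) (hf : LocallyIntegrable f volume) (x : Eucl n) :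
    Integrable fun y => k (x - y) • f y := by
  refine hf.integrable_smul_left_of_hasCompactSupport (by fun_prop) ?_
  exact hs.comp_homeomorph (Homeomorph.subLeft x)

/-- The kernel is a probability density, so `mollify k f x - f x` is an average of f(x - z) - f(x).
Bound the square of the average by the average of the squares, then exchange the integrals. -/
theorem eLpNorm_mollify_sub_le {k : Eucl n → ℝ} (hk : Continuous k) (hs : HasCompactSupport k)
    (hnn : ∀ z, 0 ≤ k z) (hint : ∫ z, k z = 1) {f : Eucl n → ℂ} (hf : MemLp f 2 volume)
    {ε : ℝ≥0∞} (hε : ∀ z, k z ≠ 0 → eLpNorm (fun x => f (x - z) - f x) 2 volume ≤ ε) :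
    eLpNorm (fun x => mollify k f x - f x) 2 volume ≤ ε := by
  -- Exchanging the integrals needs joint measurability of (x, z) ↦ f(x - z), so f is replaced by a
  -- strongly measurable representative.
  wlog hfm : StronglyMeasurable f generalizing f
  · obtain ⟨g, hg, hfg⟩ := hf.1
    have hm : mollify k f = mollify k g := by
      ext x
      refine integral_congr_ae ?_
      filter_upwards [hfg] with y hy
      rw [hy]
    have h1 : eLpNorm (fun x => mollify k f x - f x) 2 volume =
        eLpNorm (fun x => mollify k g x - g x) 2 volume := by
      refine eLpNorm_congr_ae ?_
      filter_upwards [hfg] with y hy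
      rw [hm, hy]
    rw [h1]
    refine this ((memLp_congr_ae hfg).1 hf) (fun z hz => ?_) hg
    refine le_of_eq_of_le (eLpNorm_congr_ae ?_) (hε z hz)
    have h2 := (measurePreserving_sub_right (volume : Measure (Eucl n)) z).quasiMeasurePreserving.ae
      hfg
    filter_upwards [hfg, h2] with y hy hy2
    rw [hy, hy2]
  set ν : Measure (Eucl n) := volume.withDensity fun z => ENNReal.ofReal (k z) with hν
  have hkint : Integrable k := hk.integrable_of_hasCompactSupport hs
  have hkm : Measurable fun z => ENNReal.ofReal (k z) :=
    ENNReal.measurable_ofReal.comp hk.measurable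
  have hprob : IsProbabilityMeasure ν := by
    refine ⟨?_⟩
    rw [hν, withDensity_apply _ MeasurableSet.univ, Measure.restrict_univ,
      ← ofReal_integral_eq_lintegral_ofReal hkint (Eventually.of_forall hnn), hint,
      ENNReal.ofReal_one]
  have hνae : ∀ᵐ z ∂ν, k z ≠ 0 := by
    rw [hν, ae_withDensity_iff hkm]
    refine Eventually.of_forall fun z hz h0 => hz ?_
    rw [h0, ENNReal.ofReal_zero]
  have hloc : LocallyIntegrable f volume := hf.locallyIntegrable (by norm_num)
  have hfi (x) : Integrable (fun z => f (x - z)) ν := by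
    rw [hν, integrable_withDensity_iff_integrable_smul' hkm
      (Eventually.of_forall fun _ => ENNReal.ofReal_lt_top)]
    have h := (integrable_kernel_smul hk hs hloc x).comp_sub_left x
    refine h.congr (Eventually.of_forall fun z => ?_)
    simp [ENNReal.toReal_ofReal (hnn z)]
  have hmoll (x) : mollify k f x - f x = ∫ z, (f (x - z) - f x) ∂ν := by
    rw [integral_sub (hfi x) (integrable_const _), integral_const, probReal_univ, one_smul, hν,
      integral_withDensity_eq_integral_toReal_smul hkm
        (Eventually.of_forall fun _ => ENNReal.ofReal_lt_top), mollify,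
      ← integral_sub_left_eq_self _ volume x]
    simp [ENNReal.toReal_ofReal (hnn _)]
  have hpt (x) : ‖mollify k f x - f x‖ₑ ^ 2 ≤ ∫⁻ z, ‖f (x - z) - f x‖ₑ ^ 2 ∂ν := by
    rw [hmoll, ← eLpNorm_two_sq_eq_lintegral]
    refine pow_le_pow_left' ((enorm_integral_le_lintegral_enorm _).trans ?_) 2
    rw [← eLpNorm_one_eq_lintegral_enorm]
    exact eLpNorm_le_eLpNorm_of_exponent_le one_le_two
      ((hfi x).sub (integrable_const _)).aestronglyMeasurable
  rw [← ENNReal.pow_le_pow_left_iff two_ne_zero, eLpNorm_two_sq_eq_lintegral]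
  calc ∫⁻ x, ‖mollify k f x - f x‖ₑ ^ 2
      ≤ ∫⁻ x, ∫⁻ z, ‖f (x - z) - f x‖ₑ ^ 2 ∂ν := lintegral_mono hpt
    _ = ∫⁻ z, (∫⁻ x, ‖f (x - z) - f x‖ₑ ^ 2) ∂ν := by
        refine lintegral_lintegral_swap (Measurable.aemeasurable ?_)
        have hm := hfm.measurable
        fun_prop
    _ ≤ ∫⁻ _, ε ^ 2 ∂ν := by
        refine lintegral_mono_ae ?_
        filter_upwards [hνae] with z hz
        rw [← eLpNorm_two_sq_eq_lintegral]
        exact pow_le_pow_left' (hε z hz) 2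
    _ = ε ^ 2 := by simp

/-- The kernels only have to shrink to the origin and need not be centred at it. This freedom is
what permits mollifying from one side near ∂Ω. -/
theorem tendsto_eLpNorm_mollify_sub {k : ℕ → Eucl n → ℝ} {R : ℕ → ℝ} (hk : ∀ m, Continuous (k m))
    (hs : ∀ m, HasCompactSupport (k m)) (hnn : ∀ m z, 0 ≤ k m z) (hint : ∀ m, ∫ z, k m z = 1)
    (hR : ∀ m z, k m z ≠ 0 → ‖z‖ ≤ R m) (hR0 : Tendsto R atTop (𝓝 0))
    {f : Eucl n → ℂ} (hf : MemLp f 2 volume) :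
    Tendsto (fun m => eLpNorm (fun x => mollify (k m) f x - f x) 2 volume) atTop (𝓝 0) := by
  rw [ENNReal.tendsto_nhds_zero]
  intro ε hε
  have h1 := (ENNReal.tendsto_nhds_zero.1 (tendsto_eLpNorm_translate_sub hf)) ε hε
  obtain ⟨s, hs0, hsub⟩ := Metric.eventually_nhds_iff.1 h1
  filter_upwards [hR0 (gt_mem_nhds hs0)] with m hm
  refine eLpNorm_mollify_sub_le (hk m) (hs m) (hnn m) (hint m) hf fun z hz => hsub ?_
  rw [dist_zero_right]
  exact (hR m z hz).trans_lt hm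

/-- Test the weak derivative with φ(y) = χ(y) k(x - y). The hypothesis `hx` says that this φ is
supported in Ω, so extension by zero creates no boundary contribution at x. -/
theorem IsWeakPartial.mollify_fderiv {Ω : Set (Eucl n)} (hΩ : MeasurableSet Ω) {i : Fin n}
    {u g : Eucl n → ℂ} (h : IsWeakPartial Ω i u g) (hu : MemLp u 2 (volume.restrict Ω))
    (hg : MemLp g 2 (volume.restrict Ω)) {χ k : Eucl n → ℝ} (hχ : ContDiff ℝ ∞ χ)
    (hχs : HasCompactSupport χ) (hk : ContDiff ℝ ∞ k) (hks : HasCompactSupport k) {x : Eucl n}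
    (hx : ∀ y ∈ tsupport χ, x - y ∈ tsupport k → y ∈ Ω) :
    mollify (fun z => fderiv ℝ k z (stdVec i)) (Ω.indicator fun y => χ y • u y) x =
      mollify k (Ω.indicator fun y => χ y • g y + fderiv ℝ χ y (stdVec i) • u y) x := by
  have hχ1 : ContDiff ℝ 1 χ := hχ.of_le (by exact_mod_cast le_top)
  have hk1 : ContDiff ℝ 1 k := hk.of_le (by exact_mod_cast le_top)
  have hd : Continuous fun z => fderiv ℝ χ z (stdVec i) :=
    (hχ1.continuous_fderiv one_ne_zero).clm_apply continuous_const
  have hdk : Continuous fun z => fderiv ℝ k z (stdVec i) :=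
    (hk1.continuous_fderiv one_ne_zero).clm_apply continuous_const
  have hloc {a : Eucl n → ℝ} (ha : Continuous a) (has : HasCompactSupport a) {w : Eucl n → ℂ}
      (hw : MemLp w 2 (volume.restrict Ω)) :
      LocallyIntegrable (Ω.indicator fun y => a y • w y) volume := by
    refine MemLp.locallyIntegrable (p := 2) ?_ (by norm_num)
    rw [memLp_indicator_iff_restrict hΩ]
    obtain ⟨C, hC⟩ := ha.bounded_above_of_compact_support has
    exact MemLp.of_le_mul (c := C) hw (ha.aestronglyMeasurable.smul hw.1)
      (Eventually.of_forall fun y => by rw [norm_smul]; gcongr; exact hC y)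
  set φ : Eucl n → ℝ := fun y => χ y * k (x - y) with hφ
  have hkx : ContDiff ℝ ∞ fun y => k (x - y) := hk.comp (by fun_prop)
  have hφc : ContDiff ℝ ∞ φ := hχ.mul hkx
  have hφs : HasCompactSupport φ := hχs.mul_right
  have hφsub : tsupport φ ⊆ Ω := by
    intro y hy
    refine hx y (tsupport_mul_subset_left hy) ?_
    have h1 : y ∈ tsupport fun y => k (x - y) := tsupport_mul_subset_right hy
    have h2 := tsupport_comp_eq_preimage k (Homeomorph.subLeft x)
    have h3 : y ∈ tsupport (k ∘ Homeomorph.subLeft x) := h1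
    rw [h2] at h3
    exact h3
  have hφd (y) : fderiv ℝ φ y (stdVec i) =
      k (x - y) * fderiv ℝ χ y (stdVec i) - fderiv ℝ k (x - y) (stdVec i) * χ y := by
    have h1 : HasFDerivAt (fun y => k (x - y))
        ((fderiv ℝ k (x - y)).comp (-ContinuousLinearMap.id ℝ (Eucl n))) y :=
      ((hk1.differentiable one_ne_zero) (x - y)).hasFDerivAt.comp y
        ((hasFDerivAt_id y).const_sub x)
    have h2 : HasFDerivAt φ _ y := ((hχ1.differentiable one_ne_zero) y).hasFDerivAt.mul h1
    rw [h2.fderiv]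
    simp
    ring
  have key := h.2.2 φ hφc hφs hφsub
  rw [← integral_indicator hΩ, ← integral_indicator hΩ] at key
  have i1 := integrable_kernel_smul hk.continuous hks (hloc hd (hχs.fderiv_apply ℝ _) hu) x
  have i2 := integrable_kernel_smul hdk (hks.fderiv_apply ℝ _) (hloc hχ.continuous hχs hu) x
  have i3 := integrable_kernel_smul hk.continuous hks (hloc hχ.continuous hχs hg) x
  have e1 : (fun y => Ω.indicator (fun y => fderiv ℝ φ y (stdVec i) • u y) y) = fun y =>
      k (x - y) • Ω.indicator (fun y => fderiv ℝ χ y (stdVec i) • u y) y -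
      fderiv ℝ k (x - y) (stdVec i) • Ω.indicator (fun y => χ y • u y) y := by
    ext y
    by_cases hy : y ∈ Ω
    · simp only [Set.indicator_of_mem hy, hφd, sub_smul, mul_smul]
    · simp [Set.indicator_of_notMem hy]
  have e2 : (fun y => Ω.indicator (fun y => φ y • g y) y) = fun y =>
      k (x - y) • Ω.indicator (fun y => χ y • g y) y := by
    ext y
    by_cases hy : y ∈ Ω
    · simp only [Set.indicator_of_mem hy, hφ, mul_smul]
      rw [smul_comm]
    · simp [Set.indicator_of_notMem hy]
  have e3 : (fun y => k (x - y) • Ω.indicator (fun y => χ y • g y +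
      fderiv ℝ χ y (stdVec i) • u y) y) = fun y =>
      k (x - y) • Ω.indicator (fun y => χ y • g y) y +
      k (x - y) • Ω.indicator (fun y => fderiv ℝ χ y (stdVec i) • u y) y := by
    ext y
    by_cases hy : y ∈ Ω
    · simp only [Set.indicator_of_mem hy, smul_add]
    · simp [Set.indicator_of_notMem hy]
  rw [e1, e2, integral_sub i1 i2] at key
  rw [mollify, mollify, e3, integral_add i3 i1]
  linear_combination (exp := 1) -key

end CarlemanEstimate

/-! ### Weak derivatives, and density of smooth functions in H¹. -/

namespace CarlemanEstimate

variable {n : ℕ} {Ω : Set (Eucl n)}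

theorem IsWeakPartial.ae_eq (hΩ : IsOpen Ω) {i : Fin n} {u g g' : Eucl n → ℂ}
    (h : IsWeakPartial Ω i u g) (h' : IsWeakPartial Ω i u g') :
    g =ᵐ[volume.restrict Ω] g' := by
  have hloc : LocallyIntegrableOn (fun x => g x - g' x) Ω volume := h.2.1.sub h'.2.1
  have h0 := hΩ.ae_eq_zero_of_integral_contDiff_smul_eq_zero hloc (fun φ hφ hs hsub => by
    have hvan : ∀ x ∉ Ω, φ x • (g x - g' x) = 0 := fun x hx => by
      rw [image_eq_zero_of_notMem_tsupport fun hc => hx (hsub hc), zero_smul]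
    rw [← setIntegral_eq_integral_of_forall_compl_eq_zero hvan]
    have hi {f : Eucl n → ℂ} (hf : LocallyIntegrableOn f Ω volume) :
        IntegrableOn (fun x => φ x • f x) Ω volume := by
      have h1 : IntegrableOn (fun x => φ x • f x) (tsupport φ) volume :=
        (hf.integrableOn_compact_subset hsub hs).continuousOn_smul hφ.continuous.continuousOn hs
      refine (h1.of_forall_sdiff_eq_zero hΩ.measurableSet fun x hx => ?_)
      rw [image_eq_zero_of_notMem_tsupport hx.2, zero_smul]
    simp only [smul_sub]
    rw [integral_sub (hi h.2.1) (hi h'.2.1)]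
    have e1 := h.2.2 φ hφ hs hsub
    have e2 := h'.2.2 φ hφ hs hsub
    rw [e1] at e2
    rw [neg_injective e2, sub_self])
  rw [Filter.EventuallyEq, ae_restrict_iff' hΩ.measurableSet]
  filter_upwards [h0] with x hx hxΩ
  exact sub_eq_zero.1 (hx hxΩ)

theorem MemH1.isWeakPartial {u : Eucl n → ℂ} (h : MemH1 Ω u) (i : Fin n) :
    IsWeakPartial Ω i u (weakPartial Ω i u) := by
  have hex : ∃ g, IsWeakPartial Ω i u g := (h.2 i).imp fun _ hg => hg.1
  rw [weakPartial, dif_pos hex]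
  exact hex.choose_spec

theorem IsWeakPartial.ae_eq_weakPartial (hΩ : IsOpen Ω) {u g : Eucl n → ℂ} {i : Fin n}
    (h : IsWeakPartial Ω i u g) : weakPartial Ω i u =ᵐ[volume.restrict Ω] g := by
  have hex : ∃ g, IsWeakPartial Ω i u g := ⟨g, h⟩
  rw [weakPartial, dif_pos hex]
  exact hex.choose_spec.ae_eq hΩ h

theorem MemH1.memLp_weakPartial (hΩ : IsOpen Ω) {u : Eucl n → ℂ} (h : MemH1 Ω u) (i : Fin n) :
    MemLp (weakPartial Ω i u) 2 (volume.restrict Ω) := by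
  obtain ⟨g, hg, hgL⟩ := h.2 i
  exact (memLp_congr_ae (hg.ae_eq_weakPartial hΩ)).2 hgL

/-- The kernel is centred at -εd with radius εδ, so the mollification at x sees only the points x +
ε(d + ξ) with ‖ξ‖ ≤ δ. By `hcone` those in the support of χ lie in Ω, hence differentiation commutes
with mollification at every x in Ω. -/
theorem exists_local_smooth_approx (hΩ : MeasurableSet Ω) {u : Eucl n → ℂ}
    {g : Fin n → Eucl n → ℂ} (hg : ∀ i, IsWeakPartial Ω i u (g i))
    (hu : MemLp u 2 (volume.restrict Ω)) (hgL : ∀ i, MemLp (g i) 2 (volume.restrict Ω))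
    {χ : Eucl n → ℝ} (hχ : ContDiff ℝ ∞ χ) (hχs : HasCompactSupport χ) {d : Eucl n} {δ ε₀ : ℝ}
    (hδ : 0 < δ) (hε₀ : 0 < ε₀)
    (hcone : ∀ x ∈ Ω, ∀ ε, 0 < ε → ε < ε₀ → ∀ ξ : Eucl n, ‖ξ‖ ≤ δ →
      x + ε • (d + ξ) ∈ tsupport χ → x + ε • (d + ξ) ∈ Ω) :
    ∃ w : ℕ → Eucl n → ℂ, (∀ m, ContDiff ℝ ∞ (w m)) ∧
      Tendsto (fun m => eLpNorm (fun x => w m x - χ x • u x) 2 (volume.restrict Ω)) atTop (𝓝 0) ∧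
      ∀ i, Tendsto (fun m => eLpNorm (fun x => fderiv ℝ (w m) x (stdVec i) -
        (χ x • g i x + fderiv ℝ χ x (stdVec i) • u x)) 2 (volume.restrict Ω)) atTop (𝓝 0) := by
  have hχ1 : ContDiff ℝ 1 χ := hχ.of_le (by exact_mod_cast le_top)
  have hmul {a : Eucl n → ℝ} (ha : Continuous a) (has : HasCompactSupport a) {w : Eucl n → ℂ}
      (hw : MemLp w 2 (volume.restrict Ω)) : MemLp (fun y => a y • w y) 2 (volume.restrict Ω) := by
    obtain ⟨C, hC⟩ := ha.bounded_above_of_compact_support has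
    exact MemLp.of_le_mul (c := C) hw (ha.aestronglyMeasurable.smul hw.1)
      (Eventually.of_forall fun y => by rw [norm_smul]; gcongr; exact hC y)
  have hF : MemLp (Ω.indicator fun y => χ y • u y) 2 volume :=
    (memLp_indicator_iff_restrict hΩ).2 (hmul hχ.continuous hχs hu)
  have hG (i) : MemLp (Ω.indicator fun y => χ y • g i y + fderiv ℝ χ y (stdVec i) • u y) 2
      volume := by
    refine (memLp_indicator_iff_restrict hΩ).2 ((hmul hχ.continuous hχs (hgL i)).add ?_)
    exact hmul ((hχ1.continuous_fderiv one_ne_zero).clm_apply continuous_const)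
      (hχs.fderiv_apply ℝ _) hu
  -- The 2 keeps ε m strictly below ε₀ already for m = 0.
  set ε : ℕ → ℝ := fun m => ε₀ / (m + 2) with hε
  have hεpos (m) : 0 < ε m := by positivity
  have hεlt (m : ℕ) : ε m < ε₀ := by
    rw [hε, div_lt_iff₀ (by positivity)]
    nlinarith [(Nat.cast_nonneg m : (0 : ℝ) ≤ m)]
  have hε0 : Tendsto ε atTop (𝓝 0) := by
    refine Tendsto.div_atTop tendsto_const_nhds ?_
    exact tendsto_atTop_add_const_right _ _ tendsto_natCast_atTop_atTop
  let B : ∀ m, ContDiffBump (-(ε m • d)) := fun m =>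
    ⟨ε m * δ / 2, ε m * δ, by have := hεpos m; positivity, by
      have := mul_pos (hεpos m) hδ; linarith⟩
  set k : ℕ → Eucl n → ℝ := fun m => (B m).normed volume with hk
  have hksm (m) : ContDiff ℝ ∞ (k m) := (B m).contDiff_normed
  have hkcs (m) : HasCompactSupport (k m) := (B m).hasCompactSupport_normed
  have hkts (m) : tsupport (k m) = Metric.closedBall (-(ε m • d)) (ε m * δ) :=
    (B m).tsupport_normed_eq
  have hR (m z) (hz : k m z ≠ 0) : ‖z‖ ≤ ε m * (‖d‖ + δ) := by
    have h1 : z ∈ tsupport (k m) := subset_tsupport _ hz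
    rw [hkts, Metric.mem_closedBall, dist_eq_norm, sub_neg_eq_add] at h1
    calc ‖z‖ = ‖(z + ε m • d) - ε m • d‖ := by rw [add_sub_cancel_right]
      _ ≤ ‖z + ε m • d‖ + ‖ε m • d‖ := norm_sub_le _ _
      _ ≤ ε m * δ + ε m * ‖d‖ := by
        rw [norm_smul, Real.norm_of_nonneg (hεpos m).le]; gcongr
      _ = _ := by ring
  have hR0 : Tendsto (fun m => ε m * (‖d‖ + δ)) atTop (𝓝 0) := by
    simpa using hε0.mul_const (‖d‖ + δ)
  have hconv {f : Eucl n → ℂ} (hf : MemLp f 2 volume) :=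
    tendsto_eLpNorm_mollify_sub (fun m => (hksm m).continuous) hkcs
      (fun m z => (B m).nonneg_normed z) (fun m => (B m).integral_normed) hR hR0 hf
  have hloc := hF.locallyIntegrable (by norm_num)
  refine ⟨fun m => mollify (k m) (Ω.indicator fun y => χ y • u y),
    fun m => contDiff_mollify (hksm m) (hkcs m) hloc, ?_, fun i => ?_⟩
  · refine tendsto_of_tendsto_of_tendsto_of_le_of_le tendsto_const_nhds (hconv hF)
      (fun _ => zero_le) fun m => ?_
    refine le_trans (le_of_eq ?_) (eLpNorm_mono_measure _ (Measure.restrict_le_self (s := Ω)))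
    refine eLpNorm_congr_ae ?_
    filter_upwards [ae_restrict_mem hΩ] with x hx
    rw [Set.indicator_of_mem hx]
  · refine tendsto_of_tendsto_of_tendsto_of_le_of_le tendsto_const_nhds (hconv (hG i))
      (fun _ => zero_le) fun m => ?_
    refine le_trans (le_of_eq ?_) (eLpNorm_mono_measure _ (Measure.restrict_le_self (s := Ω)))
    refine eLpNorm_congr_ae ?_
    filter_upwards [ae_restrict_mem hΩ] with x hx
    rw [Set.indicator_of_mem hx, fderiv_mollify_apply (hksm m) (hkcs m) hloc,
      (hg i).mollify_fderiv hΩ hu (hgL i) hχ hχs (hksm m) (hkcs m)]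
    intro y hy hxy
    rw [hkts, Metric.mem_closedBall, dist_eq_norm, sub_neg_eq_add] at hxy
    set ξ : Eucl n := (ε m)⁻¹ • (y - x) - d with hξ
    have hyx : x + ε m • (d + ξ) = y := by
      rw [hξ, add_sub_cancel, smul_inv_smul₀ (hεpos m).ne', add_sub_cancel]
    have hn : ‖ξ‖ ≤ δ := by
      have h1 : ε m • ξ = -(x - y + ε m • d) := by
        rw [hξ, smul_sub, smul_inv_smul₀ (hεpos m).ne']; abel
      have h2 : ε m * ‖ξ‖ ≤ ε m * δ := by
        rw [← norm_neg, ← h1, norm_smul, Real.norm_of_nonneg (hεpos m).le] at hxy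
        exact hxy
      exact le_of_mul_le_mul_left h2 (hεpos m)
    have := hcone x hx (ε m) (hεpos m) (hεlt m) ξ hn
    rw [hyx] at this
    exact this hy

theorem tendsto_eLpNorm_sum_sub {ι : Type*} [Fintype ι] {μ : Measure (Eucl n)}
    {f : ι → ℕ → Eucl n → ℂ} {F : ι → Eucl n → ℂ}
    (hm : ∀ i m, AEStronglyMeasurable (fun x => f i m x - F i x) μ)
    (h : ∀ i, Tendsto (fun m => eLpNorm (fun x => f i m x - F i x) 2 μ) atTop (𝓝 0)) :
    Tendsto (fun m => eLpNorm (fun x => ∑ i, f i m x - ∑ i, F i x) 2 μ) atTop (𝓝 0) := by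
  have hs : Tendsto (fun m => ∑ i, eLpNorm (fun x => f i m x - F i x) 2 μ) atTop (𝓝 0) := by
    simpa using tendsto_finsetSum Finset.univ fun i _ => h i
  refine tendsto_of_tendsto_of_tendsto_of_le_of_le tendsto_const_nhds hs (fun _ => zero_le)
    fun m => ?_
  refine le_trans (le_of_eq ?_) (eLpNorm_sum_le (fun i _ => hm i m) one_le_two)
  congr 1
  ext x
  rw [Finset.sum_apply, Finset.sum_sub_distrib]

namespace BoundaryAtlas

variable (A : BoundaryAtlas Ω)

/-- The functions of the partition of unity, the interior one having index `none`. -/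
noncomputable def cutoff (o : Option A.ι) : Eucl n → ℝ := o.elim A.χ₀ A.χ

theorem contDiff_cutoff (o : Option A.ι) : ContDiff ℝ ∞ (A.cutoff o) := by
  rcases o with _ | i
  exacts [A.contDiff₀, A.contDiff i]

theorem hasCompactSupport_cutoff (o : Option A.ι) : HasCompactSupport (A.cutoff o) := by
  rcases o with _ | i
  exacts [A.hasCompactSupport₀, A.hasCompactSupport i]

theorem sum_cutoff {x : Eucl n} (hx : x ∈ closure Ω) : ∑ o, A.cutoff o x = 1 := by
  rw [Fintype.sum_option]
  exact A.sum_eq_one x hx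

/-- This cancels the terms u ∂χ that the product rule leaves when the local approximations are added
up. -/
theorem sum_fderiv_cutoff (hΩ : IsOpen Ω) {x : Eucl n} (hx : x ∈ Ω) (d : Eucl n) :
    ∑ o, fderiv ℝ (A.cutoff o) x d = 0 := by
  have heq : (fun y => ∑ o, A.cutoff o y) =ᶠ[𝓝 x] fun _ => (1 : ℝ) := by
    filter_upwards [hΩ.mem_nhds hx] with y hy
    exact A.sum_cutoff (subset_closure hy)
  have h1 : HasFDerivAt (fun y => ∑ o, A.cutoff o y) (∑ o, fderiv ℝ (A.cutoff o) x) x :=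
    HasFDerivAt.fun_sum fun o _ => ((A.contDiff_cutoff o).differentiable (by simp) x).hasFDerivAt
  have h2 := heq.fderiv_eq (𝕜 := ℝ)
  rw [h1.fderiv, fderiv_const_apply] at h2
  simpa using congrArg (fun L => L d) h2

/-- The interior cutoff is supported in Ω, so any direction will do. In a chart the direction is the
axis `dir i`; the aperture makes ‖ξ‖(1 + K) at most 1/2, and ε₀ is so small that x itself stays in
the chart ball whenever the displaced point lies in the support. -/
theorem exists_cone (o : Option A.ι) : ∃ (d : Eucl n) (δ ε₀ : ℝ), 0 < δ ∧ 0 < ε₀ ∧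
    ∀ x ∈ Ω, ∀ ε, 0 < ε → ε < ε₀ → ∀ ξ : Eucl n, ‖ξ‖ ≤ δ →
      x + ε • (d + ξ) ∈ tsupport (A.cutoff o) → x + ε • (d + ξ) ∈ Ω := by
  rcases o with _ | i
  · exact ⟨0, 1, 1, one_pos, one_pos, fun x _ ε _ _ ξ _ h => A.tsupport_subset₀ h⟩
  · obtain ⟨θ, hθ, hsub⟩ := IsCompact.exists_thickening_subset_open (A.hasCompactSupport i)
      Metric.isOpen_ball (A.tsupport_subset i)
    have hK : (0 : ℝ) < 1 + A.K i := by positivity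
    refine ⟨A.dir i, (2 * (1 + A.K i : ℝ))⁻¹, θ / (1 + (2 * (1 + A.K i : ℝ))⁻¹), by positivity,
      by positivity, fun x hx ε hε hεlt ξ hξ hmem => ?_⟩
    refine (A.chart i).mem_of_add_smul_mem hx hε ?_ (hsub ?_) (A.tsupport_subset i hmem)
    · calc ‖ξ‖ * (1 + A.K i) ≤ (2 * (1 + A.K i : ℝ))⁻¹ * (1 + A.K i) := by gcongr
        _ = 2⁻¹ := by field_simp
        _ < 1 := by norm_num
    · refine Metric.mem_thickening_iff.2 ⟨_, hmem, ?_⟩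
      rw [dist_eq_norm, sub_add_cancel_left, norm_neg, norm_smul, Real.norm_of_nonneg hε.le]
      rw [lt_div_iff₀ (by positivity)] at hεlt
      refine lt_of_le_of_lt ?_ hεlt
      gcongr
      refine (norm_add_le _ _).trans ?_
      rw [(A.chart i).norm_eq]
      gcongr

end BoundaryAtlas

/-- Functions smooth up to the boundary are dense in `H¹(Ω)`. -/
theorem MemH1.exists_smooth_approx (hΩ : IsBoundedC2Domain Ω) {u : Eucl n → ℂ} (hu : MemH1 Ω u) :
    ∃ w : ℕ → Eucl n → ℂ, (∀ m, ContDiff ℝ ∞ (w m)) ∧ TendstoH1 Ω w u := by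
  obtain ⟨A⟩ := hΩ.nonempty_boundaryAtlas
  have hΩm := hΩ.isOpen.measurableSet
  have hloc (o : Option A.ι) : ∃ w : ℕ → Eucl n → ℂ, (∀ m, ContDiff ℝ ∞ (w m)) ∧
      Tendsto (fun m => eLpNorm (fun x => w m x - A.cutoff o x • u x) 2 (volume.restrict Ω))
        atTop (𝓝 0) ∧
      ∀ i, Tendsto (fun m => eLpNorm (fun x => fderiv ℝ (w m) x (stdVec i) -
        (A.cutoff o x • weakPartial Ω i u x + fderiv ℝ (A.cutoff o) x (stdVec i) • u x)) 2
        (volume.restrict Ω)) atTop (𝓝 0) := by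
    obtain ⟨d, δ, ε₀, hδ, hε₀, hcone⟩ := A.exists_cone o
    exact exists_local_smooth_approx hΩm hu.isWeakPartial hu.1 (hu.memLp_weakPartial hΩ.isOpen)
      (A.contDiff_cutoff o) (A.hasCompactSupport_cutoff o) hδ hε₀ hcone
  choose w hw hw0 hw1 using hloc
  have hχd (o) (i : Fin n) : Continuous fun x => fderiv ℝ (A.cutoff o) x (stdVec i) :=
    ((A.contDiff_cutoff o).continuous_fderiv (by simp)).clm_apply continuous_const
  refine ⟨fun m x => ∑ o, w o m x, fun m => ContDiff.sum fun o _ => hw o m, ?_, fun i => ?_⟩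
  · refine (tendsto_eLpNorm_sum_sub (fun o m => ?_) hw0).congr fun m => eLpNorm_congr_ae ?_
    · exact (hw o m).continuous.aestronglyMeasurable.sub
        ((A.contDiff_cutoff o).continuous.aestronglyMeasurable.smul hu.1.1)
    · filter_upwards [ae_restrict_mem hΩm] with x hx
      rw [← Finset.sum_smul, A.sum_cutoff (subset_closure hx), one_smul]
  · refine (tendsto_eLpNorm_sum_sub (fun o m => ?_) fun o => hw1 o i).congr
      fun m => eLpNorm_congr_ae ?_
    · refine (Continuous.aestronglyMeasurable ?_).sub
        (((A.contDiff_cutoff o).continuous.aestronglyMeasurable.smul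
          (hu.memLp_weakPartial hΩ.isOpen i).1).add
            ((hχd o i).aestronglyMeasurable.smul hu.1.1))
      exact ((hw o m).continuous_fderiv (by simp)).clm_apply continuous_const
    · filter_upwards [ae_restrict_mem hΩm] with x hx
      have h1 : HasFDerivAt (fun x => ∑ o, w o m x) (∑ o, fderiv ℝ (w o m) x) x :=
        HasFDerivAt.fun_sum fun o _ => ((hw o m).differentiable (by simp) x).hasFDerivAt
      rw [h1.fderiv, Finset.sum_add_distrib, ← Finset.sum_smul, ← Finset.sum_smul,
        A.sum_cutoff (subset_closure hx), A.sum_fderiv_cutoff hΩ.isOpen hx, one_smul, zero_smul,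
        add_zero, sum_apply]

end CarlemanEstimate

/-! ### The trace inequality and existence of traces. -/

namespace CarlemanEstimate

variable {n : ℕ} {Ω : Set (Eucl n)}

theorem integrableOn_of_continuous {F : Type*} [NormedAddCommGroup F]
    (hb : Bornology.IsBounded Ω) {f : Eucl n → F} (hf : Continuous f) : IntegrableOn f Ω volume :=
  (hf.continuousOn.integrableOn_compact hb.isCompact_closure).mono_set subset_closure

theorem memLp_two_of_continuous (hb : Bornology.IsBounded Ω) {f : Eucl n → ℂ}
    (hf : Continuous f) : MemLp f 2 (volume.restrict Ω) := by
  rw [memLp_two_iff_integrable_sq_norm hf.aestronglyMeasurable]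
  exact integrableOn_of_continuous hb (hf.norm.pow 2)

theorem eLpNorm_two_sq_eq_ofReal {α : Type*} [MeasurableSpace α] {μ : Measure α} {f : α → ℂ}
    (hf : MemLp f 2 μ) : eLpNorm f 2 μ ^ 2 = ENNReal.ofReal (∫ x, ‖f x‖ ^ 2 ∂μ) := by
  rw [eLpNorm_two_sq_eq_lintegral, ofReal_integral_eq_lintegral_ofReal
    ((memLp_two_iff_integrable_sq_norm hf.1).1 hf) (Eventually.of_forall fun x => by positivity)]
  refine lintegral_congr fun x => ?_
  rw [ENNReal.ofReal_pow (norm_nonneg _), ofReal_norm]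

namespace BoundaryAtlas

variable (A : BoundaryAtlas Ω)

theorem setIntegral_fderiv_real (hΩ : IsBoundedC2Domain Ω) {a : Eucl n → ℝ} (ha : ContDiff ℝ 1 a)
    (d : Eucl n) :
    ∫ x in Ω, fderiv ℝ a x d = ∫ x, ⟪outwardNormal Ω x, d⟫_ℝ * a x ∂A.area := by
  have h := A.setIntegral_fderiv hΩ (a := fun x => ((a x : ℝ) : ℂ))
    (Complex.ofRealCLM.contDiff.comp ha) d
  have h1 (x) : fderiv ℝ (fun x => ((a x : ℝ) : ℂ)) x d = ((fderiv ℝ a x d : ℝ) : ℂ) := by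
    have h2 : HasFDerivAt (fun x => ((a x : ℝ) : ℂ)) _ x :=
      Complex.ofRealCLM.hasFDerivAt.comp x ((ha.differentiable one_ne_zero) x).hasFDerivAt
    rw [h2.fderiv]
    rfl
  simp only [h1, Complex.real_smul, ← Complex.ofReal_mul] at h
  rw [integral_complex_ofReal, integral_complex_ofReal] at h
  exact_mod_cast h

theorem integrable_area (hΩ : IsBoundedC2Domain Ω) {F : Type*} [NormedAddCommGroup F]
    {f : Eucl n → F} (hf : ContinuousOn f (frontier Ω)) : Integrable f A.area :=
  integrable_of_continuousOn_frontier hΩ.isBounded (A.ae_area_mem_frontier hΩ.isOpen) hf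

/-- The trace inequality for the area measure. -/
theorem exists_trace_le (hΩ : IsBoundedC2Domain Ω) : ∃ C : ℝ, 0 ≤ C ∧ ∀ w : Eucl n → ℂ,
    ContDiff ℝ ∞ w → ∫ x, ‖w x‖ ^ 2 ∂A.area ≤
      C * ∑ i, (∫ x in Ω, (‖w x‖ ^ 2 + ‖fderiv ℝ w x (stdVec i)‖ ^ 2)) := by
  -- Apply the divergence theorem to |w|² X, with X the transversal field. On ∂Ω the flux is at
  -- least c|w|², while div(|w|² X) is controlled by |w|² and |∂_i w|².
  obtain ⟨c, hc, hX⟩ := A.exists_le_inner_transversal hΩ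
  have hXi (i : Fin n) : ContDiff ℝ ∞ fun x => A.transversal x i := by
    have := A.contDiff_transversal
    fun_prop
  have hXi1 (i : Fin n) : ContDiff ℝ 1 fun x => A.transversal x i :=
    (hXi i).of_le (by exact_mod_cast le_top)
  have hbd (i : Fin n) : ∃ B : ℝ, ∀ x ∈ closure Ω, |A.transversal x i| ≤ B ∧
      |fderiv ℝ (fun x => A.transversal x i) x (stdVec i)| ≤ B := by
    obtain ⟨B1, h1⟩ := hΩ.isBounded.isCompact_closure.exists_bound_of_continuousOn
      (hXi i).continuous.continuousOn
    obtain ⟨B2, h2⟩ := hΩ.isBounded.isCompact_closure.exists_bound_of_continuousOn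
      (f := fun x => fderiv ℝ (fun x => A.transversal x i) x (stdVec i))
      (((hXi1 i).continuous_fderiv one_ne_zero).clm_apply continuous_const).continuousOn
    exact ⟨max B1 B2, fun x hx => ⟨(h1 x hx).trans (le_max_left _ _),
      (h2 x hx).trans (le_max_right _ _)⟩⟩
  choose B hB using hbd
  set D : ℝ := ∑ i, |B i| with hD
  have hD0 : 0 ≤ D := Finset.sum_nonneg fun i _ => abs_nonneg _
  have hBD (i) : B i ≤ D := (le_abs_self _).trans
    (Finset.single_le_sum (f := fun i => |B i|) (fun j _ => abs_nonneg _) (Finset.mem_univ i))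
  refine ⟨c⁻¹ * (2 * D), by positivity, fun w hw => ?_⟩
  have hw1 : ContDiff ℝ 1 w := hw.of_le (by exact_mod_cast le_top)
  have hwd (i : Fin n) : Continuous fun x => fderiv ℝ w x (stdVec i) :=
    (hw1.continuous_fderiv one_ne_zero).clm_apply continuous_const
  have hb (i : Fin n) : ContDiff ℝ 1 fun x => A.transversal x i * ‖w x‖ ^ 2 :=
    (hXi1 i).mul (hw1.norm_sq ℝ)
  have hder (i : Fin n) (x) : fderiv ℝ (fun x => A.transversal x i * ‖w x‖ ^ 2) x (stdVec i) =
      A.transversal x i * (2 * ⟪w x, fderiv ℝ w x (stdVec i)⟫_ℝ) +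
        ‖w x‖ ^ 2 * fderiv ℝ (fun x => A.transversal x i) x (stdVec i) := by
    have h1 : HasFDerivAt (fun x => A.transversal x i * ‖w x‖ ^ 2) _ x :=
      ((hXi1 i).differentiable one_ne_zero x).hasFDerivAt.mul
        ((hw1.differentiable one_ne_zero) x).hasFDerivAt.norm_sq
    rw [h1.fderiv]
    simp only [add_apply, smul_apply, ContinuousLinearMap.comp_apply, innerSL_apply_apply,
      smul_eq_mul, nsmul_eq_mul, Nat.cast_ofNat]
  have hle (i : Fin n) : ∫ x, ⟪outwardNormal Ω x, stdVec i⟫_ℝ * (A.transversal x i * ‖w x‖ ^ 2)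
      ∂A.area ≤ 2 * D * ∫ x in Ω, (‖w x‖ ^ 2 + ‖fderiv ℝ w x (stdVec i)‖ ^ 2) := by
    rw [← A.setIntegral_fderiv_real hΩ (hb i), ← integral_const_mul]
    refine setIntegral_mono_on ?_ ?_ hΩ.isOpen.measurableSet fun x hx => ?_
    · exact integrableOn_of_continuous hΩ.isBounded
        (((hb i).continuous_fderiv one_ne_zero).clm_apply continuous_const)
    · exact integrableOn_of_continuous hΩ.isBounded
        (continuous_const.mul ((hw.continuous.norm.pow 2).add ((hwd i).norm.pow 2)))
    · rw [hder]
      have h1 := hB i x (subset_closure hx)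
      have h2 := abs_real_inner_le_norm (w x) (fderiv ℝ w x (stdVec i))
      have h3 : 2 * |⟪w x, fderiv ℝ w x (stdVec i)⟫_ℝ| ≤
          ‖w x‖ ^ 2 + ‖fderiv ℝ w x (stdVec i)‖ ^ 2 := by
        nlinarith [sq_nonneg (‖w x‖ - ‖fderiv ℝ w x (stdVec i)‖)]
      have h4 : A.transversal x i * (2 * ⟪w x, fderiv ℝ w x (stdVec i)⟫_ℝ) ≤
          D * (‖w x‖ ^ 2 + ‖fderiv ℝ w x (stdVec i)‖ ^ 2) := by
        refine (le_abs_self _).trans ?_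
        rw [abs_mul, abs_mul, abs_two]
        exact mul_le_mul (h1.1.trans (hBD i)) h3 (by positivity) hD0
      have h5 : ‖w x‖ ^ 2 * fderiv ℝ (fun x => A.transversal x i) x (stdVec i) ≤ ‖w x‖ ^ 2 * D := by
        gcongr
        exact (le_abs_self _).trans (h1.2.trans (hBD i))
      nlinarith [mul_nonneg hD0 (sq_nonneg ‖fderiv ℝ w x (stdVec i)‖)]
  have hνi (i : Fin n) : ContinuousOn (fun x => ⟪outwardNormal Ω x, (stdVec i : Eucl n)⟫_ℝ)
      (frontier Ω) := (A.continuousOn_outwardNormal hΩ.isOpen).inner continuousOn_const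
  have hsum : c * ∫ x, ‖w x‖ ^ 2 ∂A.area ≤ ∑ i, ∫ x, ⟪outwardNormal Ω x, stdVec i⟫_ℝ *
      (A.transversal x i * ‖w x‖ ^ 2) ∂A.area := by
    rw [← integral_const_mul, ← integral_finsetSum]
    · refine integral_mono_ae ?_ ?_ ?_
      · exact A.integrable_area hΩ (continuous_const.mul (hw.continuous.norm.pow 2)).continuousOn
      · exact integrable_finsetSum _ fun i _ => A.integrable_area hΩ
          ((hνi i).mul (hb i).continuous.continuousOn)
      · filter_upwards [A.ae_area_mem_frontier hΩ.isOpen] with x hx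
        have h1 := hX x hx
        have h2 : ⟪outwardNormal Ω x, A.transversal x⟫_ℝ =
            ∑ i, ⟪outwardNormal Ω x, stdVec i⟫_ℝ * A.transversal x i := by
          rw [PiLp.inner_apply]
          refine Finset.sum_congr rfl fun i _ => ?_
          simp [EuclideanSpace.inner_single_right, mul_comm]
        rw [h2] at h1
        simp only [← mul_assoc, ← Finset.sum_mul]
        gcongr
    · exact fun i _ => A.integrable_area hΩ ((hνi i).mul (hb i).continuous.continuousOn)
  rw [mul_assoc, inv_mul_eq_div, le_div_iff₀' hc, Finset.mul_sum]
  exact hsum.trans (Finset.sum_le_sum fun i _ => hle i)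

end BoundaryAtlas

/-- The trace inequality. -/
theorem exists_eLpNorm_trace_le (hΩ : IsBoundedC2Domain Ω) : ∃ C : ℝ≥0, ∀ w : Eucl n → ℂ,
    ContDiff ℝ ∞ w → eLpNorm w 2 (surfaceMeasure Ω) ^ 2 ≤
      C * ∑ i, (eLpNorm w 2 (volume.restrict Ω) ^ 2 +
        eLpNorm (fun x => fderiv ℝ w x (stdVec i)) 2 (volume.restrict Ω) ^ 2) := by
  obtain ⟨A⟩ := hΩ.nonempty_boundaryAtlas
  obtain ⟨C, hC, h⟩ := A.exists_trace_le hΩ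
  obtain ⟨K, hK⟩ := A.surfaceMeasure_le hΩ.isOpen
  refine ⟨K * C.toNNReal, fun w hw => ?_⟩
  have hw1 : ContDiff ℝ 1 w := hw.of_le (by exact_mod_cast le_top)
  have hwd (i : Fin n) : Continuous fun x => fderiv ℝ w x (stdVec i) :=
    (hw1.continuous_fderiv one_ne_zero).clm_apply continuous_const
  have hwL := memLp_two_of_continuous hΩ.isBounded hw.continuous
  have hwdL (i : Fin n) := memLp_two_of_continuous hΩ.isBounded (hwd i)
  have hwA : MemLp w 2 A.area := by
    rw [memLp_two_iff_integrable_sq_norm hw.continuous.aestronglyMeasurable]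
    exact A.integrable_area hΩ (hw.continuous.norm.pow 2).continuousOn
  have h1 : eLpNorm w 2 (surfaceMeasure Ω) ^ 2 ≤ K * eLpNorm w 2 A.area ^ 2 := by
    rw [eLpNorm_two_sq_eq_lintegral, eLpNorm_two_sq_eq_lintegral]
    refine (lintegral_mono' hK le_rfl).trans ?_
    rw [ENNReal.smul_def, lintegral_smul_measure, smul_eq_mul]
  have h2 (i : Fin n) : eLpNorm w 2 (volume.restrict Ω) ^ 2 +
      eLpNorm (fun x => fderiv ℝ w x (stdVec i)) 2 (volume.restrict Ω) ^ 2 =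
      ENNReal.ofReal (∫ x in Ω, (‖w x‖ ^ 2 + ‖fderiv ℝ w x (stdVec i)‖ ^ 2)) := by
    rw [eLpNorm_two_sq_eq_ofReal hwL, eLpNorm_two_sq_eq_ofReal (hwdL i),
      ← ENNReal.ofReal_add (integral_nonneg fun _ => by positivity)
        (integral_nonneg fun _ => by positivity), integral_add
        (f := fun x => ‖w x‖ ^ 2) (g := fun x => ‖fderiv ℝ w x (stdVec i)‖ ^ 2)
        (integrableOn_of_continuous hΩ.isBounded (hw.continuous.norm.pow 2))
        (integrableOn_of_continuous hΩ.isBounded ((hwd i).norm.pow 2))]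
  refine h1.trans ?_
  simp only [h2]
  rw [eLpNorm_two_sq_eq_ofReal hwA, ← ENNReal.ofReal_sum_of_nonneg fun i _ =>
    integral_nonneg fun _ => by positivity]
  push_cast
  rw [mul_assoc]
  gcongr
  rw [show ((C.toNNReal : ℝ≥0) : ℝ≥0∞) = ENNReal.ofReal C from rfl, ← ENNReal.ofReal_mul hC]
  exact ENNReal.ofReal_le_ofReal (h w hw)

theorem isFiniteMeasure_surfaceMeasure (hΩ : IsBoundedC2Domain Ω) :
    IsFiniteMeasure (surfaceMeasure Ω) := by
  obtain ⟨A⟩ := hΩ.nonempty_boundaryAtlas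
  obtain ⟨K, hK⟩ := A.surfaceMeasure_le hΩ.isOpen
  exact isFiniteMeasure_of_le _ hK

/-- Every function in `H¹(Ω)` has a trace. -/
theorem MemH1.exists_isSobolevTrace (hΩ : IsBoundedC2Domain Ω) {u : Eucl n → ℂ}
    (hu : MemH1 Ω u) : ∃ g, IsSobolevTrace Ω u g := by
  obtain ⟨w, hw, hw0, hw1⟩ := hu.exists_smooth_approx hΩ
  obtain ⟨C, hC⟩ := exists_eLpNorm_trace_le hΩ
  have := isFiniteMeasure_surfaceMeasure hΩ
  have hwL (m) : MemLp (w m) 2 (surfaceMeasure Ω) := by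
    rw [memLp_two_iff_integrable_sq_norm (hw m).continuous.aestronglyMeasurable]
    exact BoundaryAtlas.integrable_of_continuousOn_frontier hΩ.isBounded
      (ae_surfaceMeasure_mem_frontier Ω) ((hw m).continuous.norm.pow 2).continuousOn
  -- The approximants are Cauchy in H¹(Ω). The trace inequality applied to their differences makes
  -- the boundary values Cauchy in L²(∂Ω), and the trace is their limit.
  have hcauchy {f : ℕ → Eucl n → ℂ} {F : Eucl n → ℂ} (hf : ∀ m, Continuous (f m))
      (hF : AEStronglyMeasurable F (volume.restrict Ω))
      (h : Tendsto (fun m => eLpNorm (fun x => f m x - F x) 2 (volume.restrict Ω)) atTop (𝓝 0)) :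
      Tendsto (fun p : ℕ × ℕ => eLpNorm (fun x => f p.1 x - f p.2 x) 2 (volume.restrict Ω))
        atTop (𝓝 0) := by
    have h1 := (h.comp tendsto_fst).add (h.comp tendsto_snd)
    rw [prod_atTop_atTop_eq, add_zero] at h1
    refine tendsto_of_tendsto_of_tendsto_of_le_of_le tendsto_const_nhds h1 (fun _ => zero_le)
      fun p => ?_
    refine le_trans (le_of_eq ?_) (eLpNorm_sub_le ((hf p.1).aestronglyMeasurable.sub hF)
      ((hf p.2).aestronglyMeasurable.sub hF) one_le_two)
    congr 1
    ext x
    simp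
  have hlim : Tendsto (fun p : ℕ × ℕ => C * ∑ i : Fin n,
      (eLpNorm (fun x => w p.1 x - w p.2 x) 2 (volume.restrict Ω) ^ 2 +
        eLpNorm (fun x => fderiv ℝ (w p.1) x (stdVec i) - fderiv ℝ (w p.2) x (stdVec i)) 2
          (volume.restrict Ω) ^ 2)) atTop (𝓝 0) := by
    have h0 := hcauchy (fun m => (hw m).continuous) hu.1.1 hw0
    have h1 (i : Fin n) := hcauchy (fun m => ((hw m).continuous_fderiv (by simp)).clm_apply
      continuous_const) (hu.memLp_weakPartial hΩ.isOpen i).1 (hw1 i)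
    have h2 : Tendsto (fun p : ℕ × ℕ => ∑ i : Fin n,
      (eLpNorm (fun x => w p.1 x - w p.2 x) 2 (volume.restrict Ω) ^ 2 +
        eLpNorm (fun x => fderiv ℝ (w p.1) x (stdVec i) - fderiv ℝ (w p.2) x (stdVec i)) 2
          (volume.restrict Ω) ^ 2)) atTop (𝓝 (∑ i : Fin n, ((0 : ℝ≥0∞) ^ 2 + 0 ^ 2))) :=
      tendsto_finsetSum _ fun i _ => ((ENNReal.continuous_pow 2).tendsto 0 |>.comp h0).add
        ((ENNReal.continuous_pow 2).tendsto 0 |>.comp (h1 i))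
    have h3 := ENNReal.Tendsto.const_mul (a := C) h2 (Or.inr ENNReal.coe_ne_top)
    simpa using h3
  have hsq : Tendsto (fun p : ℕ × ℕ => eLpNorm (w p.1 - w p.2) 2 (surfaceMeasure Ω) ^ 2) atTop
      (𝓝 0) := by
    refine tendsto_of_tendsto_of_tendsto_of_le_of_le tendsto_const_nhds hlim (fun _ => zero_le)
      fun p => ?_
    refine (hC (w p.1 - w p.2) ((hw p.1).sub (hw p.2))).trans (le_of_eq ?_)
    congr 2
    ext i
    congr 3
    ext x
    rw [fderiv_sub ((hw p.1).differentiable (by simp) x) ((hw p.2).differentiable (by simp) x)]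
    rfl
  have hC2 : Tendsto (fun p : ℕ × ℕ => eLpNorm (w p.1 - w p.2) 2 (surfaceMeasure Ω)) atTop
      (𝓝 0) := by
    rw [ENNReal.tendsto_nhds_zero] at hsq ⊢
    intro ε hε
    filter_upwards [hsq (ε ^ 2) (by positivity)] with p hp
    exact (ENNReal.pow_le_pow_left_iff two_ne_zero).1 hp
  have hCS := (Lp.cauchySeq_Lp_iff_cauchySeq_eLpNorm fun m => (hwL m).toLp (w m)).2 (by
    refine hC2.congr fun p => eLpNorm_congr_ae ?_
    filter_upwards [(hwL p.1).coeFn_toLp, (hwL p.2).coeFn_toLp] with x h1 h2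
    simp [h1, h2])
  obtain ⟨G, hG⟩ := cauchySeq_tendsto_of_complete hCS
  refine ⟨G, hu, Lp.memLp G, w, hw, ⟨hw0, hw1⟩, ?_⟩
  rw [Lp.tendsto_Lp_iff_tendsto_eLpNorm'] at hG
  refine hG.congr fun m => eLpNorm_congr_ae ?_
  filter_upwards [(hwL m).coeFn_toLp] with x h1
  simp [h1]

theorem MemH1.isSobolevTrace (hΩ : IsBoundedC2Domain Ω) {u : Eucl n → ℂ} (hu : MemH1 Ω u) :
    IsSobolevTrace Ω u (sobolevTrace Ω u) := by
  have hex := hu.exists_isSobolevTrace hΩ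
  rw [sobolevTrace, dif_pos hex]
  exact hex.choose_spec

end CarlemanEstimate

/-! ### Weighted L² pairings and Green's formula. -/

namespace CarlemanEstimate

variable {n : ℕ} {Ω : Set (Eucl n)}

/-- Convergence of square-integrable functions in `L²(μ)`. -/
structure TendstoL2 (μ : Measure (Eucl n)) (f : ℕ → Eucl n → ℂ) (F : Eucl n → ℂ) : Prop where
  memLp : ∀ m, MemLp (f m) 2 μ
  memLp_lim : MemLp F 2 μ
  tendsto : Tendsto (fun m => eLpNorm (fun x => f m x - F x) 2 μ) atTop (𝓝 0)

/-- The sesquilinear pairing of `L²(μ)` with weight `b`. -/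
noncomputable def pairing (μ : Measure (Eucl n)) (b : Eucl n → ℝ) (f h : Eucl n → ℂ) : ℂ :=
  ∫ x, b x • (f x * starRingEnd ℂ (h x)) ∂μ

/-- A measurable weight that is essentially bounded. -/
def IsBddWeight (μ : Measure (Eucl n)) (b : Eucl n → ℝ) : Prop :=
  AEStronglyMeasurable b μ ∧ ∃ B : ℝ, ∀ᵐ x ∂μ, ‖b x‖ ≤ B

section L2

variable {μ : Measure (Eucl n)} {b c : Eucl n → ℝ} {f h f' h' : Eucl n → ℂ}

theorem IsBddWeight.memLp_smul (hb : IsBddWeight μ b) (hf : MemLp f 2 μ) :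
    MemLp (fun x => b x • f x) 2 μ := by
  obtain ⟨hm, B, hB⟩ := hb
  refine MemLp.of_le_mul (c := B) hf (hm.smul hf.1) ?_
  filter_upwards [hB] with x hx
  rw [norm_smul]
  gcongr

theorem IsBddWeight.integrable (hb : IsBddWeight μ b) (hf : MemLp f 2 μ) (hh : MemLp h 2 μ) :
    Integrable (fun x => b x • (f x * starRingEnd ℂ (h x))) μ := by
  have hstar : MemLp (fun x => starRingEnd ℂ (h x)) 2 μ := hh.star
  have := (hb.memLp_smul hf).integrable_mul hstar
  refine this.congr (Eventually.of_forall fun x => ?_)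
  simp only [Pi.mul_apply, smul_mul_assoc]

theorem TendstoL2.smul {s : ℕ → Eucl n → ℂ} (hs : TendstoL2 μ s f) (hb : IsBddWeight μ b) :
    TendstoL2 μ (fun m x => b x • s m x) (fun x => b x • f x) := by
  refine ⟨fun m => hb.memLp_smul (hs.memLp m), hb.memLp_smul hs.memLp_lim, ?_⟩
  obtain ⟨hm, B, hB⟩ := hb
  have h1 : Tendsto (fun m => ENNReal.ofReal B * eLpNorm (fun x => s m x - f x) 2 μ) atTop
      (𝓝 0) := by
    simpa using ENNReal.Tendsto.const_mul hs.tendsto (Or.inr ENNReal.ofReal_ne_top)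
  refine tendsto_of_tendsto_of_tendsto_of_le_of_le tendsto_const_nhds h1 (fun _ => zero_le)
    fun m => eLpNorm_le_mul_eLpNorm_of_ae_le_mul ?_ 2
  filter_upwards [hB] with x hx
  rw [← smul_sub, norm_smul]
  gcongr

theorem TendstoL2.tendsto_integral_mul_conj {s t : ℕ → Eucl n → ℂ} (hs : TendstoL2 μ s f)
    (ht : TendstoL2 μ t h) :
    Tendsto (fun m => ∫ x, s m x * starRingEnd ℂ (t m x) ∂μ) atTop
      (𝓝 (∫ x, f x * starRingEnd ℂ (h x) ∂μ)) := by
  have key {u : ℕ → Eucl n → ℂ} {U : Eucl n → ℂ} (hu : TendstoL2 μ u U) :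
      Tendsto (fun m => (hu.memLp m).toLp (u m)) atTop (𝓝 (hu.memLp_lim.toLp U)) := by
    rw [Lp.tendsto_Lp_iff_tendsto_eLpNorm'']
    exact hu.tendsto
  have h1 := Filter.Tendsto.inner (𝕜 := ℂ) (key ht) (key hs)
  have h2 {a a' : Eucl n → ℂ} (ha : MemLp a 2 μ) (ha' : MemLp a' 2 μ) :
      ⟪ha.toLp a, ha'.toLp a'⟫_ℂ = ∫ x, a' x * starRingEnd ℂ (a x) ∂μ := by
    rw [L2.inner_def]
    refine integral_congr_ae ?_
    filter_upwards [ha.coeFn_toLp, ha'.coeFn_toLp] with x e1 e2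
    rw [e1, e2, RCLike.inner_apply]
  simpa only [h2] using h1

theorem TendstoL2.tendsto_pairing {s t : ℕ → Eucl n → ℂ} (hs : TendstoL2 μ s f)
    (ht : TendstoL2 μ t h) (hb : IsBddWeight μ b) :
    Tendsto (fun m => pairing μ b (s m) (t m)) atTop (𝓝 (pairing μ b f h)) := by
  have := (hs.smul hb).tendsto_integral_mul_conj ht
  simpa only [pairing, smul_mul_assoc] using this

theorem pairing_add_left (hb : IsBddWeight μ b) (hf : MemLp f 2 μ) (hf' : MemLp f' 2 μ)
    (hh : MemLp h 2 μ) :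
    pairing μ b (fun x => f x + f' x) h = pairing μ b f h + pairing μ b f' h := by
  rw [pairing, pairing, pairing, ← integral_add (hb.integrable hf hh) (hb.integrable hf' hh)]
  simp only [add_mul, smul_add]

theorem pairing_conj (μ : Measure (Eucl n)) (b : Eucl n → ℝ) (f h : Eucl n → ℂ) :
    starRingEnd ℂ (pairing μ b f h) = pairing μ b h f := by
  rw [pairing, pairing, ← integral_conj]
  congr 1
  ext x
  simp only [Complex.real_smul, map_mul, Complex.conj_ofReal, Complex.conj_conj]
  ring

theorem pairing_re_comm (μ : Measure (Eucl n)) (b : Eucl n → ℝ) (f h : Eucl n → ℂ) :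
    (pairing μ b f h).re = (pairing μ b h f).re := by
  rw [← pairing_conj, Complex.conj_re]

theorem pairing_smul_weight (a : ℝ) : pairing μ (fun x => a * b x) f h = a • pairing μ b f h := by
  rw [pairing, pairing, ← integral_smul]
  simp only [mul_smul]

theorem pairing_congr (hf : f =ᵐ[μ] f') (hh : h =ᵐ[μ] h') :
    pairing μ b f h = pairing μ b f' h' := by
  refine integral_congr_ae ?_
  filter_upwards [hf, hh] with x h1 h2
  rw [h1, h2]

theorem pairing_sum_left {ι : Type*} [Fintype ι] {f : ι → Eucl n → ℂ} (hb : IsBddWeight μ b)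
    (hf : ∀ i, MemLp (f i) 2 μ) (hh : MemLp h 2 μ) :
    pairing μ b (fun x => ∑ i, f i x) h = ∑ i, pairing μ b (f i) h := by
  simp only [pairing]
  rw [← integral_finsetSum _ fun i _ => hb.integrable (hf i) hh]
  simp only [Finset.sum_mul, Finset.smul_sum]

theorem pairing_smul_left (a : ℝ) : pairing μ b (fun x => a • f x) h = a • pairing μ b f h := by
  rw [pairing, pairing, ← integral_smul]
  simp only [smul_mul_assoc, smul_comm a]

theorem pairing_smul_right (a : ℝ) : pairing μ b f (fun x => a • h x) = a • pairing μ b f h := by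
  rw [pairing, pairing, ← integral_smul]
  congr 1
  ext x
  simp only [Complex.real_smul, map_mul, Complex.conj_ofReal]
  ring

theorem pairing_sum_right {ι : Type*} [Fintype ι] {h : ι → Eucl n → ℂ} (hb : IsBddWeight μ b)
    (hf : MemLp f 2 μ) (hh : ∀ i, MemLp (h i) 2 μ) :
    pairing μ b f (fun x => ∑ i, h i x) = ∑ i, pairing μ b f (h i) := by
  simp only [pairing]
  rw [← integral_finsetSum _ fun i _ => hb.integrable hf (hh i)]
  simp only [map_sum, Finset.mul_sum, Finset.smul_sum]

theorem pairing_self_re : (pairing μ b f f).re = ∫ x, b x * ‖f x‖ ^ 2 ∂μ := by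
  have h1 : pairing μ b f f = ∫ x, ((b x * ‖f x‖ ^ 2 : ℝ) : ℂ) ∂μ := by
    rw [pairing]
    congr 1
    ext x
    rw [Complex.mul_conj, Complex.normSq_eq_norm_sq, Complex.real_smul]
    push_cast
    ring
  rw [h1, integral_complex_ofReal, Complex.ofReal_re]

theorem pairing_re (hb : IsBddWeight μ b) (hf : MemLp f 2 μ) (hh : MemLp h 2 μ) :
    (pairing μ b f h).re = ∫ x, b x * (f x * starRingEnd ℂ (h x)).re ∂μ := by
  have h1 := integral_re (𝕜 := ℂ) (hb.integrable hf hh)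
  simp only [Complex.real_smul, RCLike.re_eq_complex_re, Complex.re_ofReal_mul] at h1
  rw [pairing]
  simp only [Complex.real_smul]
  exact h1.symm

end L2

theorem isBddWeight_of_continuous (hb : Bornology.IsBounded Ω) (hΩ : MeasurableSet Ω)
    {b : Eucl n → ℝ} (h : Continuous b) : IsBddWeight (volume.restrict Ω) b := by
  obtain ⟨B, hB⟩ := hb.isCompact_closure.exists_bound_of_continuousOn h.continuousOn
  exact ⟨h.aestronglyMeasurable, B, (ae_restrict_mem hΩ).mono fun x hx => hB x (subset_closure hx)⟩

namespace BoundaryAtlas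

variable (A : BoundaryAtlas Ω)

theorem isBddWeight_area (hΩ : IsBoundedC2Domain Ω) {b : Eucl n → ℝ}
    (h : ContinuousOn b (frontier Ω)) : IsBddWeight A.area b := by
  have hcomp : IsCompact (frontier Ω) :=
    hΩ.isBounded.isCompact_closure.of_isClosed_subset isClosed_frontier frontier_subset_closure
  obtain ⟨B, hB⟩ := hcomp.exists_bound_of_continuousOn h
  exact ⟨(A.integrable_area hΩ h).1, B, (A.ae_area_mem_frontier hΩ.isOpen).mono hB⟩

/-- `u ∈ H¹(Ω)` has weak gradient `U` and trace `g`, the trace being taken with respect to the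
area measure. -/
def HasTrace (u : Eucl n → ℂ) (U : Fin n → Eucl n → ℂ) (g : Eucl n → ℂ) : Prop :=
  ∃ w : ℕ → Eucl n → ℂ, (∀ m, ContDiff ℝ ∞ (w m)) ∧ TendstoL2 (volume.restrict Ω) w u ∧
    (∀ i, TendstoL2 (volume.restrict Ω) (fun m x => fderiv ℝ (w m) x (stdVec i)) (U i)) ∧
    TendstoL2 A.area w g

variable {A}

theorem HasTrace.memLp {u : Eucl n → ℂ} {U : Fin n → Eucl n → ℂ} {g : Eucl n → ℂ}
    (h : A.HasTrace u U g) : MemLp u 2 (volume.restrict Ω) := by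
  obtain ⟨w, -, h, -, -⟩ := h
  exact h.memLp_lim

theorem HasTrace.memLp_grad {u : Eucl n → ℂ} {U : Fin n → Eucl n → ℂ} {g : Eucl n → ℂ}
    (h : A.HasTrace u U g) (i : Fin n) : MemLp (U i) 2 (volume.restrict Ω) := by
  obtain ⟨w, -, -, h, -⟩ := h
  exact (h i).memLp_lim

theorem HasTrace.memLp_trace {u : Eucl n → ℂ} {U : Fin n → Eucl n → ℂ} {g : Eucl n → ℂ}
    (h : A.HasTrace u U g) : MemLp g 2 A.area := by
  obtain ⟨w, -, -, -, h⟩ := h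
  exact h.memLp_lim

theorem memLp_area_of_continuous (A : BoundaryAtlas Ω) (hΩ : IsBoundedC2Domain Ω)
    {f : Eucl n → ℂ} (hf : Continuous f) : MemLp f 2 A.area := by
  rw [memLp_two_iff_integrable_sq_norm hf.aestronglyMeasurable]
  exact A.integrable_area hΩ (hf.norm.pow 2).continuousOn

/-- With the constant 1 as second argument, Green's formula becomes integration by parts of a single
H¹ function against a smooth test function. -/
theorem hasTrace_one (A : BoundaryAtlas Ω) (hΩ : IsBoundedC2Domain Ω) :
    A.HasTrace (fun _ => 1) (fun _ _ => 0) (fun _ => 1) := by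
  have h1 := memLp_two_of_continuous hΩ.isBounded (f := fun _ : Eucl n => (1 : ℂ)) (by fun_prop)
  have h0 := memLp_two_of_continuous hΩ.isBounded (f := fun _ : Eucl n => (0 : ℂ)) (by fun_prop)
  have h2 := A.memLp_area_of_continuous hΩ (f := fun _ => (1 : ℂ)) (by fun_prop)
  refine ⟨fun _ _ => 1, fun _ => contDiff_const, ⟨fun _ => h1, h1, by simp⟩,
    fun i => ⟨fun _ => by simp, h0, by simp⟩, ⟨fun _ => h2, h2, by simp⟩⟩

/-- Since `area` is at most a multiple of the surface measure, L² convergence for the latter passes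
to the former. -/
theorem hasTrace_of_isSobolevTrace (A : BoundaryAtlas Ω) (hΩ : IsBoundedC2Domain Ω)
    {u g : Eucl n → ℂ} (h : IsSobolevTrace Ω u g) :
    A.HasTrace u (fun i => weakPartial Ω i u) g := by
  obtain ⟨hu, hg, w, hw, ⟨hw0, hw1⟩, hwg⟩ := h
  obtain ⟨C, hC⟩ := A.area_le hΩ.isOpen
  refine ⟨w, hw, ⟨fun m => memLp_two_of_continuous hΩ.isBounded (hw m).continuous, hu.1, hw0⟩,
    fun i => ⟨fun m => memLp_two_of_continuous hΩ.isBounded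
      (((hw m).continuous_fderiv (by simp)).clm_apply continuous_const),
      hu.memLp_weakPartial hΩ.isOpen i, hw1 i⟩,
    ⟨fun m => A.memLp_area_of_continuous hΩ (hw m).continuous, ?_, ?_⟩⟩
  · exact hg.of_measure_le_smul (c := C) ENNReal.coe_ne_top hC
  · have h1 (m) : eLpNorm (fun x => w m x - g x) 2 A.area ≤
        ((C : ℝ≥0∞) ^ ((1 : ℝ) / 2)) * eLpNorm (fun x => w m x - g x) 2 (surfaceMeasure Ω) := by
      refine (eLpNorm_mono_measure _ hC).trans (le_of_eq ?_)
      have := eLpNorm_smul_measure_of_ne_top (p := 2) (by norm_num)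
        (fun x => w m x - g x) (C : ℝ≥0∞) (μ := surfaceMeasure Ω)
      rw [ENNReal.smul_def, this]
      simp
    have h2 : Tendsto (fun m => ((C : ℝ≥0∞) ^ ((1 : ℝ) / 2)) *
        eLpNorm (fun x => w m x - g x) 2 (surfaceMeasure Ω)) atTop (𝓝 0) := by
      simpa using ENNReal.Tendsto.const_mul hwg
        (Or.inr (ENNReal.rpow_ne_top_of_nonneg (by norm_num) ENNReal.coe_ne_top))
    exact tendsto_of_tendsto_of_tendsto_of_le_of_le tendsto_const_nhds h2 (fun _ => zero_le) h1

/-- The approximating functions are supported inside the open set Ω, so they vanish on ∂Ω. -/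
theorem hasTrace_zero_of_memH10 (A : BoundaryAtlas Ω) (hΩ : IsBoundedC2Domain Ω)
    {u : Eucl n → ℂ} (h : MemH10 Ω u) :
    A.HasTrace u (fun i => weakPartial Ω i u) (fun _ => 0) := by
  obtain ⟨hu, w, hw, hw0, hw1⟩ := h
  refine ⟨w, fun m => (hw m).1, ⟨fun m => memLp_two_of_continuous hΩ.isBounded (hw m).1.continuous,
    hu.1, hw0⟩, fun i => ⟨fun m => memLp_two_of_continuous hΩ.isBounded
      (((hw m).1.continuous_fderiv (by simp)).clm_apply continuous_const),
      hu.memLp_weakPartial hΩ.isOpen i, hw1 i⟩,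
    ⟨fun m => A.memLp_area_of_continuous hΩ (hw m).1.continuous, MemLp.zero', ?_⟩⟩
  have h0 (m) : eLpNorm (fun x => w m x - 0) 2 A.area = 0 := by
    rw [← eLpNorm_zero (ε := ℂ) (p := 2) (μ := A.area)]
    refine eLpNorm_congr_ae ?_
    filter_upwards [A.ae_area_mem_frontier hΩ.isOpen] with x hx
    rw [image_eq_zero_of_notMem_tsupport (f := w m) fun hc =>
      (hΩ.isOpen.frontier_eq ▸ hx).2 ((hw m).2.2 hc), sub_zero]
    rfl
  simp only [h0]
  exact tendsto_const_nhds

/-- Green's formula for `H¹` functions. -/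
theorem HasTrace.green (hΩ : IsBoundedC2Domain Ω) {u u' : Eucl n → ℂ} {U U' : Fin n → Eucl n → ℂ}
    {g g' : Eucl n → ℂ} (h : A.HasTrace u U g) (h' : A.HasTrace u' U' g') {b : Eucl n → ℝ}
    (hb : ContDiff ℝ ∞ b) (i : Fin n) :
    pairing (volume.restrict Ω) b (U i) u' + pairing (volume.restrict Ω) b u (U' i) +
      pairing (volume.restrict Ω) (fun x => fderiv ℝ b x (stdVec i)) u u' =
      pairing A.area (fun x => ⟪outwardNormal Ω x, stdVec i⟫_ℝ * b x) g g' := by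
  obtain ⟨w, hw, hw0, hw1, hwg⟩ := h
  obtain ⟨w', hw', hw0', hw1', hwg'⟩ := h'
  have hbw := isBddWeight_of_continuous hΩ.isBounded hΩ.isOpen.measurableSet hb.continuous
  have hdc : Continuous fun x => fderiv ℝ b x (stdVec i) :=
    (hb.continuous_fderiv (by simp)).clm_apply continuous_const
  have hdw := isBddWeight_of_continuous hΩ.isBounded hΩ.isOpen.measurableSet hdc
  have hνw : IsBddWeight A.area fun x => ⟪outwardNormal Ω x, stdVec i⟫_ℝ * b x :=
    A.isBddWeight_area hΩ (((A.continuousOn_outwardNormal hΩ.isOpen).inner continuousOn_const).mul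
      hb.continuous.continuousOn)
  have hlhs := (((hw1 i).tendsto_pairing hw0' hbw).add (hw0.tendsto_pairing (hw1' i) hbw)).add
    (hw0.tendsto_pairing hw0' hdw)
  have hrhs := hwg.tendsto_pairing hwg' hνw
  -- Both sides are continuous along the approximating sequences. It remains to treat smooth
  -- functions, by the divergence theorem for b · w · conj w'.
  refine tendsto_nhds_unique hlhs (hrhs.congr fun m => ?_)
  have hconj : ContDiff ℝ ∞ fun x => starRingEnd ℂ (w' m x) :=
    Complex.conjCLE.contDiff.comp (hw' m)
  have hmul : ContDiff ℝ ∞ fun x => w m x * starRingEnd ℂ (w' m x) := (hw m).mul hconj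
  have ha : ContDiff ℝ 1 fun x => b x • (w m x * starRingEnd ℂ (w' m x)) :=
    (hb.smul hmul).of_le (by exact_mod_cast le_top)
  have hdiv := A.setIntegral_fderiv hΩ ha (stdVec i)
  have hder (x) : fderiv ℝ (fun x => b x • (w m x * starRingEnd ℂ (w' m x))) x (stdVec i) =
      b x • (fderiv ℝ (w m) x (stdVec i) * starRingEnd ℂ (w' m x)) +
      b x • (w m x * starRingEnd ℂ (fderiv ℝ (w' m) x (stdVec i))) +
      fderiv ℝ b x (stdVec i) • (w m x * starRingEnd ℂ (w' m x)) := by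
    have hc : HasFDerivAt (fun x => starRingEnd ℂ (w' m x))
        ((Complex.conjCLE : ℂ →L[ℝ] ℂ).comp (fderiv ℝ (w' m) x)) x :=
      Complex.conjCLE.hasFDerivAt.comp x (((hw' m).differentiable (by simp)) x).hasFDerivAt
    have h1 : HasFDerivAt (fun x => b x • (w m x * starRingEnd ℂ (w' m x))) _ x :=
      ((hb.differentiable (by simp)) x).hasFDerivAt.smul
        ((((hw m).differentiable (by simp)) x).hasFDerivAt.mul hc)
    rw [h1.fderiv]
    simp
    ring
  simp only [hder] at hdiv
  rw [integral_add, integral_add] at hdiv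
  · simp only [pairing]
    rw [hdiv]
    simp only [mul_smul]
  · exact hbw.integrable ((hw1 i).memLp m) (hw0'.memLp m)
  · exact hbw.integrable (hw0.memLp m) ((hw1' i).memLp m)
  · exact (hbw.integrable ((hw1 i).memLp m) (hw0'.memLp m)).add
      (hbw.integrable (hw0.memLp m) ((hw1' i).memLp m))
  · exact hdw.integrable (hw0.memLp m) (hw0'.memLp m)

end BoundaryAtlas

end CarlemanEstimate

/-! ### Traces of the gradient and the weighted integral identities. -/

namespace CarlemanEstimate

variable {n : ℕ} {Ω : Set (Eucl n)}

theorem inner_stdVec (x : Eucl n) (i : Fin n) : ⟪x, stdVec i⟫_ℝ = x i := by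
  simp [EuclideanSpace.inner_single_right]

theorem contDiff_fderiv_apply {φ : Eucl n → ℝ} (hφ : ContDiff ℝ ∞ φ) (d : Eucl n) :
    ContDiff ℝ ∞ fun x => fderiv ℝ φ x d :=
  (hφ.fderiv_right (m := ∞) (by simp)).clm_apply contDiff_const

theorem fderiv_fderiv_apply_comm {φ : Eucl n → ℝ} (hφ : ContDiff ℝ ∞ φ) (x d d' : Eucl n) :
    fderiv ℝ (fun y => fderiv ℝ φ y d) x d' = fderiv ℝ (fun y => fderiv ℝ φ y d') x d := by
  have hd : DifferentiableAt ℝ (fderiv ℝ φ) x :=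
    (hφ.fderiv_right (m := 1) (by norm_cast)).differentiable one_ne_zero x
  have h1 (c : Eucl n) : HasFDerivAt (fun y => fderiv ℝ φ y c)
      ((fderiv ℝ (fderiv ℝ φ) x).flip c) x := by
    simpa using hd.hasFDerivAt.clm_apply (hasFDerivAt_const c x)
  rw [(h1 d).fderiv, (h1 d').fderiv]
  exact ((contDiff_infty.1 hφ 2).contDiffAt.isSymmSndFDerivAt (by simp)) d' d

/-- The derivatives of the test function commute: moving both onto φ in either order gives the same
integral against v. Existence of ∂_i h is a conclusion here. -/
theorem IsWeakPartial.symm {i j : Fin n} {v f h s : Eucl n → ℂ} (hf : IsWeakPartial Ω i v f)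
    (hh : IsWeakPartial Ω j v h) (hs : IsWeakPartial Ω j f s) : IsWeakPartial Ω i h s := by
  refine ⟨hh.2.1, hs.2.1, fun φ hφ hφs hφsub => ?_⟩
  have hsub (k : Fin n) : tsupport (fun x => fderiv ℝ φ x (stdVec k)) ⊆ Ω :=
    (tsupport_fderiv_apply_subset ℝ _).trans hφsub
  have e1 := hf.2.2 _ (contDiff_fderiv_apply hφ (stdVec j)) (hφs.fderiv_apply ℝ _) (hsub j)
  have e2 := hh.2.2 _ (contDiff_fderiv_apply hφ (stdVec i)) (hφs.fderiv_apply ℝ _) (hsub i)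
  have e3 := hs.2.2 φ hφ hφs hφsub
  simp only [fderiv_fderiv_apply_comm hφ _ (stdVec j) (stdVec i)] at e1
  rw [← e3, ← neg_injective (e1.symm.trans e2)]

theorem MemH2.weakPartial_comm (hΩ : IsOpen Ω) {v : Eucl n → ℂ} (hv : MemH2 Ω v) (i j : Fin n) :
    weakPartial Ω j (weakPartial Ω i v) =ᵐ[volume.restrict Ω]
      weakPartial Ω i (weakPartial Ω j v) :=
  (((hv.1.isWeakPartial i).symm (hv.1.isWeakPartial j)
    ((hv.2 i).isWeakPartial j)).ae_eq_weakPartial hΩ).symm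

section Pairing

variable {μ : Measure (Eucl n)} {b : Eucl n → ℝ} {f h f' h' : Eucl n → ℂ}

theorem pairing_zero_right : pairing μ b f (fun _ => 0) = 0 := by
  simp [pairing]

theorem pairing_add_right (hb : IsBddWeight μ b) (hf : MemLp f 2 μ) (hh : MemLp h 2 μ)
    (hh' : MemLp h' 2 μ) :
    pairing μ b f (fun x => h x + h' x) = pairing μ b f h + pairing μ b f h' := by
  rw [← pairing_conj, pairing_add_left hb hh hh' hf, map_add, pairing_conj, pairing_conj]

theorem re_pairing_sum_sum {ι κ : Type*} [Fintype ι] [Fintype κ] {f : ι → Eucl n → ℂ}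
    {h : κ → Eucl n → ℂ} (hb : IsBddWeight μ b) (hf : ∀ i, MemLp (f i) 2 μ)
    (hh : ∀ j, MemLp (h j) 2 μ) (a : ι → ℝ) (c : κ → ℝ) :
    (pairing μ b (fun x => ∑ i, a i • f i x) (fun x => ∑ j, c j • h j x)).re =
      ∑ i, ∑ j, a i * c j * (pairing μ b (f i) (h j)).re := by
  have hh' (j) : MemLp (fun x => c j • h j x) 2 μ := (hh j).const_smul (c j)
  rw [pairing_sum_left (f := fun i x => a i • f i x) hb (fun i => (hf i).const_smul (a i))
    (memLp_finsetSum _ fun j _ => hh' j), Complex.re_sum]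
  refine Finset.sum_congr rfl fun i _ => ?_
  rw [pairing_smul_left, pairing_sum_right hb (hf i) hh',
    Complex.smul_re, Complex.re_sum, Finset.smul_sum]
  refine Finset.sum_congr rfl fun j _ => ?_
  rw [pairing_smul_right, Complex.smul_re, smul_smul, smul_eq_mul]

theorem pairing_smul_smul (a c : Eucl n → ℝ) :
    pairing μ b (fun x => a x • f x) (fun x => c x • f x) =
      pairing μ (fun x => a x * c x * b x) f f := by
  simp only [pairing]
  congr 1
  ext x
  simp only [Complex.real_smul, map_mul, Complex.conj_ofReal]
  push_cast
  ring

end Pairing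

namespace BoundaryAtlas

variable {A : BoundaryAtlas Ω}

theorem continuousOn_outwardNormal_apply (A : BoundaryAtlas Ω) (hΩ : IsOpen Ω) (i : Fin n) :
    ContinuousOn (fun x => outwardNormal Ω x i) (frontier Ω) := by
  have := A.continuousOn_outwardNormal hΩ
  fun_prop

theorem sum_outwardNormal_sq (A : BoundaryAtlas Ω) (hΩ : IsOpen Ω) {x : Eucl n}
    (hx : x ∈ frontier Ω) : ∑ i, outwardNormal Ω x i * outwardNormal Ω x i = 1 := by
  have h := A.norm_outwardNormal hΩ hx
  have h2 := EuclideanSpace.real_norm_sq_eq (outwardNormal Ω x)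
  rw [h] at h2
  simp only [← sq]
  linarith

/-- The traces of the gradient of a function vanishing on the boundary form a field parallel to
the normal. -/
theorem ae_trace_grad_parallel (hΩ : IsBoundedC2Domain Ω) {v : Eucl n → ℂ}
    {V G : Fin n → Eucl n → ℂ} {S : Fin n → Fin n → Eucl n → ℂ}
    (hv : A.HasTrace v V (fun _ => 0)) (hV : ∀ i, A.HasTrace (V i) (S i) (G i))
    (hS : ∀ i j, S i j =ᵐ[volume.restrict Ω] S j i) (i j : Fin n) :
    ∀ᵐ x ∂A.area, outwardNormal Ω x j • G i x - outwardNormal Ω x i • G j x = 0 := by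
  have hone := A.hasTrace_one hΩ
  have hw (k : Fin n) : IsBddWeight A.area fun x => outwardNormal Ω x k :=
    A.isBddWeight_area hΩ (A.continuousOn_outwardNormal_apply hΩ.isOpen k)
  have hL (k l) := (hw k).memLp_smul (hV l).memLp_trace
  refine ae_eq_zero_of_integral_contDiff_smul_eq_zero
    (((hL j i).sub (hL i j)).integrable one_le_two).locallyIntegrable fun φ hφ hφs => ?_
  have hgreen (k l : Fin n) := (hV k).green hΩ hone hφ l
  have hgreen0 (k l : Fin n) := hv.green hΩ hone (contDiff_fderiv_apply hφ (stdVec k)) l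
  simp only [pairing_zero_right, add_zero] at hgreen hgreen0
  have hz (b : Eucl n → ℝ) : pairing A.area b (fun _ => 0) (fun _ => 1) = 0 := by simp [pairing]
  simp only [hz] at hgreen0
  -- Green's formula for V_i and V_j against φ produces the two boundary terms. Their second-order
  -- interior terms agree by `hS`; the first-order ones agree because v has zero trace and can be
  -- integrated by parts once more, against ∂_jφ and ∂_iφ.
  have e1 := hgreen i j
  have e2 := hgreen j i
  have e3 := hgreen0 j i
  have e4 := hgreen0 i j
  simp only [fderiv_fderiv_apply_comm hφ _ (stdVec j) (stdVec i)] at e3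
  rw [pairing_congr (hS i j) (EventuallyEq.refl _ _)] at e1
  have hbw (k : Fin n) : IsBddWeight A.area fun x => ⟪outwardNormal Ω x, stdVec k⟫_ℝ * φ x :=
    A.isBddWeight_area hΩ (((A.continuousOn_outwardNormal hΩ.isOpen).inner continuousOn_const).mul
      hφ.continuous.continuousOn)
  have hexp : ∫ x, φ x • (outwardNormal Ω x j • G i x - outwardNormal Ω x i • G j x) ∂A.area =
      pairing A.area (fun x => ⟪outwardNormal Ω x, stdVec j⟫_ℝ * φ x) (G i) (fun _ => 1) -
      pairing A.area (fun x => ⟪outwardNormal Ω x, stdVec i⟫_ℝ * φ x) (G j) (fun _ => 1) := by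
    rw [pairing, pairing, ← integral_sub ((hbw j).integrable (hV i).memLp_trace hone.memLp_trace)
      ((hbw i).integrable (hV j).memLp_trace hone.memLp_trace)]
    congr 1
    ext x
    simp only [inner_stdVec, Complex.real_smul, map_one, mul_one]
    push_cast
    ring
  change ∫ x, φ x • (outwardNormal Ω x j • G i x - outwardNormal Ω x i • G j x) ∂A.area = 0
  rw [hexp]
  linear_combination e2 - e1 + e3 - e4

/-- Since |ν| = 1, G_i is the sum over j of ν_j² G_i, and parallelism replaces ν_j G_i by ν_i G_j.
-/
theorem ae_trace_grad_eq (hΩ : IsBoundedC2Domain Ω) {v : Eucl n → ℂ}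
    {V G : Fin n → Eucl n → ℂ} {S : Fin n → Fin n → Eucl n → ℂ}
    (hv : A.HasTrace v V (fun _ => 0)) (hV : ∀ i, A.HasTrace (V i) (S i) (G i))
    (hS : ∀ i j, S i j =ᵐ[volume.restrict Ω] S j i) (i : Fin n) :
    G i =ᵐ[A.area] fun x => outwardNormal Ω x i • ∑ j, outwardNormal Ω x j • G j x := by
  have h := ae_all_iff.2 fun j => ae_trace_grad_parallel hΩ hv hV hS i j
  filter_upwards [h, A.ae_area_mem_frontier hΩ.isOpen] with x hx hxf
  have h1 : G i x = ∑ j, (outwardNormal Ω x j * outwardNormal Ω x j) • G i x := by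
    rw [← Finset.sum_smul, A.sum_outwardNormal_sq hΩ.isOpen hxf, one_smul]
  rw [h1, Finset.smul_sum]
  refine Finset.sum_congr rfl fun j _ => ?_
  rw [mul_smul, sub_eq_zero.1 (hx j), smul_comm]

end BoundaryAtlas

/-- The exponential weight. -/
noncomputable def expWeight (ρ : ℝ) (η : Eucl n) (x : Eucl n) : ℝ := Real.exp (-2 * ρ * ⟪x, η⟫_ℝ)

theorem expWeight_pos (ρ : ℝ) (η x : Eucl n) : 0 < expWeight ρ η x := Real.exp_pos _

theorem contDiff_expWeight (ρ : ℝ) (η : Eucl n) : ContDiff ℝ ∞ (expWeight ρ η) := by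
  have h : ContDiff ℝ ∞ fun x : Eucl n => ⟪x, η⟫_ℝ := contDiff_id.inner ℝ contDiff_const
  exact (contDiff_const.mul h).exp

theorem hasFDerivAt_inner_const (η x : Eucl n) :
    HasFDerivAt (fun x : Eucl n => ⟪x, η⟫_ℝ) (innerSL ℝ η) x := by
  have h := (innerSL ℝ η).hasFDerivAt (x := x)
  refine h.congr_of_eventuallyEq (Eventually.of_forall fun y => ?_)
  simp [real_inner_comm]

theorem hasFDerivAt_expWeight (ρ : ℝ) (η x : Eucl n) :
    HasFDerivAt (expWeight ρ η) (expWeight ρ η x • (-2 * ρ) • innerSL ℝ η) x :=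
  ((hasFDerivAt_inner_const η x).const_mul (-2 * ρ)).exp

theorem fderiv_expWeight (ρ : ℝ) (η x : Eucl n) (i : Fin n) :
    fderiv ℝ (expWeight ρ η) x (stdVec i) = (-2 * ρ * η i) * expWeight ρ η x := by
  rw [(hasFDerivAt_expWeight ρ η x).fderiv]
  simp only [smul_apply, innerSL_apply_apply, inner_stdVec, smul_eq_mul]
  ring

theorem fderiv_expWeight_mul_inner (ρ : ℝ) (η x : Eucl n) (i : Fin n) :
    fderiv ℝ (fun x => expWeight ρ η x * ⟪x, η⟫_ℝ) x (stdVec i) =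
      η i * (expWeight ρ η x - 2 * ρ * (expWeight ρ η x * ⟪x, η⟫_ℝ)) := by
  have h : HasFDerivAt (fun x => expWeight ρ η x * ⟪x, η⟫_ℝ) _ x :=
    (hasFDerivAt_expWeight ρ η x).mul (hasFDerivAt_inner_const η x)
  rw [h.fderiv]
  simp only [add_apply, smul_apply, innerSL_apply_apply, inner_stdVec, smul_eq_mul]
  ring

theorem sum_mul_self_eq_one {η : Eucl n} (hη : ‖η‖ = 1) : ∑ i, η i * η i = 1 := by
  have h2 := EuclideanSpace.real_norm_sq_eq η
  rw [hη] at h2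
  simp only [← sq]
  linarith

namespace BoundaryAtlas

variable {A : BoundaryAtlas Ω} {v : Eucl n → ℂ} {V G : Fin n → Eucl n → ℂ}
  {S : Fin n → Fin n → Eucl n → ℂ}

/-- The weighted Rellich identity. -/
theorem rellich (hΩ : IsBoundedC2Domain Ω) (hv : A.HasTrace v V (fun _ => 0))
    (hV : ∀ i, A.HasTrace (V i) (S i) (G i)) (hS : ∀ i j, S i j =ᵐ[volume.restrict Ω] S j i)
    {η : Eucl n} (hη : ‖η‖ = 1) (ρ : ℝ) :
    2 * (pairing (volume.restrict Ω) (expWeight ρ η) (fun x => ∑ i, S i i x)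
        (fun x => ∑ i, η i • V i x)).re
      - 4 * ρ * (pairing (volume.restrict Ω) (expWeight ρ η) (fun x => ∑ i, η i • V i x)
        (fun x => ∑ i, η i • V i x)).re
      + 2 * ρ * ∑ i, (pairing (volume.restrict Ω) (expWeight ρ η) (V i) (V i)).re =
    ∫ x, ⟪outwardNormal Ω x, η⟫_ℝ * expWeight ρ η x *
      ‖∑ j, outwardNormal Ω x j • G j x‖ ^ 2 ∂A.area := by
  set μ := (volume : Measure (Eucl n)).restrict Ω with hμ
  set m := expWeight ρ η with hm
  set N : Eucl n → ℂ := fun x => ∑ j, outwardNormal Ω x j • G j x with hN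
  have hmc : ContDiff ℝ ∞ m := contDiff_expWeight ρ η
  have hmw : IsBddWeight μ m :=
    isBddWeight_of_continuous hΩ.isBounded hΩ.isOpen.measurableSet hmc.continuous
  have hνc (k : Fin n) := A.continuousOn_outwardNormal_apply hΩ.isOpen k
  have hNL : MemLp N 2 A.area := memLp_finsetSum _ fun j _ =>
    (A.isBddWeight_area hΩ (hνc j)).memLp_smul (hV j).memLp_trace
  have hG (i) : G i =ᵐ[A.area] fun x => outwardNormal Ω x i • N x :=
    ae_trace_grad_eq hΩ hv hV hS i
  have hkw (i j : Fin n) : IsBddWeight A.area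
      fun x => outwardNormal Ω x i * outwardNormal Ω x i * (outwardNormal Ω x j * m x) :=
    A.isBddWeight_area hΩ (((hνc i).mul (hνc i)).mul ((hνc j).mul hmc.continuous.continuousOn))
  set k : Fin n → Fin n → ℝ := fun i j => (pairing A.area
    (fun x => outwardNormal Ω x i * outwardNormal Ω x i * (outwardNormal Ω x j * m x)) N N).re
    with hk
  set p : Fin n → Fin n → ℝ := fun i j => (pairing μ m (V i) (V j)).re with hp
  set q : Fin n → Fin n → ℝ := fun i j => (pairing μ m (S i i) (V j)).re with hq
  -- Twice Green's formula for (V_i, V_j) in direction i, minus the one for (V_i, V_i) in direction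
  -- j. The remaining second derivatives cancel by symmetry of S, and on the boundary V_i is ν_i N.
  have key (i j : Fin n) : 2 * q i j - 4 * ρ * η i * p i j + 2 * ρ * η j * p i i = k i j := by
    have e1 := congrArg Complex.re ((hV i).green hΩ (hV j) hmc i)
    have e2 := congrArg Complex.re ((hV i).green hΩ (hV i) hmc j)
    simp only [hm, fderiv_expWeight, inner_stdVec] at e1 e2
    rw [← hm, ← hμ] at e1 e2
    simp only [pairing_smul_weight, Complex.add_re, Complex.smul_re, smul_eq_mul] at e1 e2
    rw [pairing_congr (EventuallyEq.refl _ (V i)) (hS j i), pairing_congr (hG i) (hG j),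
      pairing_smul_smul] at e1
    rw [pairing_re_comm μ m (S i j), pairing_congr (hG i) (hG i), pairing_smul_smul] at e2
    have e3 : (pairing A.area (fun x => outwardNormal Ω x i * outwardNormal Ω x j *
        (outwardNormal Ω x i * m x)) N N).re = k i j := by
      simp only [hk]
      congr 2
      ext x
      ring
    rw [e3] at e1
    change _ = k i j at e2
    simp only [hp, hq]
    linear_combination 2 * e1 - e2
  have hLD := re_pairing_sum_sum (μ := μ) hmw (fun i => (hV i).memLp_grad i)
    (fun i => hv.memLp_grad i) (fun _ => 1) (fun i => η i)
  simp only [one_smul, one_mul] at hLD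
  have hDD := re_pairing_sum_sum (μ := μ) hmw (fun i => hv.memLp_grad i)
    (fun i => hv.memLp_grad i) (fun i => η i) (fun i => η i)
  -- Summing over i uses that the ν_i² add up to 1, and summing η_j ν_j over j gives ν·η.
  have hright : ∫ x, ⟪outwardNormal Ω x, η⟫_ℝ * m x * ‖N x‖ ^ 2 ∂A.area =
      ∑ i, ∑ j, η j * k i j := by
    simp only [hk, pairing_self_re, ← integral_const_mul]
    have hint (i j : Fin n) : Integrable (fun x => η j * (outwardNormal Ω x i *
        outwardNormal Ω x i * (outwardNormal Ω x j * m x) * ‖N x‖ ^ 2)) A.area := by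
      refine Integrable.const_mul ?_ _
      have h1 := ((hkw i j).integrable hNL hNL).re
      refine h1.congr (Eventually.of_forall fun x => ?_)
      simp only [Complex.mul_conj, Complex.normSq_eq_norm_sq, Complex.real_smul]
      rw [← Complex.ofReal_mul]
      exact Complex.ofReal_re _
    have hsw : ∑ i, ∑ j, ∫ x, η j * (outwardNormal Ω x i * outwardNormal Ω x i *
        (outwardNormal Ω x j * m x) * ‖N x‖ ^ 2) ∂A.area =
        ∫ x, ∑ i, ∑ j, η j * (outwardNormal Ω x i * outwardNormal Ω x i *
        (outwardNormal Ω x j * m x) * ‖N x‖ ^ 2) ∂A.area := by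
      rw [integral_finsetSum _ fun i _ => integrable_finsetSum _ fun j _ => hint i j]
      refine Finset.sum_congr rfl fun i _ => ?_
      rw [integral_finsetSum _ fun j _ => hint i j]
    rw [hsw]
    refine integral_congr_ae ?_
    filter_upwards [A.ae_area_mem_frontier hΩ.isOpen] with x hx
    have h1 := A.sum_outwardNormal_sq hΩ.isOpen hx
    have h2 : ⟪outwardNormal Ω x, η⟫_ℝ = ∑ j, η j * outwardNormal Ω x j := by
      rw [PiLp.inner_apply]
      exact Finset.sum_congr rfl fun i _ => by simp
    have h3 : ∀ i, ∑ j, η j * (outwardNormal Ω x i * outwardNormal Ω x i *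
        (outwardNormal Ω x j * m x) * ‖N x‖ ^ 2) =
        outwardNormal Ω x i * outwardNormal Ω x i * (⟪outwardNormal Ω x, η⟫_ℝ * m x * ‖N x‖ ^ 2) := by
      intro i
      rw [h2, Finset.sum_mul, Finset.sum_mul, Finset.mul_sum]
      exact Finset.sum_congr rfl fun j _ => by ring
    simp only [h3]
    rw [← Finset.sum_mul, h1, one_mul]
  rw [hright, hLD, hDD]
  -- Inserting the sum of the η_j², which is 1, turns the gradient term into a double sum, so the
  -- claim is the sum of the η_j `key i j`.
  have hdiag : ∑ i, p i i = ∑ i, ∑ j, η j * (η j * p i i) := by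
    refine Finset.sum_congr rfl fun i _ => ?_
    simp only [← mul_assoc]
    rw [← Finset.sum_mul, sum_mul_self_eq_one hη, one_mul]
  rw [hdiag]
  simp only [Finset.mul_sum, ← Finset.sum_sub_distrib, ← Finset.sum_add_distrib]
  refine Finset.sum_congr rfl fun i _ => Finset.sum_congr rfl fun j _ => ?_
  linear_combination η j * key i j

/-- Integrate by parts against v: the boundary term vanishes with the trace of v, and
differentiating the weight produces the factor 2ρ. -/
theorem pairing_laplacian_self (hΩ : IsBoundedC2Domain Ω) (hv : A.HasTrace v V (fun _ => 0))
    (hV : ∀ i, A.HasTrace (V i) (S i) (G i)) (η : Eucl n) (ρ : ℝ) :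
    (pairing (volume.restrict Ω) (expWeight ρ η) (fun x => ∑ i, S i i x) v).re
      + ∑ i, (pairing (volume.restrict Ω) (expWeight ρ η) (V i) (V i)).re
      = 2 * ρ * (pairing (volume.restrict Ω) (expWeight ρ η) (fun x => ∑ i, η i • V i x) v).re := by
  have hmc : ContDiff ℝ ∞ (expWeight ρ η) := contDiff_expWeight ρ η
  have hmw : IsBddWeight (volume.restrict Ω) (expWeight ρ η) :=
    isBddWeight_of_continuous hΩ.isBounded hΩ.isOpen.measurableSet hmc.continuous
  rw [pairing_sum_left hmw (fun i => (hV i).memLp_grad i) hv.memLp,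
    pairing_sum_left (f := fun i x => η i • V i x) hmw
      (fun i => (hv.memLp_grad i).const_smul (η i)) hv.memLp, Complex.re_sum,
    Complex.re_sum, Finset.mul_sum, ← Finset.sum_add_distrib]
  refine Finset.sum_congr rfl fun i _ => ?_
  have e1 := congrArg Complex.re ((hV i).green hΩ hv hmc i)
  simp only [fderiv_expWeight, pairing_zero_right, pairing_smul_weight, Complex.add_re,
    Complex.smul_re, smul_eq_mul, Complex.zero_re] at e1
  rw [pairing_smul_left, Complex.smul_re, smul_eq_mul]
  linear_combination e1

/-- The derivative of b|v|² along η integrates to zero because v has zero trace. It is used with b =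
m and with b = m · (x·η). -/
theorem pairing_dirDeriv_self (hΩ : IsBoundedC2Domain Ω) (hv : A.HasTrace v V (fun _ => 0))
    {η : Eucl n} {b c : Eucl n → ℝ} (hη : ‖η‖ = 1) (hb : ContDiff ℝ ∞ b)
    (hc : ∀ x i, fderiv ℝ b x (stdVec i) = η i * c x) :
    2 * (pairing (volume.restrict Ω) b (fun x => ∑ i, η i • V i x) v).re +
      (pairing (volume.restrict Ω) c v v).re = 0 := by
  have hbw : IsBddWeight (volume.restrict Ω) b :=
    isBddWeight_of_continuous hΩ.isBounded hΩ.isOpen.measurableSet hb.continuous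
  have h1 : (pairing (volume.restrict Ω) c v v).re =
      ∑ i, η i * (η i * (pairing (volume.restrict Ω) c v v).re) := by
    simp only [← mul_assoc]
    rw [← Finset.sum_mul, sum_mul_self_eq_one hη, one_mul]
  rw [h1, pairing_sum_left (f := fun i x => η i • V i x) hbw
      (fun i => (hv.memLp_grad i).const_smul (η i)) hv.memLp,
    Complex.re_sum, Finset.mul_sum, ← Finset.sum_add_distrib]
  refine Finset.sum_eq_zero fun i _ => ?_
  have e1 := congrArg Complex.re (hv.green hΩ hv hb i)
  simp only [hc, pairing_zero_right, pairing_smul_weight, Complex.add_re,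
    Complex.smul_re, smul_eq_mul, Complex.zero_re] at e1
  rw [pairing_re_comm _ b v (V i)] at e1
  rw [pairing_smul_left, Complex.smul_re, smul_eq_mul]
  linear_combination η i * e1

end BoundaryAtlas

end CarlemanEstimate

/-! ### Directional Poincaré inequality and Carleman estimate for the Laplacian. -/

namespace CarlemanEstimate

variable {n : ℕ} {Ω : Set (Eucl n)}

section Pairing

variable {μ : Measure (Eucl n)} {b c : Eucl n → ℝ} {f h : Eucl n → ℂ}

theorem re_pairing_add_smul_self (hb : IsBddWeight μ b) (hf : MemLp f 2 μ) (hh : MemLp h 2 μ)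
    (a : ℝ) : (pairing μ b (fun x => f x + a • h x) (fun x => f x + a • h x)).re =
      (pairing μ b f f).re + 2 * a * (pairing μ b f h).re + a ^ 2 * (pairing μ b h h).re := by
  have hah : MemLp (fun x => a • h x) 2 μ := hh.const_smul a
  have hs : MemLp (fun x => f x + a • h x) 2 μ := hf.add hah
  rw [pairing_add_left hb hf hah hs, pairing_add_right hb hf hf hah,
    pairing_add_right hb hah hf hah, pairing_smul_left, pairing_smul_left, pairing_smul_right,
    pairing_smul_right]
  simp only [Complex.add_re, Complex.smul_re, smul_eq_mul]
  rw [pairing_re_comm μ b h f]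
  ring

theorem pairing_add_mul_weight (hb : IsBddWeight μ b) (hc : IsBddWeight μ c) (hf : MemLp f 2 μ)
    (hh : MemLp h 2 μ) (a : ℝ) :
    pairing μ (fun x => b x + a * c x) f h = pairing μ b f h + a • pairing μ c f h := by
  rw [← pairing_smul_weight, pairing, pairing, pairing, ← integral_add (hb.integrable hf hh)]
  · simp only [add_smul]
  · simp only [mul_smul]
    exact (hc.integrable hf hh).smul a

theorem IsBddWeight.integrable_mul_norm_sq (hb : IsBddWeight μ b) (hf : MemLp f 2 μ) :
    Integrable (fun x => b x * ‖f x‖ ^ 2) μ := by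
  refine (hb.integrable hf hf).re.congr (Eventually.of_forall fun x => ?_)
  simp only [Complex.mul_conj, Complex.normSq_eq_norm_sq, Complex.real_smul]
  rw [← Complex.ofReal_mul]
  exact Complex.ofReal_re _

theorem IsBddWeight.integrable_re (hb : IsBddWeight μ b) (hf : MemLp f 2 μ) (hh : MemLp h 2 μ) :
    Integrable (fun x => b x * (f x * starRingEnd ℂ (h x)).re) μ := by
  refine (hb.integrable hf hh).re.congr (Eventually.of_forall fun x => ?_)
  simp only [Complex.real_smul]
  exact Complex.re_ofReal_mul _ _

theorem abs_re_mul_conj_le (z w : ℂ) : |(z * starRingEnd ℂ w).re| ≤ ‖z‖ * ‖w‖ := by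
  refine (Complex.abs_re_le_norm _).trans ?_
  rw [norm_mul, Complex.norm_conj]

end Pairing

namespace BoundaryAtlas

variable {A : BoundaryAtlas Ω} {v : Eucl n → ℂ} {V G : Fin n → Eucl n → ℂ}
  {S : Fin n → Fin n → Eucl n → ℂ}

/-- The derivative of `v` along `η`, conjugated by the exponential weight. -/
noncomputable def conjDeriv (ρ : ℝ) (η : Eucl n) (V : Fin n → Eucl n → ℂ) (v : Eucl n → ℂ)
    (x : Eucl n) : ℂ :=
  ∑ i, η i • V i x + (-ρ) • v x

theorem memLp_conjDeriv (hv : A.HasTrace v V (fun _ => 0)) (ρ : ℝ) (η : Eucl n) :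
    MemLp (conjDeriv ρ η V v) 2 (volume.restrict Ω) :=
  (memLp_finsetSum _ fun i _ => (hv.memLp_grad i).const_smul (η i)).add (hv.memLp.const_smul (-ρ))

/-- The Poincaré inequality in the direction `η`. -/
theorem weighted_poincare (hΩ : IsBoundedC2Domain Ω) (hv : A.HasTrace v V (fun _ => 0))
    {η : Eucl n} (hη : ‖η‖ = 1) {R : ℝ} (hR : ∀ x ∈ Ω, |⟪x, η⟫_ℝ| ≤ R) (ρ : ℝ) :
    (pairing (volume.restrict Ω) (expWeight ρ η) v v).re ≤ 4 * R ^ 2 *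
      (pairing (volume.restrict Ω) (expWeight ρ η) (conjDeriv ρ η V v) (conjDeriv ρ η V v)).re := by
  have hmc := contDiff_expWeight ρ η
  have hlc : ContDiff ℝ ∞ fun x : Eucl n => ⟪x, η⟫_ℝ := contDiff_id.inner ℝ contDiff_const
  have hΩm := hΩ.isOpen.measurableSet
  have hmw := isBddWeight_of_continuous hΩ.isBounded hΩm hmc.continuous
  have hlw := isBddWeight_of_continuous hΩ.isBounded hΩm (hmc.mul hlc).continuous
  have hvL := hv.memLp
  have hXL := memLp_conjDeriv hv ρ η
  have hDL : MemLp (fun x => ∑ i, η i • V i x) 2 (volume.restrict Ω) :=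
    memLp_finsetSum _ fun i _ => (hv.memLp_grad i).const_smul (η i)
  have hρL : MemLp (fun x => (-ρ) • v x) 2 (volume.restrict Ω) := hvL.const_smul (-ρ)
  -- The derivative of m · (x·η) along η is m - 2ρ m · (x·η). The first term gives the norm of v,
  -- and the second is exactly what replaces ∂_η v by ∂_η v - ρv.
  have e1 := pairing_dirDeriv_self hΩ hv hη (hmc.mul hlc)
    (c := fun x => expWeight ρ η x + (-2 * ρ) * (expWeight ρ η x * ⟪x, η⟫_ℝ)) (fun x i => by
      rw [fderiv_expWeight_mul_inner]; ring)
  rw [pairing_add_mul_weight hmw hlw hvL hvL] at e1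
  have e2 : (pairing (volume.restrict Ω) (fun x => expWeight ρ η x * ⟪x, η⟫_ℝ)
      (conjDeriv ρ η V v) v).re = (pairing (volume.restrict Ω)
        (fun x => expWeight ρ η x * ⟪x, η⟫_ℝ) (fun x => ∑ i, η i • V i x) v).re -
      ρ * (pairing (volume.restrict Ω) (fun x => expWeight ρ η x * ⟪x, η⟫_ℝ) v v).re := by
    have := pairing_add_left (b := fun x => expWeight ρ η x * ⟪x, η⟫_ℝ) hlw hDL hρL hvL
    rw [pairing_smul_left] at this
    have h3 := congrArg Complex.re this
    rw [Complex.add_re, Complex.smul_re, smul_eq_mul] at h3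
    rw [sub_eq_add_neg, ← neg_mul]
    exact h3
  rw [Complex.add_re, Complex.smul_re, smul_eq_mul] at e1
  have e3 : (pairing (volume.restrict Ω) (expWeight ρ η) v v).re =
      -2 * (pairing (volume.restrict Ω) (fun x => expWeight ρ η x * ⟪x, η⟫_ℝ)
        (conjDeriv ρ η V v) v).re := by
    rw [e2]
    linear_combination e1
  -- Young's inequality is weighted so that half of the norm of v can be absorbed; this produces the
  -- constant 4R².
  have e4 : -2 * (pairing (volume.restrict Ω) (fun x => expWeight ρ η x * ⟪x, η⟫_ℝ)
      (conjDeriv ρ η V v) v).re ≤ 2⁻¹ * (pairing (volume.restrict Ω) (expWeight ρ η) v v).re +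
        2 * R ^ 2 * (pairing (volume.restrict Ω) (expWeight ρ η) (conjDeriv ρ η V v)
          (conjDeriv ρ η V v)).re := by
    rw [pairing_re hlw hXL hvL, pairing_self_re, pairing_self_re, ← integral_const_mul,
      ← integral_const_mul, ← integral_const_mul, ← integral_add
        ((hmw.integrable_mul_norm_sq hvL).const_mul _)
        ((hmw.integrable_mul_norm_sq hXL).const_mul _)]
    refine integral_mono_ae ((hlw.integrable_re hXL hvL).const_mul _)
      (((hmw.integrable_mul_norm_sq hvL).const_mul _).add
        ((hmw.integrable_mul_norm_sq hXL).const_mul _)) ?_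
    filter_upwards [ae_restrict_mem hΩm] with x hx
    have hm := (expWeight_pos ρ η x).le
    have h1 := abs_re_mul_conj_le (conjDeriv ρ η V v x) (v x)
    have h2 : -(⟪x, η⟫_ℝ * (conjDeriv ρ η V v x * starRingEnd ℂ (v x)).re) ≤
        R * (‖conjDeriv ρ η V v x‖ * ‖v x‖) := by
      refine (neg_le_abs _).trans ?_
      rw [abs_mul]
      exact mul_le_mul (hR x hx) h1 (abs_nonneg _) ((abs_nonneg _).trans (hR x hx))
    have h3 : -2 * (⟪x, η⟫_ℝ * (conjDeriv ρ η V v x * starRingEnd ℂ (v x)).re) ≤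
        2⁻¹ * ‖v x‖ ^ 2 + 2 * R ^ 2 * ‖conjDeriv ρ η V v x‖ ^ 2 := by
      nlinarith [sq_nonneg (‖v x‖ - 2 * R * ‖conjDeriv ρ η V v x‖)]
    calc _ = expWeight ρ η x *
          (-2 * (⟪x, η⟫_ℝ * (conjDeriv ρ η V v x * starRingEnd ℂ (v x)).re)) := by ring
      _ ≤ expWeight ρ η x * (2⁻¹ * ‖v x‖ ^ 2 + 2 * R ^ 2 * ‖conjDeriv ρ η V v x‖ ^ 2) :=
        mul_le_mul_of_nonneg_left h3 hm
      _ = _ := by ring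
  linarith

/-- The Carleman estimate for the Laplacian, with the signed boundary term. -/
theorem carleman_laplacian (hΩ : IsBoundedC2Domain Ω) (hv : A.HasTrace v V (fun _ => 0))
    (hV : ∀ i, A.HasTrace (V i) (S i) (G i)) (hS : ∀ i j, S i j =ᵐ[volume.restrict Ω] S j i)
    {η : Eucl n} (hη : ‖η‖ = 1) (ρ : ℝ) :
    4 * ρ ^ 2 * (pairing (volume.restrict Ω) (expWeight ρ η) (conjDeriv ρ η V v)
        (conjDeriv ρ η V v)).re +
      2 * ρ * ∫ x, ⟪outwardNormal Ω x, η⟫_ℝ * expWeight ρ η x *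
        ‖∑ j, outwardNormal Ω x j • G j x‖ ^ 2 ∂A.area ≤
    (pairing (volume.restrict Ω) (expWeight ρ η) (fun x => ∑ i, S i i x)
      (fun x => ∑ i, S i i x)).re := by
  have hmc := contDiff_expWeight ρ η
  have hΩm := hΩ.isOpen.measurableSet
  have hmw := isBddWeight_of_continuous hΩ.isBounded hΩm hmc.continuous
  have hvL := hv.memLp
  have hXL := memLp_conjDeriv hv ρ η
  have hDL : MemLp (fun x => ∑ i, η i • V i x) 2 (volume.restrict Ω) :=
    memLp_finsetSum _ fun i _ => (hv.memLp_grad i).const_smul (η i)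
  have hρL : MemLp (fun x => (-ρ) • v x) 2 (volume.restrict Ω) := hvL.const_smul (-ρ)
  have hLL : MemLp (fun x => ∑ i, S i i x) 2 (volume.restrict Ω) :=
    memLp_finsetSum _ fun i _ => (hV i).memLp_grad i
  have h1 := rellich hΩ hv hV hS hη ρ
  have h2 := pairing_laplacian_self hΩ hv hV η ρ
  have h3 := pairing_dirDeriv_self hΩ hv hη hmc (c := fun x => (-2 * ρ) * expWeight ρ η x)
    (fun x i => by rw [fderiv_expWeight]; ring)
  rw [pairing_smul_weight, Complex.smul_re, smul_eq_mul] at h3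
  have h4 := re_pairing_add_smul_self hmw hDL hvL (-ρ)
  have h5 := congrArg Complex.re (pairing_add_right hmw hLL hDL hρL)
  rw [pairing_smul_right, Complex.add_re, Complex.smul_re, smul_eq_mul] at h5
  -- Δv - 2ρX is e^{ρ x·η} (Δ + ρ²)w. Its squared norm is the nonnegative quantity discarded in the
  -- estimate.
  have h6 := re_pairing_add_smul_self hmw hLL hXL (-2 * ρ)
  have h7 : 0 ≤ (pairing (volume.restrict Ω) (expWeight ρ η)
      (fun x => ∑ i, S i i x + (-2 * ρ) • conjDeriv ρ η V v x)
      (fun x => ∑ i, S i i x + (-2 * ρ) • conjDeriv ρ η V v x)).re := by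
    rw [pairing_self_re]
    exact integral_nonneg fun x => mul_nonneg (expWeight_pos ρ η x).le (sq_nonneg _)
  rw [h6] at h7
  change (pairing _ _ (conjDeriv ρ η V v) (conjDeriv ρ η V v)).re = _ at h4
  change (pairing _ _ _ (conjDeriv ρ η V v)).re = _ at h5
  rw [← h1]
  rw [h5] at h7
  -- By `h3` the pairing of ∂_η v with v is ρ‖v‖², so `h4` reads ‖X‖² = ‖∂_η v‖² minus ρ times that
  -- pairing. Together with `h1` and `h2` this gives 4ρ Re⟨Δv, X⟩ = 8ρ²‖X‖² + 2ρ times the boundary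
  -- integral; inserted in `h7`, it leaves 4ρ²‖X‖².
  linear_combination h7 + 4 * ρ ^ 2 * h2 + 8 * ρ ^ 2 * h4 - 4 * ρ ^ 3 * h3

end BoundaryAtlas

/-! ### The two faces, the potential, and the final estimate. -/

theorem isClosed_shadowedFace (hΩ : IsBoundedC2Domain Ω) (η : Eucl n) :
    IsClosed (shadowedFace Ω η) := by
  obtain ⟨A⟩ := hΩ.nonempty_boundaryAtlas
  have hc : ContinuousOn (fun x => ⟪outwardNormal Ω x, η⟫_ℝ) (frontier Ω) :=
    (A.continuousOn_outwardNormal hΩ.isOpen).inner continuousOn_const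
  exact hc.preimage_isClosed_of_isClosed isClosed_frontier isClosed_Ici

theorem isClosed_illuminatedFace (hΩ : IsBoundedC2Domain Ω) (η : Eucl n) :
    IsClosed (illuminatedFace Ω η) := by
  obtain ⟨A⟩ := hΩ.nonempty_boundaryAtlas
  have hc : ContinuousOn (fun x => ⟪outwardNormal Ω x, η⟫_ℝ) (frontier Ω) :=
    (A.continuousOn_outwardNormal hΩ.isOpen).inner continuousOn_const
  exact hc.preimage_isClosed_of_isClosed isClosed_frontier isClosed_Iic

/-- The faces overlap where ν·η = 0, but the integrand vanishes there. -/
theorem integral_frontier_eq_sub (hΩ : IsBoundedC2Domain Ω) {η : Eucl n} {μ : Measure (Eucl n)}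
    (hμ : ∀ᵐ x ∂μ, x ∈ frontier Ω) {f : Eucl n → ℝ}
    (hf : Integrable (fun x => f x * |⟪η, outwardNormal Ω x⟫_ℝ|) μ) :
    ∫ x, f x * ⟪η, outwardNormal Ω x⟫_ℝ ∂μ =
      ∫ x in shadowedFace Ω η, f x * |⟪η, outwardNormal Ω x⟫_ℝ| ∂μ -
      ∫ x in illuminatedFace Ω η, f x * |⟪η, outwardNormal Ω x⟫_ℝ| ∂μ := by
  have hs := (isClosed_shadowedFace hΩ η).measurableSet
  have hi := (isClosed_illuminatedFace hΩ η).measurableSet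
  rw [← integral_indicator hs, ← integral_indicator hi,
    ← integral_sub (hf.indicator hs) (hf.indicator hi)]
  refine integral_congr_ae ?_
  filter_upwards [hμ] with x hx
  rcases lt_trichotomy ⟪η, outwardNormal Ω x⟫_ℝ 0 with h | h | h
  · have h1 : x ∉ shadowedFace Ω η := fun hc => absurd hc.2 (by rw [real_inner_comm]; exact h.not_ge)
    have h2 : x ∈ illuminatedFace Ω η := ⟨hx, by rw [real_inner_comm]; exact h.le⟩
    rw [Set.indicator_of_notMem h1, Set.indicator_of_mem h2, abs_of_neg h]
    ring
  · have h1 (s : Set (Eucl n)) :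
        s.indicator (fun x => f x * |⟪η, outwardNormal Ω x⟫_ℝ|) x = 0 :=
      Set.indicator_apply_eq_zero.2 fun _ => by simp only [h, abs_zero, mul_zero]
    rw [h1, h1, h, mul_zero, sub_zero]
  · have h1 : x ∈ shadowedFace Ω η := ⟨hx, by rw [real_inner_comm]; exact h.le⟩
    have h2 : x ∉ illuminatedFace Ω η := fun hc => absurd hc.2 (by
      rw [real_inner_comm]; exact h.not_ge)
    rw [Set.indicator_of_mem h1, Set.indicator_of_notMem h2, abs_of_pos h, sub_zero]

theorem setIntegral_le_of_measure_le_smul {μ ν : Measure (Eucl n)} {C : ℝ≥0} (h : μ ≤ C • ν)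
    {f : Eucl n → ℝ} (hf : ∀ x, 0 ≤ f x) (hfi : Integrable f ν) (s : Set (Eucl n)) :
    ∫ x in s, f x ∂μ ≤ C * ∫ x in s, f x ∂ν := by
  have h1 : ∫ x in s, f x ∂μ ≤ ∫ x in s, f x ∂(C • ν) := by
    refine integral_mono_measure (Measure.restrict_mono le_rfl h)
      (Eventually.of_forall hf) ?_
    exact (hfi.smul_measure_nnreal).integrableOn
  refine h1.trans (le_of_eq ?_)
  rw [Measure.restrict_smul, integral_smul_nnreal_measure]
  rfl

/-- With f = Δv, write f = qv - (-f + qv) and use (a + b)² ≤ 2a² + 2b². -/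
theorem integral_sq_le_of_norm_le {μ : Measure (Eucl n)} {b : Eucl n → ℝ} (hb : IsBddWeight μ b)
    (hb0 : ∀ x, 0 ≤ b x) {f v q : Eucl n → ℂ} (hf : MemLp f 2 μ) (hv : MemLp v 2 μ)
    (hqm : AEStronglyMeasurable q μ) {M : ℝ} (hq : ∀ᵐ x ∂μ, ‖q x‖ ≤ M) :
    ∫ x, b x * ‖f x‖ ^ 2 ∂μ ≤ 2 * ∫ x, b x * ‖-f x + q x * v x‖ ^ 2 ∂μ +
      2 * M ^ 2 * ∫ x, b x * ‖v x‖ ^ 2 ∂μ := by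
  have hqv : MemLp (fun x => q x * v x) 2 μ := by
    refine MemLp.of_le_mul (c := M) hv (hqm.mul hv.1) ?_
    filter_upwards [hq] with x hx
    rw [norm_mul]
    gcongr
  have hs : MemLp (fun x => -f x + q x * v x) 2 μ := hf.neg.add hqv
  rw [← integral_const_mul, ← integral_const_mul, ← integral_add
    ((hb.integrable_mul_norm_sq hs).const_mul _) ((hb.integrable_mul_norm_sq hv).const_mul _)]
  refine integral_mono_ae (hb.integrable_mul_norm_sq hf)
    (((hb.integrable_mul_norm_sq hs).const_mul _).add
      ((hb.integrable_mul_norm_sq hv).const_mul _)) ?_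
  filter_upwards [hq] with x hx
  have h1 : ‖f x‖ ≤ ‖-f x + q x * v x‖ + M * ‖v x‖ := by
    calc ‖f x‖ = ‖q x * v x - (-f x + q x * v x)‖ := by congr 1; ring
      _ ≤ ‖q x * v x‖ + ‖-f x + q x * v x‖ := norm_sub_le _ _
      _ ≤ M * ‖v x‖ + ‖-f x + q x * v x‖ := by rw [norm_mul]; gcongr
      _ = _ := add_comm _ _
  have h2 : ‖f x‖ ^ 2 ≤ 2 * ‖-f x + q x * v x‖ ^ 2 + 2 * M ^ 2 * ‖v x‖ ^ 2 := by
    have h3 := pow_le_pow_left₀ (norm_nonneg _) h1 2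
    nlinarith [sq_nonneg (‖-f x + q x * v x‖ - M * ‖v x‖)]
  calc _ ≤ b x * (2 * ‖-f x + q x * v x‖ ^ 2 + 2 * M ^ 2 * ‖v x‖ ^ 2) :=
        mul_le_mul_of_nonneg_left h2 (hb0 x)
    _ = _ := by ring

end CarlemanEstimate

open CarlemanEstimate in
theorem proposition3p3 (n : ℕ) (hn : 3 ≤ n)
    (Ω : Set (CarlemanEstimate.Eucl n)) (hΩ : CarlemanEstimate.IsBoundedC2Domain Ω)
    (η₁ : CarlemanEstimate.Eucl n) (hη₁ : ‖η₁‖ = 1) (M : ℝ≥0) :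
    ∃ C : ℝ, 0 < C ∧ ∀ ρ₁ : ℝ, 0 < ρ₁ → ∃ ρ₂ : ℝ, ρ₁ < ρ₂ ∧
      ∀ q : CarlemanEstimate.Eucl n → ℂ, MemLp q ∞ (volume.restrict Ω) →
        eLpNorm q ∞ (volume.restrict Ω) ≤ (M : ℝ≥0∞) →
      ∀ v : CarlemanEstimate.Eucl n → ℂ,
        CarlemanEstimate.MemH10 Ω v → CarlemanEstimate.MemH2 Ω v →
      ∀ ρ : ℝ, ρ₂ < ρ →
        ρ ^ 2 * (∫ x in Ω, Real.exp (-2 * ρ * ⟪x, η₁⟫_ℝ) * ‖v x‖ ^ 2)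
          + ρ * (∫ x in CarlemanEstimate.shadowedFace Ω η₁,
              Real.exp (-2 * ρ * ⟪x, η₁⟫_ℝ) * ‖CarlemanEstimate.normalDeriv Ω v x‖ ^ 2
                * |⟪η₁, CarlemanEstimate.outwardNormal Ω x⟫_ℝ|
              ∂(CarlemanEstimate.surfaceMeasure Ω))
        ≤ C * ((∫ x in Ω, Real.exp (-2 * ρ * ⟪x, η₁⟫_ℝ)
                * ‖-CarlemanEstimate.weakLaplacian Ω v x + q x * v x‖ ^ 2)
          + ρ * (∫ x in CarlemanEstimate.illuminatedFace Ω η₁,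
              Real.exp (-2 * ρ * ⟪x, η₁⟫_ℝ) * ‖CarlemanEstimate.normalDeriv Ω v x‖ ^ 2
                * |⟪η₁, CarlemanEstimate.outwardNormal Ω x⟫_ℝ|
              ∂(CarlemanEstimate.surfaceMeasure Ω))) := by
  obtain ⟨A⟩ := hΩ.nonempty_boundaryAtlas
  obtain ⟨C₁, hC₁⟩ := A.area_le hΩ.isOpen
  obtain ⟨C₂, hC₂⟩ := A.surfaceMeasure_le hΩ.isOpen
  obtain ⟨R, hR0, hR⟩ : ∃ R : ℝ, 0 < R ∧ ∀ x ∈ Ω, |⟪x, η₁⟫_ℝ| ≤ R := by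
    obtain ⟨R, hR⟩ := hΩ.isBounded.exists_norm_le
    -- The maximum with 1 makes R positive, so that 4R² can be cancelled below.
    refine ⟨max R 1, lt_max_of_lt_right one_pos, fun x hx => ?_⟩
    refine (abs_real_inner_le_norm x η₁).trans ?_
    rw [hη₁, mul_one]
    exact (hR x hx).trans (le_max_left _ _)
  -- 4R² comes from the Poincaré inequality, C₂ and 1 + C₁ from passing between `area` and the
  -- surface measure on the two faces; the last 1 is slack. In ρ₂ the summand 2RM permits absorbing
  -- the potential, and 1 makes ρ₂ exceed ρ₁ strictly.
  refine ⟨(4 * R ^ 2 + C₂) * (1 + C₁) + 1, by positivity, fun ρ₁ hρ₁ =>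
    ⟨ρ₁ + 1 + 2 * R * M, ?_, ?_⟩⟩
  · have : 0 ≤ 2 * R * M := by positivity
    linarith
  intro q hq hqM v hv0 hv2 ρ hρ
  have hM0 : (0 : ℝ) ≤ M := M.2
  have hρM : 2 * R * M ≤ ρ := by linarith
  have hρ0 : 0 < ρ := by
    have : 0 ≤ 2 * R * M := by positivity
    linarith
  have hΩm := hΩ.isOpen.measurableSet
  set G : Fin n → Eucl n → ℂ := fun i => sobolevTrace Ω (weakPartial Ω i v) with hG
  have hv := A.hasTrace_zero_of_memH10 hΩ hv0
  have hV (i : Fin n) : A.HasTrace (weakPartial Ω i v)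
      (fun j => weakPartial Ω j (weakPartial Ω i v)) (G i) :=
    A.hasTrace_of_isSobolevTrace hΩ ((hv2.2 i).isSobolevTrace hΩ)
  have hS := hv2.weakPartial_comm hΩ.isOpen
  have hmw := isBddWeight_of_continuous hΩ.isBounded hΩm (contDiff_expWeight ρ η₁).continuous
  have hcarl := BoundaryAtlas.carleman_laplacian hΩ hv hV hS hη₁ ρ
  have hpoin := BoundaryAtlas.weighted_poincare hΩ hv hη₁ hR ρ
  have hqae : ∀ᵐ x ∂volume.restrict Ω, ‖q x‖ ≤ M := by
    rw [eLpNorm_exponent_top] at hqM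
    filter_upwards [ae_le_eLpNormEssSup (f := q) (μ := volume.restrict Ω)] with x hx
    have h1 := hx.trans hqM
    rw [enorm_eq_nnnorm] at h1
    exact_mod_cast h1
  have hLL : MemLp (weakLaplacian Ω v) 2 (volume.restrict Ω) :=
    memLp_finsetSum _ fun i _ => (hV i).memLp_grad i
  have hpot := integral_sq_le_of_norm_le hmw (fun x => (expWeight_pos ρ η₁ x).le) hLL hv.memLp
    hq.1 hqae
  have hnd (x : Eucl n) : ∑ j, outwardNormal Ω x j • G j x = normalDeriv Ω v x := by
    simp only [normalDeriv, hG, Complex.real_smul]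
  have hNL : MemLp (normalDeriv Ω v) 2 A.area := by
    have h1 : MemLp (fun x => ∑ j, outwardNormal Ω x j • G j x) 2 A.area :=
      memLp_finsetSum _ fun j _ => (A.isBddWeight_area hΩ
        (A.continuousOn_outwardNormal_apply hΩ.isOpen j)).memLp_smul (hV j).memLp_trace
    simpa only [hnd] using h1
  set F : Eucl n → ℝ := fun x => expWeight ρ η₁ x * ‖normalDeriv Ω v x‖ ^ 2 *
    |⟪η₁, outwardNormal Ω x⟫_ℝ| with hF
  have hF0 (x) : 0 ≤ F x :=
    mul_nonneg (mul_nonneg (expWeight_pos ρ η₁ x).le (sq_nonneg _)) (abs_nonneg _)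
  have hFA : Integrable F A.area := by
    have hw : IsBddWeight A.area fun x => expWeight ρ η₁ x * |⟪η₁, outwardNormal Ω x⟫_ℝ| :=
      A.isBddWeight_area hΩ ((contDiff_expWeight ρ η₁).continuous.continuousOn.mul
        (continuousOn_const.inner (A.continuousOn_outwardNormal hΩ.isOpen)).abs)
    refine (hw.integrable_mul_norm_sq hNL).congr (Eventually.of_forall fun x => ?_)
    simp only [hF]
    ring
  have hFS : Integrable F (surfaceMeasure Ω) := hFA.smul_measure_nnreal.mono_measure hC₂
  have hsplit := integral_frontier_eq_sub hΩ (A.ae_area_mem_frontier hΩ.isOpen) (η := η₁) hFA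
  have hbd : ∫ x, ⟪outwardNormal Ω x, η₁⟫_ℝ * expWeight ρ η₁ x *
      ‖∑ j, outwardNormal Ω x j • G j x‖ ^ 2 ∂A.area =
      ∫ x in shadowedFace Ω η₁, F x ∂A.area - ∫ x in illuminatedFace Ω η₁, F x ∂A.area := by
    rw [← hsplit]
    congr 1
    ext x
    rw [hnd, real_inner_comm]
    ring
  have hsh := setIntegral_le_of_measure_le_smul hC₂ hF0 hFA (shadowedFace Ω η₁)
  have hil := setIntegral_le_of_measure_le_smul hC₁ hF0 hFS (illuminatedFace Ω η₁)
  change _ ≤ (pairing _ _ (weakLaplacian Ω v) (weakLaplacian Ω v)).re at hcarl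
  rw [hbd, pairing_self_re (f := weakLaplacian Ω v)] at hcarl
  rw [pairing_self_re (f := v)] at hpoin
  have hvv0 : 0 ≤ ∫ x in Ω, expWeight ρ η₁ x * ‖v x‖ ^ 2 :=
    integral_nonneg fun x => mul_nonneg (expWeight_pos ρ η₁ x).le (sq_nonneg _)
  have hQ0 : 0 ≤ ∫ x in Ω, expWeight ρ η₁ x * ‖-weakLaplacian Ω v x + q x * v x‖ ^ 2 :=
    integral_nonneg fun x => mul_nonneg (expWeight_pos ρ η₁ x).le (sq_nonneg _)
  have hAp0 : 0 ≤ ∫ x in shadowedFace Ω η₁, F x ∂A.area := integral_nonneg hF0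
  have hSm0 : 0 ≤ ∫ x in illuminatedFace Ω η₁, F x ∂(surfaceMeasure Ω) := integral_nonneg hF0
  change ρ ^ 2 * (∫ x in Ω, expWeight ρ η₁ x * ‖v x‖ ^ 2) +
    ρ * (∫ x in shadowedFace Ω η₁, F x ∂(surfaceMeasure Ω)) ≤
    _ * ((∫ x in Ω, expWeight ρ η₁ x * ‖-weakLaplacian Ω v x + q x * v x‖ ^ 2) +
    ρ * (∫ x in illuminatedFace Ω η₁, F x ∂(surfaceMeasure Ω)))
  -- Only real arithmetic remains. Sp and Sm are the shadowed and illuminated integrals for the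
  -- surface measure, Ap and Am those for `area`, and XX is the norm of the conjugated derivative.
  generalize (∫ x in Ω, expWeight ρ η₁ x * ‖v x‖ ^ 2) = vv at *
  generalize (∫ x in Ω, expWeight ρ η₁ x * ‖-weakLaplacian Ω v x + q x * v x‖ ^ 2) = Q at *
  generalize (∫ x in Ω, expWeight ρ η₁ x * ‖weakLaplacian Ω v x‖ ^ 2) = LL at *
  generalize (∫ x in shadowedFace Ω η₁, F x ∂(surfaceMeasure Ω)) = Sp at *
  generalize (∫ x in illuminatedFace Ω η₁, F x ∂(surfaceMeasure Ω)) = Sm at *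
  generalize (∫ x in shadowedFace Ω η₁, F x ∂A.area) = Ap at *
  generalize (∫ x in illuminatedFace Ω η₁, F x ∂A.area) = Am at *
  generalize (pairing (volume.restrict Ω) (expWeight ρ η₁) _ _).re = XX at *
  have hC₁0 : (0 : ℝ) ≤ C₁ := C₁.2
  have hC₂0 : (0 : ℝ) ≤ C₂ := C₂.2
  have hMvv : 4 * R ^ 2 * (M : ℝ) ^ 2 * vv ≤ ρ ^ 2 * vv := by
    refine mul_le_mul_of_nonneg_right ?_ hvv0
    calc 4 * R ^ 2 * (M : ℝ) ^ 2 = (2 * R * M) ^ 2 := by ring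
      _ ≤ ρ ^ 2 := pow_le_pow_left₀ (by positivity) hρM 2
  -- Poincaré, then Carleman, then the bound on LL give ρ² vv + 2R²ρ(Ap - Am) ≤ 2R²Q + 2R²M² vv. By
  -- `hMvv` the last term is at most half of ρ² vv; absorb it and double.
  have hmain : ρ ^ 2 * vv + 4 * R ^ 2 * (ρ * Ap) ≤ 4 * R ^ 2 * (Q + ρ * Am) := by
    have h1 : ρ ^ 2 * vv ≤ R ^ 2 * (4 * ρ ^ 2 * XX) := by
      calc ρ ^ 2 * vv ≤ ρ ^ 2 * (4 * R ^ 2 * XX) := by gcongr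
        _ = _ := by ring
    have h2 : R ^ 2 * (4 * ρ ^ 2 * XX) ≤ R ^ 2 * (2 * Q + 2 * M ^ 2 * vv - 2 * ρ * (Ap - Am)) := by
      refine mul_le_mul_of_nonneg_left ?_ (sq_nonneg R)
      linarith
    linarith
  have hAmSm : ρ * Am ≤ C₁ * (ρ * Sm) := by
    calc ρ * Am ≤ ρ * (C₁ * Sm) := by gcongr
      _ = _ := by ring
  have hSpAp : ρ * Sp ≤ C₂ * (ρ * Ap) := by
    calc ρ * Sp ≤ ρ * (C₂ * Ap) := by gcongr
      _ = _ := by ring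
  -- Dropping ρ² vv from `hmain` bounds the shadowed term alone, with the factor 4R² cancelled. It
  -- is then added with weight C₂ to pay for the surface measure on that face.
  have hAp : ρ * Ap ≤ Q + ρ * Am := by
    have h1 : 0 < 4 * R ^ 2 := by positivity
    have h2 : 4 * R ^ 2 * (ρ * Ap) ≤ 4 * R ^ 2 * (Q + ρ * Am) := by
      have : 0 ≤ ρ ^ 2 * vv := by positivity
      linarith
    exact le_of_mul_le_mul_left h2 h1
  have hρSm : 0 ≤ ρ * Sm := by positivity
  have hρAp : 0 ≤ ρ * Ap := by positivity
  have hT : Q + ρ * Am ≤ (1 + C₁) * (Q + ρ * Sm) := by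
    nlinarith [mul_nonneg hC₁0 hQ0]
  calc ρ ^ 2 * vv + ρ * Sp ≤ 4 * R ^ 2 * (Q + ρ * Am) + C₂ * (Q + ρ * Am) := by
        have h1 := mul_le_mul_of_nonneg_left hAp hC₂0
        have h2 : 0 ≤ 4 * R ^ 2 * (ρ * Ap) := by positivity
        linarith
    _ = (4 * R ^ 2 + C₂) * (Q + ρ * Am) := by ring
    _ ≤ (4 * R ^ 2 + C₂) * ((1 + C₁) * (Q + ρ * Sm)) := by gcongr
    _ ≤ ((4 * R ^ 2 + C₂) * (1 + C₁) + 1) * (Q + ρ * Sm) := by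
        nlinarith [add_nonneg hQ0 hρSm]
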